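/- **Setting.** Let $n\ge 2$, let $U\subset\mathbb R^n$ be a bounded domain, $N\ge 1$, $0=\alpha_0<\alpha_1<\dots<\alpha_N$, $a=\frac{\alpha_N}{\alpha_N+1}\in(0,1)$ and $\kappa_0=\frac{a}{2-a}+\frac12$. Let $\phi:U\to(0,1]$ and $a_0,\dots,a_N:U\to[0,\infty)$ be measurable with $a_0,a_N>0$ and $a_N\in L^1(U)$. Put $g(x,s)=\sum_{j=0}^N a_j(x)s^{\alpha_j}$ and $K(x,\xi)=1/g(x,s(x,\xi))$, where $s(x,\xi)\ge0$ is the unique non-negative solution of $s\,g(x,s)=\xi$, and $$W_1(x)=\frac{a_N(x)^a}{2N\max_j a_j(x)},\qquad \|u\|_{L^q_w}=\Big(\int_U w|u|^q\,dx\Big)^{1/q}.$$ Call $u(x,t)$ *regular* if $u\in C^2((0,\infty);L^2_\phi(U))$ and $\nabla u\in C^1((0,\infty);L^2_{1/a_0}(U))$, where $\nabla u(t)$ and $\nabla u_t(t)=\partial_t\nabla u(t)$ are the weak gradients in $U$ of the locally integrable functions $u(t)$, $u_t(t)$. For $i=1,2$ let $p_i,\Psi_i$ be regular and such that $p_i$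 solves $$\phi\,p_t=\nabla\cdot\big(K(x,|\nabla p|)\nabla p\big)\ \text{ in }U\times(0,\infty),\qquad p=\Psi_i\ \text{ on }\partial U\times(0,\infty),\qquad p(\cdot,0)=p_{0,i}\in L^2_\phi(U),$$ in the following sense: for each $t>0$ the flux $K(x,|\nabla p_i|)\nabla p_i$ is locally integrable in $U$ and the equation holds in the sense of distributions on $U$; for each $t>0$, $\bar p_i:=p_i-\Psi_i$ is a limit of functions in $C_c^\infty(U)$ in the norm $\|u\|_{L^2_\phi}+\|\nabla u\|_{L^2_{1/a_0}}$; and $p_i(t)\to p_{0,i}$ in $L^2_\phi(U)$ as $t\to0^+$. Let $\bar P=\bar p_1-\bar p_2$, $\Phi=\Psi_1-\Psi_2$, and assume that with a constant $c_P>0$ the two-weight Poincaré–Sobolev inequality $$\|u\|_{L^2_\phi}\le c_P\,\|\nabla u\|_{L^{2-a}_{W_1}}$$ holds for $u=\bar p_1(t),\bar p_2(t),\bar P(t)$ and all $t>0$. For $\Psi=\Psi_1,\Psi_2$ let $$G[\Psi](t)=\max\Big\{\int_U a_N dx,1\Big\}+\int_U\frac{|\nabla\Psi|^2}{a_0}dx+\int_U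 W_1|\nabla\Psi|^{2-a}dx+\Big(\int_U|\Psi_t|^2\phi\,dx\Big)^{\frac{2-a}{2(1-a)}},$$ $$G_1[\Psi](t)=\int_U a_0^{-1}|\nabla\Psi_t|^2dx,\qquad G_2[\Psi](t)=\int_U|\Psi_{tt}|^2\phi\,dx,$$ and write $\tilde G,\tilde G_1,\tilde G_2$ for the sums over $\Psi_1,\Psi_2$. Let $$\tilde{\mathcal A}=\sum_{i=1}^2\limsup_{t\to\infty}G[\Psi_i](t),\qquad \tilde{\mathcal B}=\sum_{i=1}^2\limsup_{t\to\infty}\big[(G[\Psi_i])'(t)\big]^-,$$ $$D(t)=\int_U\frac{|\nabla\Phi|^2}{a_0}dx+\Big(\int_U\frac{|\nabla\Phi|^2}{a_0}dx\Big)^{1/2}+\Big(\int_U|\Phi_t|^2\phi\,dx\Big)^{1/2}.$$ Let $V$ be a function given for $t\ge1$ by one of the formulas $$V(t)=\tilde{\mathcal M}(t)^{\frac2{2-a}}+\int_{t-1}^t(\tilde G_1+\tilde G_2)\,d\tau\quad\text{(in general)},$$ $$V(t)=\tilde{\mathcal B}^{\frac1{1-a}}+\tilde G(t)^{\frac2{2-a}}+\int_{t-1}^t(\tilde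 G_1+\tilde G_2)\,d\tau\quad\text{(allowed when }G[\Psi_1],G[\Psi_2]\in C^1((0,\infty))\text{ and }\tilde{\mathcal B}<\infty),$$ where $\tilde{\mathcal M}=\mathcal M_1+\mathcal M_2$ and each $\mathcal M_i$ is any continuous increasing function on $[0,\infty)$ with $\mathcal M_i\ge G[\Psi_i]$. **Theorem.** There is a constant $C>0$, depending only on $U$, $n$, the exponents $\alpha_0,\dots,\alpha_N$ and $c_P$ (not on $\phi$, the coefficients $a_j$, the solutions, or the initial and boundary data), such that the following holds. If $\tilde{\mathcal A}=\infty$, $$\int_1^\infty V(t)^{-\frac a{2-a}}dt=\infty,$$ $V^{\frac{a}{2-a}}$ is differentiable for all large $t$, and $\lim_{t\to\infty}\big(V^{\frac a{2-a}}\big)'(t)=0$, then $$\limsup_{t\to\infty}\|\nabla\bar P(t)\|^2_{L^{2-a}_{W_1}}\le C\limsup_{t\to\infty}\Big[V(t)^{3\kappa_0}D(t)\Big]^{1/2}+C\limsup_{t\to\infty}\Big[V(t)^{\kappa_0}D(t)\Big],$$ where the limits superior are taken in $[0,\infty]$. -/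

import Mathlib

open MeasureTheory Filter Topology Set
open scoped ENNReal ContDiff

noncomputable section

namespace Forchheimer

/-- The space `ℝⁿ` with its Euclidean norm. -/
abbrev E (n : ℕ) := EuclideanSpace ℝ (Fin n)

/-! ## The generalized Forchheimer polynomial and the conductivity `K` -/

section Coefficients

variable {n N : ℕ}

/-- `g(x,s) = a₀(x) s^{α₀} + ⋯ + a_N(x) s^{α_N}`, for `s ≥ 0`. -/
def g (α : Fin (N + 1) → ℝ) (a : Fin (N + 1) → E n → ℝ) (x : E n) (s : ℝ) : ℝ :=
  ∑ j, a j x * s ^ α j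

/-- `s(x,ξ)`: the unique non-negative solution `s` of `s g(x,s) = ξ`
(the set below is a singleton for `ξ ≥ 0` and admissible coefficients). -/
def sSol (α : Fin (N + 1) → ℝ) (a : Fin (N + 1) → E n → ℝ) (x : E n) (ξ : ℝ) : ℝ :=
  sInf {s : ℝ | 0 ≤ s ∧ s * g α a x s = ξ}

/-- `K(x,ξ) = 1 / g(x, s(x,ξ))`. -/
def K (α : Fin (N + 1) → ℝ) (a : Fin (N + 1) → E n → ℝ) (x : E n) (ξ : ℝ) : ℝ :=
  1 / g α a x (sSol α a x ξ)

/-- The exponent `a = α_N / (α_N + 1)`. -/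
def aExp (α : Fin (N + 1) → ℝ) : ℝ := α (Fin.last N) / (α (Fin.last N) + 1)

/-- `κ₀ = a / (2 - a) + 1 / 2`. -/
def kappa0 (α : Fin (N + 1) → ℝ) : ℝ := aExp α / (2 - aExp α) + 1 / 2

/-- `M(x) = max_j a_j(x)`. -/
def maxCoeff (a : Fin (N + 1) → E n → ℝ) (x : E n) : ℝ :=
  Finset.univ.sup' Finset.univ_nonempty fun j => a j x

/-- The weight `W₁(x) = a_N(x)^a / (2 N M(x))`. -/
def W1 (α : Fin (N + 1) → ℝ) (a : Fin (N + 1) → E n → ℝ) (x : E n) : ℝ :=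
  a (Fin.last N) x ^ aExp α / (2 * N * maxCoeff a x)

/-- Admissible porosity and coefficient functions on `U`. The last clause says
`B₁ = ∫_U a_N dx < ∞`. -/
structure IsMedium (U : Set (E n)) (φ : E n → ℝ) (a : Fin (N + 1) → E n → ℝ) : Prop where
  porosity_meas : AEMeasurable φ (volume.restrict U)
  porosity_pos : ∀ x ∈ U, 0 < φ x
  porosity_le : ∀ x ∈ U, φ x ≤ 1
  coeff_meas : ∀ j, AEMeasurable (a j) (volume.restrict U)
  coeff_nonneg : ∀ j, ∀ x ∈ U, 0 ≤ a j x
  coeff_zero_pos : ∀ x ∈ U, 0 < a 0 x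
  coeff_last_pos : ∀ x ∈ U, 0 < a (Fin.last N) x
  coeff_last_int : IntegrableOn (a (Fin.last N)) U

end Coefficients

/-! ## Weighted integrals, weak gradients, regular time-dependent functions -/

section Spaces

variable {n : ℕ}

/-- `∫_U w |u|^q dx`. -/
def wInt {F : Type*} [NormedAddCommGroup F] (U : Set (E n)) (w : E n → ℝ) (q : ℝ)
    (u : E n → F) : ℝ :=
  ∫ x in U, w x * ‖u x‖ ^ q

/-- The weighted norm `‖u‖_{L^q_w(U)} = (∫_U w |u|^q dx)^{1/q}`, with values in `[0,∞]`. -/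
def wNorm {F : Type*} [NormedAddCommGroup F] (U : Set (E n)) (w : E n → ℝ) (q : ℝ)
    (u : E n → F) : ℝ≥0∞ :=
  (∫⁻ x in U, ENNReal.ofReal (w x * ‖u x‖ ^ q)) ^ (1 / q)

/-- The measure `w dx` on `U`; `Lp F 2 (wMeasure U w)` is `L²_w(U)`. -/
def wMeasure (U : Set (E n)) (w : E n → ℝ) : Measure (E n) :=
  (volume.restrict U).withDensity fun x => ENNReal.ofReal (w x)

/-- Test functions `ζ ∈ C_c^∞(U)`. -/
structure IsTest (U : Set (E n)) (ζ : E n → ℝ) : Prop where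
  smooth : ContDiff ℝ ∞ ζ
  compact : HasCompactSupport ζ
  supp : tsupport ζ ⊆ U

/-- `v` is the weak (distributional) gradient of `u` in `U`. -/
structure HasWeakGrad (U : Set (E n)) (u : E n → ℝ) (v : E n → E n) : Prop where
  locInt : LocallyIntegrableOn u U
  locInt_grad : LocallyIntegrableOn v U
  parts : ∀ ζ, IsTest U ζ → ∀ e : E n,
    ∫ x in U, u x * fderiv ℝ ζ x e = - ∫ x in U, inner ℝ (v x) e * ζ x

/-- The pair `(u, ∇u)` lies in the closure of `C_c^∞(U)` with respect to
`‖u‖²_{L²_φ} + ‖∇u‖²_{L²_{1/a₀}}`: the weighted form of "`u = 0` on `∂U`". -/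
def VanishesOnBdry (U : Set (E n)) (φ a₀ : E n → ℝ) (u : E n → ℝ) (gu : E n → E n) : Prop :=
  ∀ ε : ℝ≥0∞, 0 < ε → ∃ ζ, IsTest U ζ ∧
    wNorm U φ 2 (fun x => u x - ζ x) +
      wNorm U (fun x => (a₀ x)⁻¹) 2 (fun x => gu x - gradient ζ x) < ε

/-- `t ↦ u(·,t)` is a `C¹` curve in `L²(μ)` on `(0,∞)` and `u'` is its time derivative. -/
def IsC1Curve {F : Type*} [NormedAddCommGroup F] [NormedSpace ℝ F] (μ : Measure (E n))
    (u u' : ℝ → E n → F) : Prop :=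
  ∃ c c' : ℝ → Lp F 2 μ,
    (∀ t > 0, (c t : E n → F) =ᵐ[μ] u t) ∧ (∀ t > 0, (c' t : E n → F) =ᵐ[μ] u' t) ∧
    (∀ t > 0, HasDerivAt c (c' t) t) ∧ ContinuousOn c' (Ioi 0)

/-- A regular time-dependent function `u(x,t)` together with `u_t`, `u_tt`, `∇u`, `∇u_t`:
`u ∈ C²((0,∞); L²_φ(U))` and `∇u ∈ C¹((0,∞); L²_{1/a₀}(U))`. -/
structure RegFun (U : Set (E n)) (φ a₀ : E n → ℝ) where
  val : ℝ → E n → ℝ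
  dt : ℝ → E n → ℝ
  dtt : ℝ → E n → ℝ
  grad : ℝ → E n → E n
  gradDt : ℝ → E n → E n
  val_curve : IsC1Curve (wMeasure U φ) val dt
  dt_curve : IsC1Curve (wMeasure U φ) dt dtt
  grad_curve : IsC1Curve (wMeasure U fun x => (a₀ x)⁻¹) grad gradDt
  grad_spec : ∀ t > 0, HasWeakGrad U (val t) (grad t)
  gradDt_spec : ∀ t > 0, HasWeakGrad U (dt t) (gradDt t)

end Spaces

/-! ## Solutions of the initial boundary value problem -/

section Problem

variable {n N : ℕ} {U : Set (E n)} {φ : E n → ℝ} {a : Fin (N + 1) → E n → ℝ}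

/-- `p` solves `φ p_t = ∇·(K(x,|∇p|)∇p)` in `U × (0,∞)` (for each `t > 0`, in the sense of
distributions on `U`), `p = Ψ` on `∂U × (0,∞)`, and `p(·,0) = p₀`. -/
structure IsSolution (α : Fin (N + 1) → ℝ) (p Ψ : RegFun U φ (a 0)) (p₀ : E n → ℝ) : Prop where
  flux_locInt : ∀ t > 0,
    LocallyIntegrableOn (fun x => K α a x ‖p.grad t x‖ • p.grad t x) U
  pde : ∀ t > 0, ∀ ζ, IsTest U ζ →
    ∫ x in U, φ x * p.dt t x * ζ x =
      - ∫ x in U, K α a x ‖p.grad t x‖ * inner ℝ (p.grad t x) (gradient ζ x)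
  bdry : ∀ t > 0, VanishesOnBdry U φ (a 0)
    (fun x => p.val t x - Ψ.val t x) (fun x => p.grad t x - Ψ.grad t x)
  init_mem : MemLp p₀ 2 (wMeasure U φ)
  init : Tendsto (fun t => wNorm U φ 2 (fun x => p.val t x - p₀ x)) (𝓝[>] 0) (𝓝 0)

/-- The weighted Poincaré–Sobolev inequality
`(∫_U u² φ dx)^{1/2} ≤ c_P (∫_U W₁ |∇u|^{2-a} dx)^{1/(2-a)}` for one function `u`. -/
def PoincareSobolev (U : Set (E n)) (φ : E n → ℝ) (α : Fin (N + 1) → ℝ)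
    (a : Fin (N + 1) → E n → ℝ) (cP : ℝ) (u : E n → ℝ) (gu : E n → E n) : Prop :=
  wNorm U φ 2 u ≤ ENNReal.ofReal cP * wNorm U (W1 α a) (2 - aExp α) gu

/-- `G[Ψ](t)`, where `B_* = max{∫_U a_N dx, 1}`. -/
def G (α : Fin (N + 1) → ℝ) (Ψ : RegFun U φ (a 0)) (t : ℝ) : ℝ :=
  max (∫ x in U, a (Fin.last N) x) 1
    + wInt U (fun x => (a 0 x)⁻¹) 2 (Ψ.grad t)
    + wInt U (W1 α a) (2 - aExp α) (Ψ.grad t)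
    + wInt U φ 2 (Ψ.dt t) ^ ((2 - aExp α) / (2 * (1 - aExp α)))

/-- `G₁[Ψ](t) = ∫_U a₀⁻¹ |∇Ψ_t|² dx`. -/
def G1 (Ψ : RegFun U φ (a 0)) (t : ℝ) : ℝ := wInt U (fun x => (a 0 x)⁻¹) 2 (Ψ.gradDt t)

/-- `G₂[Ψ](t) = ∫_U |Ψ_tt|² φ dx`. -/
def G2 (Ψ : RegFun U φ (a 0)) (t : ℝ) : ℝ := wInt U φ 2 (Ψ.dtt t)

/-- `𝓐[Ψ] = limsup_{t→∞} G[Ψ](t) ∈ [0,∞]`. -/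
def limA (α : Fin (N + 1) → ℝ) (Ψ : RegFun U φ (a 0)) : ℝ≥0∞ :=
  limsup (fun t => ENNReal.ofReal (G α Ψ t)) atTop

/-- `𝓑[Ψ] = limsup_{t→∞} [G[Ψ]'(t)]⁻ ∈ [0,∞]`. -/
def limB (α : Fin (N + 1) → ℝ) (Ψ : RegFun U φ (a 0)) : ℝ≥0∞ :=
  limsup (fun t => ENNReal.ofReal (-deriv (G α Ψ) t)) atTop

/-- `𝓜` is a continuous increasing function on `[0,∞)` with `𝓜 ≥ G[Ψ]`. -/
structure IsMajorant (α : Fin (N + 1) → ℝ) (Ψ : RegFun U φ (a 0)) (M : ℝ → ℝ) : Prop where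
  cont : ContinuousOn M (Ici 0)
  mono : MonotoneOn M (Ici 0)
  ge : ∀ t, 0 ≤ t → G α Ψ t ≤ M t

/-- `∫_{t-1}^t (G̃₁(τ) + G̃₂(τ)) dτ`. -/
def intG12 (Ψ₁ Ψ₂ : RegFun U φ (a 0)) (t : ℝ) : ℝ :=
  ∫ τ in (t - 1)..t, ((G1 Ψ₁ τ + G1 Ψ₂ τ) + (G2 Ψ₁ τ + G2 Ψ₂ τ))

/-- `V` is given by the general formula, for some choice of the majorants `𝓜[Ψ₁]`, `𝓜[Ψ₂]`. -/
def IsGeneralV (α : Fin (N + 1) → ℝ) (Ψ₁ Ψ₂ : RegFun U φ (a 0)) (V : ℝ → ℝ) : Prop :=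
  ∃ M₁ M₂ : ℝ → ℝ, IsMajorant α Ψ₁ M₁ ∧ IsMajorant α Ψ₂ M₂ ∧
    ∀ t, 1 ≤ t → V t = (M₁ t + M₂ t) ^ (2 / (2 - aExp α)) + intG12 Ψ₁ Ψ₂ t

/-- `G[Ψ₁], G[Ψ₂] ∈ C¹((0,∞))`, `𝓑̃ = 𝓑[Ψ₁] + 𝓑[Ψ₂] < ∞`, and `V` is given by the formula for
that case. -/
def IsFiniteBV (α : Fin (N + 1) → ℝ) (Ψ₁ Ψ₂ : RegFun U φ (a 0)) (V : ℝ → ℝ) : Prop :=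
  ContDiffOn ℝ 1 (G α Ψ₁) (Ioi 0) ∧ ContDiffOn ℝ 1 (G α Ψ₂) (Ioi 0) ∧
  limB α Ψ₁ + limB α Ψ₂ < ⊤ ∧
    ∀ t, 1 ≤ t → V t = (limB α Ψ₁ + limB α Ψ₂).toReal ^ (1 / (1 - aExp α))
      + (G α Ψ₁ t + G α Ψ₂ t) ^ (2 / (2 - aExp α)) + intG12 Ψ₁ Ψ₂ t

/-- `D(t) = ∫ a₀⁻¹|∇Φ|² + (∫ a₀⁻¹|∇Φ|²)^{1/2} + (∫ |Φ_t|² φ)^{1/2}` with `Φ = Ψ₁ - Ψ₂`. -/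
def D (Ψ₁ Ψ₂ : RegFun U φ (a 0)) (t : ℝ) : ℝ :=
  wInt U (fun x => (a 0 x)⁻¹) 2 (fun x => Ψ₁.grad t x - Ψ₂.grad t x)
    + wInt U (fun x => (a 0 x)⁻¹) 2 (fun x => Ψ₁.grad t x - Ψ₂.grad t x) ^ (1 / 2 : ℝ)
    + wInt U φ 2 (fun x => Ψ₁.dt t x - Ψ₂.dt t x) ^ (1 / 2 : ℝ)

/-- `p̄ = p - Ψ`. -/
def bar (p Ψ : RegFun U φ (a 0)) (t : ℝ) (x : E n) : ℝ := p.val t x - Ψ.val t x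

/-- `∇p̄ = ∇p - ∇Ψ`. -/
def gradBar (p Ψ : RegFun U φ (a 0)) (t : ℝ) (x : E n) : E n := p.grad t x - Ψ.grad t x

end Problem

end Forchheimer

end

open Forchheimer

/-! The flux v = K(x,|y|)y is the inverse of the explicit map v ↦ g(x,|v|)v, so K is never
differentiated: monotonicity, Lipschitz bounds and convexity are all read off from g at |v|. Taking
f = a₀·flux in L²_{1/a₀} turns the problem into an abstract monotone evolution (`Flow`) between two
Hilbert spaces, and the energy estimates become scalar computations.

One solution. Testing with p̄ and using the Poincaré inequality gives y' ≤ -c y^{(2-a)/2} + C G for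
y = ‖p̄‖². Comparison with a barrier bounds y for large times by M^{2/(2-a)} when G lies below an
increasing unbounded M (`exists_eventually_le_of_monotone`), or by G^{2/(2-a)} + β^{1/(1-a)} when
eventually G' ≥ -β (`exists_eventually_le_of_deriv_ge`). Smoothing over a unit time interval
(`Flow.Controlled.size_le`) extends the bound to the dissipation and to ‖p̄_t‖². Hence V eventually
dominates all three quantities, with a constant independent of the data (`exists_size_le_V`).

Two solutions. Let γ = a/(2-a), y = ‖P̄‖², and let Z be the squared norm of ∇P̄. Hölder's inequality
with weight 1/g gives Z ≤ C Λ^γ (S + ∫|∇Φ|²/a₀), where S pairs the difference of the fluxes with the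
difference of the gradients and Λ ≤ C V (`wNorm_W1_gradBar_sub_sq_le`). Subtracting the equations
expresses S through -y'/2 and an error of order V^{1/2} D, so Z ≤ C V^γ (-y' + C V^{1/2} D). With y
≤ C Z this is a linear inequality with damping rate V^{-γ}.

To gain decay (`limsup_le_of_differential_inequality`), consider w = V^{2κ₀} y. The derivative of
its weight is absorbed because (V^γ)' → 0, and what remains is w' ≤ -V^{-γ}(c w - C V^{3κ₀} D). As
V^{-γ} has infinite integral, limsup w ≤ C limsup V^{3κ₀} D. Finally |y'| ≤ C V^{1/2} y^{1/2},
inserted into the bound for Z, leaves Z ≤ C (w^{1/2} + V^{κ₀} D), which is the claim. -/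

noncomputable section

namespace Forchheimer

/-! ## Pointwise properties of the Forchheimer polynomial and the flux -/

section Pointwise

variable {n N : ℕ}

/-- Admissible exponents `0 = α₀ < ⋯ < α_N`, `N ≥ 1`. -/
structure AdmissibleExp (α : Fin (N + 1) → ℝ) : Prop where
  one_le : 1 ≤ N
  zero : α 0 = 0
  mono : StrictMono α

/-- The coefficients are admissible at the point `x`. -/
structure AdmissibleAt (a : Fin (N + 1) → E n → ℝ) (x : E n) : Prop where
  nonneg : ∀ j, 0 ≤ a j x
  zero_pos : 0 < a 0 x
  last_pos : 0 < a (Fin.last N) x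

theorem IsMedium.admissibleAt {U : Set (E n)} {φ : E n → ℝ} {a : Fin (N + 1) → E n → ℝ}
    (hm : IsMedium U φ a) {x : E n} (hx : x ∈ U) : AdmissibleAt a x :=
  ⟨fun j => hm.coeff_nonneg j x hx, hm.coeff_zero_pos x hx, hm.coeff_last_pos x hx⟩

variable {α : Fin (N + 1) → ℝ} {a : Fin (N + 1) → E n → ℝ} {x : E n}

namespace AdmissibleExp

theorem nonneg (hα : AdmissibleExp α) (j : Fin (N + 1)) : 0 ≤ α j := by
  rw [← hα.zero]; exact hα.mono.monotone (Fin.zero_le j)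

theorem le_last (hα : AdmissibleExp α) (j : Fin (N + 1)) : α j ≤ α (Fin.last N) :=
  hα.mono.monotone (Fin.le_last j)

theorem last_pos (hα : AdmissibleExp α) : 0 < α (Fin.last N) := by
  rw [← hα.zero]; exact hα.mono (by rw [Fin.lt_def]; exact hα.one_le)

theorem pos_of_ne (hα : AdmissibleExp α) {j : Fin (N + 1)} (hj : j ≠ 0) : 0 < α j := by
  rw [← hα.zero]; exact hα.mono (Fin.pos_of_ne_zero hj)

theorem aExp_pos (hα : AdmissibleExp α) : 0 < aExp α := by
  have := hα.last_pos; unfold aExp; positivity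

theorem aExp_lt_one (hα : AdmissibleExp α) : aExp α < 1 := by
  have := hα.last_pos; unfold aExp; rw [div_lt_one (by positivity)]; linarith

end AdmissibleExp

theorem g_nonneg (ha : AdmissibleAt a x) {s : ℝ} (hs : 0 ≤ s) : 0 ≤ g α a x s :=
  Finset.sum_nonneg fun j _ => mul_nonneg (ha.nonneg j) (Real.rpow_nonneg hs _)

theorem zero_le_g (hα : AdmissibleExp α) (ha : AdmissibleAt a x) {s : ℝ} (hs : 0 ≤ s) :
    a 0 x ≤ g α a x s := by
  have := Finset.single_le_sum (f := fun j => a j x * s ^ α j)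
    (fun j _ => mul_nonneg (ha.nonneg j) (Real.rpow_nonneg hs _)) (Finset.mem_univ 0)
  simpa [hα.zero, g] using this

theorem g_pos (hα : AdmissibleExp α) (ha : AdmissibleAt a x) {s : ℝ} (hs : 0 ≤ s) :
    0 < g α a x s := ha.zero_pos.trans_le (zero_le_g hα ha hs)

theorem g_mono (hα : AdmissibleExp α) (ha : AdmissibleAt a x) {s t : ℝ} (hs : 0 ≤ s)
    (hst : s ≤ t) : g α a x s ≤ g α a x t :=
  Finset.sum_le_sum fun j _ => mul_le_mul_of_nonneg_left
    (Real.rpow_le_rpow hs hst (hα.nonneg j)) (ha.nonneg j)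

theorem g_zero (hα : AdmissibleExp α) : g α a x 0 = a 0 x := by
  unfold g
  rw [Finset.sum_eq_single 0]
  · simp [hα.zero]
  · intro j _ hj
    rw [Real.zero_rpow (hα.pos_of_ne hj).ne', mul_zero]
  · simp

theorem continuous_g (hα : AdmissibleExp α) : Continuous (g α a x) :=
  continuous_finsetSum _ fun j _ => continuous_const.mul (Real.continuous_rpow_const (hα.nonneg j))

/-- The defining set is closed and bounded below, and it is nonempty by the intermediate value
theorem on [0, ξ/a₀], because g ≥ a₀. So the infimum is attained, and uniqueness of the root is not
needed. -/
theorem sSol_spec (hα : AdmissibleExp α) (ha : AdmissibleAt a x) {ξ : ℝ} (hξ : 0 ≤ ξ) :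
    0 ≤ sSol α a x ξ ∧ sSol α a x ξ * g α a x (sSol α a x ξ) = ξ := by
  set f : ℝ → ℝ := fun s => s * g α a x s
  have hf : Continuous f := continuous_id.mul (continuous_g hα)
  have hclosed : IsClosed {s : ℝ | 0 ≤ s ∧ s * g α a x s = ξ} :=
    (isClosed_le continuous_const continuous_id).inter (isClosed_eq hf continuous_const)
  have hne : {s : ℝ | 0 ≤ s ∧ s * g α a x s = ξ}.Nonempty := by
    have hb : 0 ≤ ξ / a 0 x := div_nonneg hξ ha.zero_pos.le
    have := intermediate_value_Icc hb hf.continuousOn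
    obtain ⟨s, hs, hs'⟩ := this (show ξ ∈ Icc (f 0) (f (ξ / a 0 x)) by
      refine ⟨by simpa [f] using hξ, ?_⟩
      calc ξ = ξ / a 0 x * a 0 x := by field_simp [ha.zero_pos.ne']
        _ ≤ _ := mul_le_mul_of_nonneg_left (zero_le_g hα ha hb) hb)
    exact ⟨s, hs.1, hs'⟩
  exact hclosed.csInf_mem hne ⟨0, fun s hs => hs.1⟩

/-- The flux `K(x,|y|) y`. -/
def flux (α : Fin (N + 1) → ℝ) (a : Fin (N + 1) → E n → ℝ) (x y : E n) : E n :=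
  K α a x ‖y‖ • y

/-- K(ξ)ξ = ξ/g(s) = s. This trades the implicit K for the explicit g evaluated at the length of the
flux. -/
theorem norm_flux (hα : AdmissibleExp α) (ha : AdmissibleAt a x) (y : E n) :
    ‖flux α a x y‖ = sSol α a x ‖y‖ := by
  obtain ⟨h0, h1⟩ := sSol_spec hα ha (norm_nonneg y)
  have hg := g_pos hα ha h0
  rw [flux, norm_smul, K, Real.norm_of_nonneg (by positivity)]
  nth_rewrite 2 [← h1]
  field_simp

/-- The flux is inverse to `v ↦ g(x,|v|) v`. -/
theorem g_smul_flux (hα : AdmissibleExp α) (ha : AdmissibleAt a x) (y : E n) :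
    g α a x ‖flux α a x y‖ • flux α a x y = y := by
  rw [norm_flux hα ha, flux, K, smul_smul, mul_one_div_cancel, one_smul]
  exact (g_pos hα ha (sSol_spec hα ha (norm_nonneg y)).1).ne'

/-- `h(x,s) = ∑ⱼ aⱼ (αⱼ+1)/(αⱼ+2) s^{αⱼ+2}`; `2 h(x,|flux|)` is `∫₀^{|y|²} K(x,√r) dr`. -/
def potential (α : Fin (N + 1) → ℝ) (a : Fin (N + 1) → E n → ℝ) (x : E n) (s : ℝ) : ℝ :=
  ∑ j, a j x * ((α j + 1) / (α j + 2) * s ^ (α j + 2))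

theorem sq_mul_g (hα : AdmissibleExp α) {s : ℝ} (hs : 0 ≤ s) :
    s ^ 2 * g α a x s = ∑ j, a j x * s ^ (α j + 2) := by
  unfold g
  rw [Finset.mul_sum]
  refine Finset.sum_congr rfl fun j _ => ?_
  rw [Real.rpow_add_of_nonneg hs (hα.nonneg j) (by norm_num)]
  norm_cast
  ring

/-- The factors (αⱼ+1)/(αⱼ+2) lie between 1/2 and 1. Together with `le_two_potential` this makes the
potential comparable to the dissipation density. -/
theorem potential_le (hα : AdmissibleExp α) (ha : AdmissibleAt a x) {s : ℝ} (hs : 0 ≤ s) :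
    potential α a x s ≤ s ^ 2 * g α a x s := by
  rw [sq_mul_g hα hs]
  refine Finset.sum_le_sum fun j _ => mul_le_mul_of_nonneg_left ?_ (ha.nonneg j)
  have := hα.nonneg j
  refine mul_le_of_le_one_left (Real.rpow_nonneg hs _) ?_
  rw [div_le_one (by positivity)]; linarith

theorem le_two_potential (hα : AdmissibleExp α) (ha : AdmissibleAt a x) {s : ℝ} (hs : 0 ≤ s) :
    s ^ 2 * g α a x s ≤ 2 * potential α a x s := by
  rw [sq_mul_g hα hs, potential, Finset.mul_sum]
  refine Finset.sum_le_sum fun j _ => ?_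
  rw [mul_left_comm]
  refine mul_le_mul_of_nonneg_left ?_ (ha.nonneg j)
  have := hα.nonneg j
  rw [← mul_assoc]
  refine le_mul_of_one_le_left (Real.rpow_nonneg hs _) ?_
  rw [mul_div_assoc', one_le_div (by positivity)]; linarith

/-- An identity for arbitrary scalars that isolates a multiple of the squared distance. The
remaining term is nonnegative as soon as b, c are ordered like |v|, |w|. -/
theorem inner_g_smul_sub (v w : E n) (b c : ℝ) :
    inner ℝ (w - v) (c • w - b • v)
      = (c + b) / 2 * ‖w - v‖ ^ 2 + (c - b) / 2 * (‖w‖ ^ 2 - ‖v‖ ^ 2) := by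
  rw [norm_sub_sq_real]
  simp only [inner_sub_left, inner_sub_right, inner_smul_right, real_inner_self_eq_norm_sq,
    real_inner_comm w v]
  ring

/-- Monotonicity of `v ↦ g(x,|v|) v`. -/
theorem half_g_mul_le_inner (hα : AdmissibleExp α) (ha : AdmissibleAt a x) (v w : E n) :
    (g α a x ‖w‖ + g α a x ‖v‖) / 2 * ‖w - v‖ ^ 2
      ≤ inner ℝ (w - v) (g α a x ‖w‖ • w - g α a x ‖v‖ • v) := by
  rw [inner_g_smul_sub]
  have : 0 ≤ (g α a x ‖w‖ - g α a x ‖v‖) / 2 * (‖w‖ ^ 2 - ‖v‖ ^ 2) := by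
    rcases le_total ‖v‖ ‖w‖ with h | h
    · have h1 := g_mono hα ha (norm_nonneg v) h
      have h2 := pow_le_pow_left₀ (norm_nonneg v) h 2
      exact mul_nonneg (by linarith) (by linarith)
    · have h1 := g_mono hα ha (norm_nonneg w) h
      have h2 := pow_le_pow_left₀ (norm_nonneg w) h 2
      exact mul_nonneg_of_nonpos_of_nonpos (by linarith) (by linarith)
  linarith

/-- Monotonicity of the inverse map, applied at the two fluxes, with both values of g bounded below
by a₀. -/
theorem flux_cocoercive (hα : AdmissibleExp α) (ha : AdmissibleAt a x) (y z : E n) :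
    a 0 x * ‖flux α a x z - flux α a x y‖ ^ 2
      ≤ inner ℝ (flux α a x z - flux α a x y) (z - y) := by
  have h := half_g_mul_le_inner hα ha (flux α a x y) (flux α a x z)
  rw [g_smul_flux hα ha, g_smul_flux hα ha] at h
  refine le_trans (mul_le_mul_of_nonneg_right ?_ (sq_nonneg _)) h
  linarith [zero_le_g hα ha (norm_nonneg (flux α a x y)),
    zero_le_g hα ha (norm_nonneg (flux α a x z))]

theorem inner_flux_self (hα : AdmissibleExp α) (ha : AdmissibleAt a x) (y : E n) :
    inner ℝ (flux α a x y) y = ‖flux α a x y‖ ^ 2 * g α a x ‖flux α a x y‖ := by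
  nth_rewrite 2 [← g_smul_flux hα ha y]
  rw [inner_smul_right, real_inner_self_eq_norm_sq]
  ring

/-- Bernoulli's inequality when β ≥ 1, and r ≤ r^β when β ≤ 1. -/
theorem one_sub_rpow_le {r β : ℝ} (h0 : 0 ≤ r) (h1 : r ≤ 1) (hβ : 0 ≤ β) :
    1 - r ^ β ≤ (1 + β) * (1 - r) := by
  rcases le_total 1 β with h | h
  · have := one_add_mul_self_le_rpow_one_add (s := r - 1) (by linarith) h
    rw [add_sub_cancel] at this
    nlinarith
  · have : r ≤ r ^ β := by
      rcases h0.eq_or_lt with rfl | h0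
      · exact Real.rpow_nonneg le_rfl _
      · simpa using Real.rpow_le_rpow_of_exponent_ge h0 h1 h
    nlinarith

/-- By homogeneity this is `one_sub_rpow_le` at r = s/t, after one factor s is enlarged to t. -/
theorem rpow_sub_rpow_mul_le {s t β : ℝ} (hs : 0 ≤ s) (hst : s ≤ t) (hβ : 0 ≤ β) :
    (t ^ β - s ^ β) * s ≤ (1 + β) * t ^ β * (t - s) := by
  rcases (hs.trans hst).eq_or_lt with rfl | ht
  · obtain rfl : s = 0 := le_antisymm hst hs
    simp
  have hr0 : 0 ≤ s / t := by positivity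
  have hr1 : s / t ≤ 1 := (div_le_one ht).2 hst
  have h := one_sub_rpow_le hr0 hr1 hβ
  have hsr : s ^ β = (s / t) ^ β * t ^ β := by
    rw [← Real.mul_rpow hr0 ht.le, div_mul_cancel₀ _ ht.ne']
  have htβ : 0 ≤ t ^ β := Real.rpow_nonneg ht.le _
  calc (t ^ β - s ^ β) * s = t ^ β * s * (1 - (s / t) ^ β) := by rw [hsr]; ring
    _ ≤ t ^ β * s * ((1 + β) * (1 - s / t)) := by gcongr
    _ ≤ t ^ β * t * ((1 + β) * (1 - s / t)) := by
        have : 0 ≤ (1 + β) * (1 - s / t) := mul_nonneg (by linarith) (by linarith)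
        gcongr
    _ = _ := by field_simp

theorem g_sub_mul_le (hα : AdmissibleExp α) (ha : AdmissibleAt a x) {s t : ℝ} (hs : 0 ≤ s)
    (hst : s ≤ t) :
    (g α a x t - g α a x s) * s ≤ (1 + α (Fin.last N)) * g α a x t * (t - s) := by
  unfold g
  rw [← Finset.sum_sub_distrib, Finset.sum_mul, Finset.mul_sum, Finset.sum_mul]
  refine Finset.sum_le_sum fun j _ => ?_
  have h1 := rpow_sub_rpow_mul_le hs hst (hα.nonneg j)
  have h2 := hα.le_last j
  have h3 : 0 ≤ t ^ α j := Real.rpow_nonneg (hs.trans hst) _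
  have h4 := ha.nonneg j
  have h5 : 0 ≤ t - s := sub_nonneg.2 hst
  calc (a j x * t ^ α j - a j x * s ^ α j) * s = a j x * ((t ^ α j - s ^ α j) * s) := by ring
    _ ≤ a j x * ((1 + α j) * t ^ α j * (t - s)) := by gcongr
    _ ≤ a j x * ((1 + α (Fin.last N)) * t ^ α j * (t - s)) := by gcongr
    _ = _ := by ring

/-- The difference splits as g(|w|)(w-v) + (g(|w|)-g(|v|))v, and `g_sub_mul_le` controls the second
part. The Lipschitz constant is thus a multiple of g at the larger of the two fluxes. -/
theorem norm_g_smul_sub_le (hα : AdmissibleExp α) (ha : AdmissibleAt a x) {v w : E n}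
    (h : ‖v‖ ≤ ‖w‖) :
    ‖g α a x ‖w‖ • w - g α a x ‖v‖ • v‖
      ≤ (2 + α (Fin.last N)) * g α a x ‖w‖ * ‖w - v‖ := by
  have hg := g_nonneg (α := α) ha (norm_nonneg w)
  have hm := g_mono hα ha (norm_nonneg v) h
  have h1 := g_sub_mul_le hα ha (norm_nonneg v) h
  have h2 : ‖w‖ - ‖v‖ ≤ ‖w - v‖ := norm_sub_norm_le w v
  have hl := hα.last_pos
  calc ‖g α a x ‖w‖ • w - g α a x ‖v‖ • v‖
      = ‖g α a x ‖w‖ • (w - v) + (g α a x ‖w‖ - g α a x ‖v‖) • v‖ := by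
        congr 1; module
    _ ≤ g α a x ‖w‖ * ‖w - v‖ + (g α a x ‖w‖ - g α a x ‖v‖) * ‖v‖ := by
        refine (norm_add_le _ _).trans_eq ?_
        rw [norm_smul, norm_smul, Real.norm_of_nonneg hg, Real.norm_of_nonneg (sub_nonneg.2 hm)]
    _ ≤ g α a x ‖w‖ * ‖w - v‖ + (1 + α (Fin.last N)) * g α a x ‖w‖ * ‖w - v‖ := by
        refine add_le_add_right (h1.trans ?_) _
        gcongr
    _ = _ := by ring

/-- The squared Lipschitz bound for v ↦ g(|v|)v costs g² times the squared flux difference;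
monotonicity of the same map pays back one factor g. -/
theorem norm_sq_le_inner_flux_of_le (hα : AdmissibleExp α) (ha : AdmissibleAt a x) {y z : E n}
    (h : ‖flux α a x y‖ ≤ ‖flux α a x z‖) :
    ‖z - y‖ ^ 2 ≤ 2 * (2 + α (Fin.last N)) ^ 2 * g α a x ‖flux α a x z‖ *
      inner ℝ (flux α a x z - flux α a x y) (z - y) := by
  have h1 := norm_g_smul_sub_le hα ha h
  have h2 := half_g_mul_le_inner hα ha (flux α a x y) (flux α a x z)
  rw [g_smul_flux hα ha, g_smul_flux hα ha] at h1 h2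
  have hg := g_nonneg (α := α) ha (norm_nonneg (flux α a x z))
  have hg' := g_nonneg (α := α) ha (norm_nonneg (flux α a x y))
  have hl := hα.last_pos
  calc ‖z - y‖ ^ 2
      ≤ ((2 + α (Fin.last N)) * g α a x ‖flux α a x z‖ * ‖flux α a x z - flux α a x y‖) ^ 2 := by
        gcongr
    -- The `+ 0` occupies the place of g at the smaller flux, which monotonicity provides and which
    -- is discarded.
    _ = 2 * (2 + α (Fin.last N)) ^ 2 * g α a x ‖flux α a x z‖ *
          ((g α a x ‖flux α a x z‖ + 0) / 2 * ‖flux α a x z - flux α a x y‖ ^ 2) := by ring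
    _ ≤ _ := by
        gcongr
        refine le_trans ?_ h2
        gcongr

/-- Quantitative monotonicity of the flux. -/
theorem norm_sq_div_g_le_inner_flux (hα : AdmissibleExp α) (ha : AdmissibleAt a x) (y z : E n) :
    ‖z - y‖ ^ 2 / g α a x (max ‖flux α a x y‖ ‖flux α a x z‖)
      ≤ 2 * (2 + α (Fin.last N)) ^ 2 * inner ℝ (flux α a x z - flux α a x y) (z - y) := by
  rw [div_le_iff₀ (g_pos hα ha (le_max_of_le_left (norm_nonneg _)))]
  rcases le_total ‖flux α a x y‖ ‖flux α a x z‖ with h | h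
  · rw [max_eq_right h]
    linarith [norm_sq_le_inner_flux_of_le hα ha h]
  · rw [max_eq_left h]
    have := norm_sq_le_inner_flux_of_le hα ha h
    rw [norm_sub_rev, ← neg_sub (flux α a x z), ← neg_sub z, inner_neg_neg] at this
    linarith

/-- The potential is convex as a function of `y`, with gradient the flux. -/
theorem inner_flux_sub_le_potential (hα : AdmissibleExp α) (ha : AdmissibleAt a x) (y z : E n) :
    inner ℝ (flux α a x y) (z - y)
      ≤ potential α a x ‖flux α a x z‖ - potential α a x ‖flux α a x y‖ := by
  have hy := inner_flux_self hα ha y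
  set s := ‖flux α a x y‖
  have hs : 0 ≤ s := norm_nonneg _
  set t := ‖flux α a x z‖
  have ht : 0 ≤ t := norm_nonneg _
  have hz : ‖z‖ = g α a x t * t := by
    conv_lhs => rw [← g_smul_flux hα ha z, norm_smul, Real.norm_of_nonneg (g_nonneg ha ht)]
  have h1 : inner ℝ (flux α a x y) z ≤ s * (g α a x t * t) := by
    rw [← hz]; exact real_inner_le_norm _ _
  rw [inner_sub_right, hy, sq_mul_g hα hs]
  refine (sub_le_sub_right h1 _).trans ?_
  simp only [g, potential]
  rw [Finset.sum_mul, Finset.mul_sum, ← Finset.sum_sub_distrib, ← Finset.sum_sub_distrib]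
  refine Finset.sum_le_sum fun j _ => ?_
  have hj := hα.nonneg j
  -- Young's inequality for s·t^{αⱼ+1}, term by term. With these exponents both powers become αⱼ+2,
  -- and the weight of the t-power is exactly the coefficient in the potential.
  have hconj : (α j + 2).HolderConjugate ((α j + 2) / (α j + 1)) := by
    rw [Real.holderConjugate_iff]
    refine ⟨by linarith, ?_⟩
    field_simp
    ring
  have hY := Real.young_inequality_of_nonneg hs (Real.rpow_nonneg ht (α j + 1)) hconj
  have e1 : (t ^ (α j + 1)) ^ ((α j + 2) / (α j + 1)) = t ^ (α j + 2) := by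
    rw [← Real.rpow_mul ht]; congr 1; field_simp
  have e2 : t ^ (α j + 1) = t ^ α j * t := by
    rw [Real.rpow_add_of_nonneg ht hj zero_le_one, Real.rpow_one]
  rw [e1, e2] at hY
  have e3 : s ^ (α j + 2) / (α j + 2) = s ^ (α j + 2) - (α j + 1) / (α j + 2) * s ^ (α j + 2) := by
    field_simp; ring
  have e4 : t ^ (α j + 2) / ((α j + 2) / (α j + 1)) = (α j + 1) / (α j + 2) * t ^ (α j + 2) := by
    field_simp
  rw [e3, e4] at hY
  nlinarith [ha.nonneg j]

/-! ### The weight W₁ -/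

theorem le_maxCoeff (j : Fin (N + 1)) : a j x ≤ maxCoeff a x :=
  Finset.le_sup' (fun j => a j x) (Finset.mem_univ j)

theorem W1_nonneg (ha : AdmissibleAt a x) : 0 ≤ W1 α a x := by
  have := le_maxCoeff (a := a) (x := x) 0
  have := ha.zero_pos
  exact div_nonneg (Real.rpow_nonneg ha.last_pos.le _)
    (mul_nonneg (by positivity) (by linarith))

/-- The bound on the weight `W₁` that makes Hölder's inequality with the weight `1/g` work. -/
theorem W1_rpow_mul_g_rpow_le (hα : AdmissibleExp α) (ha : AdmissibleAt a x) {s : ℝ}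
    (hs : 0 ≤ s) :
    W1 α a x ^ (2 / aExp α) * g α a x s ^ ((2 - aExp α) / aExp α)
      ≤ s ^ 2 * g α a x s + a (Fin.last N) x := by
  have hb := hα.aExp_pos
  have hb1 := hα.aExp_lt_one
  have hg := g_pos hα ha hs
  have hM : 0 < maxCoeff a x := ha.zero_pos.trans_le (le_maxCoeff 0)
  have hN : (1 : ℝ) ≤ N := by exact_mod_cast hα.one_le
  set m : ℝ := 2 * N * maxCoeff a x with hm
  have hm0 : 0 < m := by positivity
  set A := a (Fin.last N) x
  have hA : 0 < A := ha.last_pos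
  have hAm : A ≤ m := by
    have := le_maxCoeff (a := a) (x := x) (Fin.last N)
    nlinarith
  have hW : W1 α a x ^ (2 / aExp α) = A ^ 2 / m ^ (2 / aExp α) := by
    rw [W1, Real.div_rpow (Real.rpow_nonneg hA.le _) hm0.le, ← Real.rpow_mul hA.le,
      mul_div_cancel₀ _ hb.ne']
    norm_cast
  have hgm : ∀ r : ℝ, 0 ≤ r → (∀ j, s ^ α j ≤ r) → g α a x s ≤ m * r := by
    intro r hr h
    calc g α a x s ≤ ∑ j : Fin (N + 1), maxCoeff a x * r :=
          Finset.sum_le_sum fun j _ =>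
            mul_le_mul (le_maxCoeff j) (h j) (Real.rpow_nonneg hs _) hM.le
      _ = (N + 1) * (maxCoeff a x * r) := by simp
      -- The sum has N+1 ≤ 2N terms; this is what the factor 2N in W₁ pays for.
      _ ≤ (2 * N) * (maxCoeff a x * r) := by
          have : 0 ≤ maxCoeff a x * r := by positivity
          gcongr; linarith
      _ = m * r := by rw [hm]; ring
  have hexp : 2 / aExp α = (2 - aExp α) / aExp α + 1 := by field_simp; ring
  have hexp0 : 0 ≤ (2 - aExp α) / aExp α := div_nonneg (by linarith) hb.le
  -- For s ≤ 1, g ≤ m and the left side is at most A²/m ≤ A. For s ≥ 1, g ≤ m s^{α_N}; one factor g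
  -- is kept and the other 2/a - 2 powers are estimated.
  rcases le_total s 1 with h1 | h1
  · have hle := hgm 1 zero_le_one fun j => Real.rpow_le_one hs h1 (hα.nonneg j)
    rw [mul_one] at hle
    have h2 : W1 α a x ^ (2 / aExp α) * g α a x s ^ ((2 - aExp α) / aExp α) ≤ A := by
      calc _ ≤ A ^ 2 / m ^ (2 / aExp α) * m ^ ((2 - aExp α) / aExp α) := by
            rw [hW]; gcongr
        _ = A ^ 2 / m := by
            rw [hexp, Real.rpow_add hm0, Real.rpow_one]
            have := Real.rpow_pos_of_pos hm0 ((2 - aExp α) / aExp α)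
            field_simp
        _ ≤ A := by rw [div_le_iff₀ hm0]; nlinarith
    have : 0 ≤ s ^ 2 * g α a x s := by positivity
    linarith
  · have hs0 : 0 < s := by linarith
    have hle := hgm (s ^ α (Fin.last N)) (Real.rpow_nonneg hs _) fun j =>
      Real.rpow_le_rpow_of_exponent_le h1 (hα.le_last j)
    have hexp2 : (2 - aExp α) / aExp α = (2 / aExp α - 2) + 1 := by field_simp; ring
    have hexp3 : 0 ≤ 2 / aExp α - 2 := by
      rw [sub_nonneg, le_div_iff₀ hb]; linarith
    -- Here the choice a = α_N/(α_N+1) enters: the estimated powers of g contribute exactly s².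
    have hexp4 : α (Fin.last N) * (2 / aExp α - 2) = 2 := by
      have := hα.last_pos
      unfold aExp; field_simp; ring
    have h2 : W1 α a x ^ (2 / aExp α) * g α a x s ^ ((2 - aExp α) / aExp α)
        ≤ s ^ 2 * g α a x s := by
      calc _ = A ^ 2 / m ^ (2 / aExp α) * (g α a x s ^ (2 / aExp α - 2) * g α a x s) := by
            rw [hW, hexp2, Real.rpow_add hg, Real.rpow_one]
        _ ≤ A ^ 2 / m ^ (2 / aExp α) *
              ((m * s ^ α (Fin.last N)) ^ (2 / aExp α - 2) * g α a x s) := by gcongr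
        _ = A ^ 2 / m ^ 2 * (s ^ 2 * g α a x s) := by
            rw [Real.mul_rpow hm0.le (Real.rpow_nonneg hs _), ← Real.rpow_mul hs, hexp4]
            have e : m ^ (2 / aExp α) = m ^ (2 / aExp α - 2) * m ^ 2 := by
              rw [← Real.rpow_natCast m 2, ← Real.rpow_add hm0]; congr 1; push_cast; ring
            have := Real.rpow_pos_of_pos hm0 (2 / aExp α - 2)
            rw [e, Real.rpow_two]
            field_simp
        _ ≤ 1 * (s ^ 2 * g α a x s) := by
            gcongr
            rw [div_le_one (by positivity)]
            gcongr
        _ = _ := one_mul _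
    linarith

end Pointwise

/-! ## Energy inequalities for abstract monotone flows -/

section AbstractFlow

open scoped RealInnerProductSpace

variable {H X : Type*} [NormedAddCommGroup H] [InnerProductSpace ℝ H]
  [NormedAddCommGroup X] [InnerProductSpace ℝ X]

/-- An abstract version of `u_t = ∇·f`, `f = A(y)`, `y = ∇u`, with `A` the cocoercive gradient of
a convex functional `j`, and with boundary values `ψ`, `η = ∇ψ`. -/
structure Flow (H X : Type*) [NormedAddCommGroup H] [InnerProductSpace ℝ H]
    [NormedAddCommGroup X] [InnerProductSpace ℝ X] where
  (u u' u'' ψ ψ' ψ'' : ℝ → H)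
  (y y' η η' f : ℝ → X)
  j : ℝ → ℝ
  hasDerivAt_u : ∀ t > 0, HasDerivAt u (u' t) t
  hasDerivAt_u' : ∀ t > 0, HasDerivAt u' (u'' t) t
  hasDerivAt_ψ : ∀ t > 0, HasDerivAt ψ (ψ' t) t
  hasDerivAt_ψ' : ∀ t > 0, HasDerivAt ψ' (ψ'' t) t
  hasDerivAt_y : ∀ t > 0, HasDerivAt y (y' t) t
  hasDerivAt_η : ∀ t > 0, HasDerivAt η (η' t) t
  continuousOn_ψ'' : ContinuousOn ψ'' (Ioi 0)
  continuousOn_η' : ContinuousOn η' (Ioi 0)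
  cocoercive : ∀ s > 0, ∀ t > 0, ‖f s - f t‖ ^ 2 ≤ ⟪f s - f t, y s - y t⟫
  norm_f_sq_le : ∀ t > 0, ‖f t‖ ^ 2 ≤ ⟪f t, y t⟫
  le_j_sub : ∀ s > 0, ∀ t > 0, ⟪f t, y s - y t⟫ ≤ j s - j t
  j_le : ∀ t > 0, j t ≤ ⟪f t, y t⟫
  le_two_j : ∀ t > 0, ⟪f t, y t⟫ ≤ 2 * j t
  weak : ∀ s > 0, ∀ t > 0, ⟪u' s, u t - ψ t⟫ = -⟪f s, y t - η t⟫

theorem inner_deriv_eq_of_inner_eq {U : H} {f : X} {w : ℝ → H} {z : ℝ → X} {w' : H} {z' : X}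
    {t : ℝ} (ht : 0 < t) (h : ∀ t > 0, ⟪U, w t⟫ = -⟪f, z t⟫) (hw : HasDerivAt w w' t)
    (hz : HasDerivAt z z' t) : ⟪U, w'⟫ = -⟪f, z'⟫ := by
  have h1 : HasDerivAt (fun s => ⟪U, w s⟫) ⟪U, w'⟫ t := by
    simpa using (hasDerivAt_const t U).inner ℝ hw
  have h2 : HasDerivAt (fun s => -⟪f, z s⟫) (-⟪f, z'⟫) t := by
    simpa using ((hasDerivAt_const t f).inner ℝ hz).fun_neg
  refine h1.unique (h2.congr_of_eventuallyEq ?_)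
  filter_upwards [lt_mem_nhds ht] with s hs using h s hs

namespace Flow

variable (F : Flow H X)

/-- `∫ K(x,|∇p|) |∇p|² dx`. -/
def diss (t : ℝ) : ℝ := ⟪F.f t, F.y t⟫

/-- `‖p - Ψ‖² + ∫ K(x,|∇p|) |∇p|² dx + ‖(p - Ψ)_t‖²`. -/
def size (t : ℝ) : ℝ := ‖F.u t - F.ψ t‖ ^ 2 + F.diss t + ‖F.u' t - F.ψ' t‖ ^ 2

/-- The sum of the two source terms `G₁ + G₂`. -/
def source (t : ℝ) : ℝ := ‖F.η' t‖ ^ 2 + ‖F.ψ'' t‖ ^ 2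

variable {F}

theorem diss_nonneg {t : ℝ} (ht : 0 < t) : 0 ≤ F.diss t :=
  (sq_nonneg _).trans (F.norm_f_sq_le t ht)

/-- The two times in `weak` are independent, so the relation can be differentiated in the test
function alone. Thus p̄_t is an admissible test function without any separate boundary condition on
it. -/
theorem weak_deriv {s t : ℝ} (hs : 0 < s) (ht : 0 < t) :
    ⟪F.u' s, F.u' t - F.ψ' t⟫ = -⟪F.f s, F.y' t - F.η' t⟫ :=
  inner_deriv_eq_of_inner_eq ht (F.weak s hs)
    ((F.hasDerivAt_u t ht).sub (F.hasDerivAt_ψ t ht))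
    ((F.hasDerivAt_y t ht).sub (F.hasDerivAt_η t ht))

theorem hasDerivAt_energy {t : ℝ} (ht : 0 < t) :
    HasDerivAt (fun t => ‖F.u t - F.ψ t‖ ^ 2)
      (2 * ⟪F.u t - F.ψ t, F.u' t - F.ψ' t⟫) t :=
  ((F.hasDerivAt_u t ht).sub (F.hasDerivAt_ψ t ht)).norm_sq

theorem hasDerivAt_energy_deriv {t : ℝ} (ht : 0 < t) :
    HasDerivAt (fun t => ‖F.u' t - F.ψ' t‖ ^ 2)
      (2 * ⟪F.u' t - F.ψ' t, F.u'' t - F.ψ'' t⟫) t :=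
  ((F.hasDerivAt_u' t ht).sub (F.hasDerivAt_ψ' t ht)).norm_sq

/-- Cocoercivity and Cauchy–Schwarz. -/
theorem norm_f_sub_le {s t : ℝ} (hs : 0 < s) (ht : 0 < t) :
    ‖F.f s - F.f t‖ ≤ ‖F.y s - F.y t‖ := by
  have h := (F.cocoercive s hs t ht).trans (real_inner_le_norm _ _)
  rcases (norm_nonneg (F.f s - F.f t)).eq_or_lt with h0 | h0
  · rw [← h0]; exact norm_nonneg _
  · nlinarith

/-- Convexity, used at both times, squeezes j(s) - j(t) - ⟪f(t), y(s)-y(t)⟫ between 0 and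
⟪f(s)-f(t), y(s)-y(t)⟫ ≤ ‖y(s)-y(t)‖² = O((s-t)²). So the chain rule holds although f is not known
to be differentiable. -/
theorem hasDerivAt_j {t : ℝ} (ht : 0 < t) : HasDerivAt F.j ⟪F.f t, F.y' t⟫ t := by
  have hy := F.hasDerivAt_y t ht
  have h1 : HasDerivAt (fun s => ⟪F.f t, F.y s⟫) ⟪F.f t, F.y' t⟫ t := by
    simpa using (hasDerivAt_const t (F.f t)).inner ℝ hy
  have h2 : HasDerivAt (fun s => F.j s - ⟪F.f t, F.y s⟫) 0 t := by
    rw [hasDerivAt_iff_isLittleO]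
    have hO : (fun s => F.y s - F.y t) =O[𝓝 t] fun s => s - t := hy.isBigO_sub
    have hO2 : (fun s => ‖F.y s - F.y t‖ ^ 2) =O[𝓝 t] fun s => (s - t) ^ 2 := hO.norm_left.pow 2
    have ho : (fun s => (s - t) ^ 2) =o[𝓝 t] fun s => s - t := by
      have : (fun s : ℝ => s - t) =o[𝓝 t] fun _ => (1 : ℝ) := by
        rw [Asymptotics.isLittleO_one_iff]
        have : Tendsto (fun s : ℝ => s - t) (𝓝 t) (𝓝 (t - t)) := by
          exact (continuous_id.sub continuous_const).tendsto t
        simpa using this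
      simpa [pow_two] using this.mul_isBigO (Asymptotics.isBigO_refl (fun s : ℝ => s - t) _)
    refine (Asymptotics.IsBigO.trans_isLittleO ?_ (hO2.trans_isLittleO ho))
    refine Asymptotics.IsBigO.of_bound 1 ?_
    filter_upwards [lt_mem_nhds ht] with s hs
    have e1 := F.le_j_sub s hs t ht
    have e2 := F.le_j_sub t ht s hs
    have e3 : ⟪F.f s - F.f t, F.y s - F.y t⟫ ≤ ‖F.y s - F.y t‖ ^ 2 := by
      refine (real_inner_le_norm _ _).trans ?_
      rw [pow_two]
      exact mul_le_mul_of_nonneg_right (norm_f_sub_le hs ht) (norm_nonneg _)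
    simp only [inner_sub_left, inner_sub_right] at e1 e2 e3
    rw [one_mul, smul_zero, sub_zero, Real.norm_of_nonneg (by linarith), Real.norm_of_nonneg (sq_nonneg _)]
    linarith
  simpa using h2.fun_add h1

/-- Bounds on the boundary data and the Poincaré inequality, in terms of a function `G`. -/
structure Controlled (F : Flow H X) (b C₀ : ℝ) (G : ℝ → ℝ) : Prop where
  one_le : ∀ t > 0, 1 ≤ G t
  norm_η_sq_le : ∀ t > 0, ‖F.η t‖ ^ 2 ≤ G t
  norm_ψ'_rpow_le : ∀ t > 0, ‖F.ψ' t‖ ^ ((2 - b) / (1 - b)) ≤ G t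
  poincare : ∀ t > 0, ‖F.u t - F.ψ t‖ ^ (2 - b) ≤ C₀ * (F.diss t + G t)

/-- The constant in Young's inequality `2pq ≤ δ q^{2-b} + C p^{(2-b)/(1-b)}`. -/
def youngConst (b δ : ℝ) : ℝ :=
  (2 / (δ * (2 - b)) ^ (1 / (2 - b))) ^ ((2 - b) / (1 - b)) / ((2 - b) / (1 - b))

theorem youngConst_nonneg {b δ : ℝ} (hb1 : b < 1) (hδ : 0 < δ) : 0 ≤ youngConst b δ := by
  unfold youngConst
  have : 0 < 2 - b := by linarith
  have : 0 < 1 - b := by linarith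
  positivity

/-- Young's inequality after rescaling q by l with l^{2-b} = δ(2-b), which puts the coefficient δ in
front of q^{2-b}. -/
theorem two_mul_le_young {b δ p q : ℝ} (hb1 : b < 1) (hδ : 0 < δ) (hp : 0 ≤ p) (hq : 0 ≤ q) :
    2 * p * q ≤ δ * q ^ (2 - b) + youngConst b δ * p ^ ((2 - b) / (1 - b)) := by
  have h2 : 0 < 2 - b := by linarith
  have h1 : 0 < 1 - b := by linarith
  have hconj : (2 - b).HolderConjugate ((2 - b) / (1 - b)) := by
    rw [Real.holderConjugate_iff]
    refine ⟨by linarith, ?_⟩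
    field_simp
    ring
  set l := (δ * (2 - b)) ^ (1 / (2 - b)) with hl
  have hl0 : 0 < l := by positivity
  have hlr : l ^ (2 - b) = δ * (2 - b) := by
    rw [hl, ← Real.rpow_mul (by positivity), one_div_mul_cancel h2.ne', Real.rpow_one]
  have h := Real.young_inequality_of_nonneg (a := l * q) (b := 2 / l * p) (by positivity)
    (by positivity) hconj
  rw [Real.mul_rpow hl0.le hq, Real.mul_rpow (by positivity) hp, hlr] at h
  calc 2 * p * q = l * q * (2 / l * p) := by field_simp
    _ ≤ _ := h
    _ = _ := by rw [youngConst, ← hl]; field_simp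

/-! ### Energy inequalities and smoothing for one flow -/

variable {b C₀ : ℝ} {G : ℝ → ℝ}

/-- The constant of the energy inequality. -/
def energyConst (b C₀ : ℝ) : ℝ := 5 / 2 + youngConst b (1 / (2 * C₀))

theorem energyConst_pos (hb1 : b < 1) (hC₀ : 0 < C₀) : 0 < energyConst b C₀ := by
  have := youngConst_nonneg (δ := 1 / (2 * C₀)) hb1 (by positivity)
  unfold energyConst; positivity

/-- The equation is tested with p̄. The choice δ = 1/(2C₀) in Young's inequality lets the Poincaré
inequality return the p̄-term as a fraction of the dissipation. -/
theorem Controlled.energy_le (hF : F.Controlled b C₀ G) (hb1 : b < 1) (hC₀ : 0 < C₀)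
    {t : ℝ} (ht : 0 < t) :
    2 * ⟪F.u t - F.ψ t, F.u' t - F.ψ' t⟫ ≤ -F.diss t + energyConst b C₀ * G t := by
  have h1 : ⟪F.u t - F.ψ t, F.u' t - F.ψ' t⟫
      = -F.diss t + ⟪F.f t, F.η t⟫ - ⟪F.ψ' t, F.u t - F.ψ t⟫ := by
    rw [real_inner_comm, inner_sub_left, F.weak t ht t ht, inner_sub_right, diss]
    ring
  have h2 : ⟪F.f t, F.η t⟫ ≤ ‖F.f t‖ * ‖F.η t‖ := real_inner_le_norm _ _
  have h3 : -⟪F.ψ' t, F.u t - F.ψ t⟫ ≤ ‖F.ψ' t‖ * ‖F.u t - F.ψ t‖ := by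
    rw [← inner_neg_left, ← norm_neg (F.ψ' t)]; exact real_inner_le_norm _ _
  have h4 := F.norm_f_sq_le t ht
  have h5 := hF.norm_η_sq_le t ht
  have hY := two_mul_le_young (δ := 1 / (2 * C₀)) hb1 (by positivity) (norm_nonneg (F.ψ' t))
    (norm_nonneg (F.u t - F.ψ t))
  have h6 : 1 / (2 * C₀) * ‖F.u t - F.ψ t‖ ^ (2 - b) ≤ 1 / 2 * (F.diss t + G t) := by
    calc _ ≤ 1 / (2 * C₀) * (C₀ * (F.diss t + G t)) := by
          gcongr; exact hF.poincare t ht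
      _ = _ := by field_simp
  have h7 := mul_le_mul_of_nonneg_left (hF.norm_ψ'_rpow_le t ht)
    (youngConst_nonneg (δ := 1 / (2 * C₀)) hb1 (by positivity))
  have h8 : F.diss t = ⟪F.f t, F.y t⟫ := rfl
  rw [h1]
  unfold energyConst
  -- Of the dissipation 2·diss, one half goes to the η-term at the price 2G and one half to the
  -- ψ'-term at the price G/2 plus the Young constant; hence the 5/2 in `energyConst`.
  nlinarith [sq_nonneg (‖F.f t‖ - 2 * ‖F.η t‖)]

/-- Spending the remaining dissipation on the Poincaré inequality gives a differential inequality
closed in ‖p̄‖². -/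
theorem Controlled.energy_le_rpow (hF : F.Controlled b C₀ G) (hb1 : b < 1) (hC₀ : 0 < C₀)
    {t : ℝ} (ht : 0 < t) :
    2 * ⟪F.u t - F.ψ t, F.u' t - F.ψ' t⟫
      ≤ -(1 / C₀) * (‖F.u t - F.ψ t‖ ^ 2) ^ ((2 - b) / 2) + (energyConst b C₀ + 1) * G t := by
  have h1 := hF.energy_le hb1 hC₀ ht
  have h2 := hF.poincare t ht
  have h3 : (‖F.u t - F.ψ t‖ ^ 2) ^ ((2 - b) / 2) = ‖F.u t - F.ψ t‖ ^ (2 - b) := by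
    rw [← Real.rpow_natCast, ← Real.rpow_mul (norm_nonneg _)]; congr 1; push_cast; ring
  rw [h3]
  have h4 : 1 / C₀ * ‖F.u t - F.ψ t‖ ^ (2 - b) ≤ F.diss t + G t := by
    rw [one_div, inv_mul_le_iff₀ hC₀]; exact h2
  linarith

/-- The exponent (2-b)/(1-b) is at least 2, and G ≥ 1 covers small values of ψ'. -/
theorem Controlled.norm_ψ'_sq_le (hF : F.Controlled b C₀ G) (hb0 : 0 < b) (hb1 : b < 1)
    {t : ℝ} (ht : 0 < t) : ‖F.ψ' t‖ ^ 2 ≤ G t := by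
  rcases le_total ‖F.ψ' t‖ 1 with h | h
  · exact (pow_le_one₀ (norm_nonneg _) h).trans (hF.one_le t ht)
  · refine le_trans ?_ (hF.norm_ψ'_rpow_le t ht)
    rw [← Real.rpow_natCast]
    refine Real.rpow_le_rpow_of_exponent_le h ?_
    rw [le_div_iff₀ (by linarith)]; push_cast; linarith

/-- The equation is tested with p̄_t, and ⟪f, y'⟫ is the derivative of j. -/
theorem Controlled.j_deriv_le (hF : F.Controlled b C₀ G) (hb0 : 0 < b) (hb1 : b < 1)
    {t : ℝ} (ht : 0 < t) :
    ⟪F.f t, F.y' t⟫ ≤ -(1 / 2) * ‖F.u' t - F.ψ' t‖ ^ 2 + 1 / 2 * F.diss t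
      + 1 / 2 * ‖F.η' t‖ ^ 2 + 1 / 2 * G t := by
  have h1 := weak_deriv (F := F) ht ht
  have h2 : ‖F.u' t - F.ψ' t‖ ^ 2 = ⟪F.u' t, F.u' t - F.ψ' t⟫ - ⟪F.ψ' t, F.u' t - F.ψ' t⟫ := by
    rw [← inner_sub_left, real_inner_self_eq_norm_sq]
  rw [inner_sub_right (F.f t)] at h1
  have h3 : ⟪F.f t, F.η' t⟫ ≤ ‖F.f t‖ * ‖F.η' t‖ := real_inner_le_norm _ _
  have h4 : -⟪F.ψ' t, F.u' t - F.ψ' t⟫ ≤ ‖F.ψ' t‖ * ‖F.u' t - F.ψ' t‖ := by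
    rw [← inner_neg_left, ← norm_neg (F.ψ' t)]; exact real_inner_le_norm _ _
  have h5 := hF.norm_ψ'_sq_le hb0 hb1 ht
  have h6 : ‖F.f t‖ ^ 2 ≤ F.diss t := F.norm_f_sq_le t ht
  nlinarith [sq_nonneg (‖F.f t‖ - ‖F.η' t‖), sq_nonneg (‖F.ψ' t‖ - ‖F.u' t - F.ψ' t‖)]

/-- Formally, the time derivative of the equation is tested with p̄_t, and monotonicity gives ⟪f',
y'⟫ ≥ ‖f'‖². As f need not be differentiable, the argument runs on difference quotients and only the
final inequality is passed to the limit. -/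
theorem inner_u''_le {t : ℝ} (ht : 0 < t) :
    ⟪F.u'' t, F.u' t - F.ψ' t⟫ ≤ 1 / 2 * ‖F.η' t‖ ^ 2 := by
  have hu : Tendsto (slope F.u' t) (𝓝[≠] t) (𝓝 (F.u'' t)) := (F.hasDerivAt_u' t ht).tendsto_slope
  have hy : Tendsto (slope F.y t) (𝓝[≠] t) (𝓝 (F.y' t)) := (F.hasDerivAt_y t ht).tendsto_slope
  have h1 : Tendsto (fun s => ⟪slope F.u' t s, F.u' t - F.ψ' t⟫) (𝓝[≠] t)
      (𝓝 ⟪F.u'' t, F.u' t - F.ψ' t⟫) := hu.inner tendsto_const_nhds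
  have h2 : Tendsto (fun s => 1 / 2 * ‖F.η' t‖ ^ 2 + 1 / 2 * ‖slope F.y t s - F.y' t‖ ^ 2)
      (𝓝[≠] t) (𝓝 (1 / 2 * ‖F.η' t‖ ^ 2 + 1 / 2 * ‖F.y' t - F.y' t‖ ^ 2)) :=
    (((hy.sub tendsto_const_nhds).norm.pow 2).const_mul _).const_add _
  rw [sub_self, norm_zero] at h2
  have h3 := le_of_tendsto_of_tendsto h1 h2 (by
    filter_upwards [nhdsWithin_le_nhds (lt_mem_nhds ht), self_mem_nhdsWithin] with s hs hst
    have e1 : ⟪slope F.u' t s, F.u' t - F.ψ' t⟫ = -⟪slope F.f t s, F.y' t - F.η' t⟫ := by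
      rw [slope_def_module, slope_def_module, real_inner_smul_left, real_inner_smul_left,
        inner_sub_left, inner_sub_left, weak_deriv hs ht, weak_deriv ht ht]
      ring
    have e2 : ‖slope F.f t s‖ ^ 2 ≤ ⟪slope F.f t s, slope F.y t s⟫ := by
      rw [slope_def_module, slope_def_module, real_inner_smul_left, real_inner_smul_right,
        norm_smul, mul_pow, Real.norm_eq_abs, sq_abs, pow_two, mul_assoc]
      have := F.cocoercive s hs t ht
      rw [← mul_assoc, ← mul_assoc]
      exact mul_le_mul_of_nonneg_left this (mul_self_nonneg _)
    have e3 : ⟪slope F.f t s, F.η' t⟫ ≤ ‖slope F.f t s‖ * ‖F.η' t‖ := real_inner_le_norm _ _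
    have e4 : ⟪slope F.f t s, slope F.y t s - F.y' t⟫
        ≤ ‖slope F.f t s‖ * ‖slope F.y t s - F.y' t‖ := real_inner_le_norm _ _
    rw [e1, inner_sub_right]
    rw [inner_sub_right] at e4
    -- Cocoercivity supplies -‖slope f‖², split evenly between the η' term and the error slope y -
    -- y', which vanishes in the limit.
    nlinarith [sq_nonneg (‖slope F.f t s‖ - ‖F.η' t‖),
      sq_nonneg (‖slope F.f t s‖ - ‖slope F.y t s - F.y' t‖)])
  linarith

theorem energy_deriv_le {t : ℝ} (ht : 0 < t) :
    2 * ⟪F.u' t - F.ψ' t, F.u'' t - F.ψ'' t⟫ ≤ F.source t + ‖F.u' t - F.ψ' t‖ ^ 2 := by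
  have h1 := inner_u''_le (F := F) ht
  have h2 : -⟪F.ψ'' t, F.u' t - F.ψ' t⟫ ≤ ‖F.ψ'' t‖ * ‖F.u' t - F.ψ' t‖ := by
    rw [← inner_neg_left, ← norm_neg (F.ψ'' t)]; exact real_inner_le_norm _ _
  rw [real_inner_comm, inner_sub_left, source]
  nlinarith [sq_nonneg (‖F.ψ'' t‖ - ‖F.u' t - F.ψ' t‖)]

theorem continuousOn_source : ContinuousOn F.source (Ioi 0) :=
  (F.continuousOn_η'.norm.pow 2).add (F.continuousOn_ψ''.norm.pow 2)

theorem source_nonneg (t : ℝ) : 0 ≤ F.source t := by unfold source; positivity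

theorem intervalIntegrable_source {s t : ℝ} (hs : 0 < s) (ht : 0 < t) :
    IntervalIntegrable F.source volume s t :=
  (continuousOn_source.mono fun _ hx => (lt_min hs ht).trans_le hx.1).intervalIntegrable

theorem hasDerivAt_integral_source {s t : ℝ} (hs : 0 < s) (ht : 0 < t) :
    HasDerivAt (fun t => ∫ τ in s..t, F.source τ) (F.source t) t :=
  intervalIntegral.integral_hasDerivAt_right (intervalIntegrable_source hs ht)
    (continuousOn_source.stronglyMeasurableAtFilter isOpen_Ioi t ht)
    (continuousOn_source.continuousAt (Ioi_mem_nhds ht))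

/-- Smoothing over a unit time interval. -/
theorem Controlled.size_le (hF : F.Controlled b C₀ G) (hb0 : 0 < b) (hb1 : b < 1) (hC₀ : 0 < C₀)
    {t m : ℝ} (ht : 1 < t) (hm : ∀ τ ∈ Icc (t - 1) t, G τ ≤ m) :
    F.size t ≤ 9 * ‖F.u (t - 1) - F.ψ (t - 1)‖ ^ 2 + (9 * energyConst b C₀ + 3) * m
      + 4 * ∫ τ in (t - 1)..t, F.source τ := by
  have ht0 : 0 < t - 1 := by linarith
  set c := 9 * energyConst b C₀ + 3
  have hc := energyConst_pos hb1 hC₀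
  -- With r = τ-(t-1), the factors r and r² remove j and p̄_t at the initial time. The weights
  -- balance: 6j + 3r·diss ≤ 9·diss is paid by the energy, the term -3r‖p̄_t‖² coming from 6r·j'
  -- pays for 2r + r², and 4·source covers 3r‖η'‖² + r²·source.
  set W : ℝ → ℝ := fun τ => 9 * ‖F.u τ - F.ψ τ‖ ^ 2 + 6 * ((τ - (t - 1)) * F.j τ)
    + (τ - (t - 1)) ^ 2 * ‖F.u' τ - F.ψ' τ‖ ^ 2 - c * m * τ
    - 4 * ∫ r in (t - 1)..τ, F.source r with hW
  set W' : ℝ → ℝ := fun τ => 9 * (2 * ⟪F.u τ - F.ψ τ, F.u' τ - F.ψ' τ⟫)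
    + 6 * (1 * F.j τ + (τ - (t - 1)) * ⟪F.f τ, F.y' τ⟫)
    + (2 * (τ - (t - 1)) * ‖F.u' τ - F.ψ' τ‖ ^ 2
      + (τ - (t - 1)) ^ 2 * (2 * ⟪F.u' τ - F.ψ' τ, F.u'' τ - F.ψ'' τ⟫)) - c * m
    - 4 * F.source τ with hW'
  have hd : ∀ τ ∈ Icc (t - 1) t, HasDerivAt W (W' τ) τ := by
    intro τ hτ
    have hτ0 : 0 < τ := ht0.trans_le hτ.1
    have hr : HasDerivAt (fun τ : ℝ => τ - (t - 1)) 1 τ := (hasDerivAt_id τ).sub_const _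
    have hr2 : HasDerivAt (fun τ : ℝ => (τ - (t - 1)) ^ 2) (2 * (τ - (t - 1))) τ := by
      simpa using hr.fun_pow 2
    have := (((((hasDerivAt_energy (F := F) hτ0).const_mul 9).add
      ((hr.mul (hasDerivAt_j (F := F) hτ0)).const_mul 6)).add
      (hr2.mul (hasDerivAt_energy_deriv (F := F) hτ0))).sub
      ((hasDerivAt_id τ).const_mul (c * m))).sub
      ((hasDerivAt_integral_source (F := F) ht0 hτ0).const_mul 4)
    simpa [hW, hW'] using! this
  have hneg : ∀ τ ∈ Icc (t - 1) t, W' τ ≤ 0 := by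
    intro τ hτ
    have hτ0 : 0 < τ := ht0.trans_le hτ.1
    set r := τ - (t - 1) with hr
    have hr0 : 0 ≤ r := by linarith [hτ.1]
    have hr1 : r ≤ 1 := by linarith [hτ.2]
    have e1 := hF.energy_le hb1 hC₀ hτ0
    have e2 := mul_le_mul_of_nonneg_left (hF.j_deriv_le hb0 hb1 hτ0) hr0
    have e3 := mul_le_mul_of_nonneg_left (energy_deriv_le (F := F) hτ0) (sq_nonneg r)
    have e4 : F.j τ ≤ F.diss τ := F.j_le τ hτ0
    have e5 := hm τ hτ
    have e6 := hF.one_le τ hτ0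
    have e7 := diss_nonneg (F := F) hτ0
    have hr2 : r ^ 2 ≤ r := by nlinarith
    have hQ := sq_nonneg ‖F.u' τ - F.ψ' τ‖
    have hS : ‖F.η' τ‖ ^ 2 ≤ F.source τ := by
      unfold source; linarith [sq_nonneg ‖F.ψ'' τ‖]
    have hS0 := sq_nonneg ‖F.η' τ‖
    have e8 : r ^ 2 * ‖F.u' τ - F.ψ' τ‖ ^ 2 ≤ r * ‖F.u' τ - F.ψ' τ‖ ^ 2 := by gcongr
    have e9 : r * F.diss τ ≤ F.diss τ := mul_le_of_le_one_left e7 hr1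
    have e10 : r * ‖F.η' τ‖ ^ 2 ≤ F.source τ := (mul_le_of_le_one_left hS0 hr1).trans hS
    have e11 : r * G τ ≤ m := (mul_le_of_le_one_left (by linarith) hr1).trans e5
    have e12 : r ^ 2 * F.source τ ≤ F.source τ :=
      mul_le_of_le_one_left (source_nonneg τ) (by linarith)
    have e13 := mul_le_mul_of_nonneg_left e5 hc.le
    simp only [hW', c]
    nlinarith
  have hanti : AntitoneOn W (Icc (t - 1) t) := by
    refine antitoneOn_of_deriv_nonpos (convex_Icc _ _)
      (fun τ hτ => (hd τ hτ).continuousAt.continuousWithinAt)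
      (fun τ hτ => (hd τ (interior_subset hτ)).differentiableAt.differentiableWithinAt)
      fun τ hτ => ?_
    rw [(hd τ (interior_subset hτ)).deriv]
    exact hneg τ (interior_subset hτ)
  have hfin := hanti (left_mem_Icc.2 (by linarith)) (right_mem_Icc.2 (by linarith))
    (by linarith : t - 1 ≤ t)
  simp only [hW, intervalIntegral.integral_same] at hfin
  have h1 := F.le_two_j t (by linarith)
  have h2 := diss_nonneg (F := F) (t := t) (by linarith)
  unfold size
  unfold diss at h2 ⊢
  nlinarith [sq_nonneg ‖F.u t - F.ψ t‖]

end Flow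

end AbstractFlow

/-! ## Scalar differential inequalities -/

section Scalar

/-- `y' ≤ -c y^θ + C₀ G` with `G` below a monotone unbounded function `M`. -/
theorem exists_eventually_le_of_monotone {θ c C₀ : ℝ} (hθ : 0 < θ) (hc : 0 < c) (hC₀ : 0 < C₀) :
    ∃ A > 0, ∀ y y' G M : ℝ → ℝ, (∀ t > 0, 0 ≤ y t) → (∀ t > 0, HasDerivAt y (y' t) t) →
      (∀ t > 0, y' t ≤ -c * y t ^ θ + C₀ * G t) → (∀ t > 0, G t ≤ M t) →
      (∀ t > 0, 0 ≤ M t) → MonotoneOn M (Ici 0) → Tendsto M atTop atTop →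
      ∀ᶠ t in atTop, y t ≤ A * M t ^ (1 / θ) := by
  refine ⟨(C₀ / c) ^ (1 / θ) + 1, by positivity, fun y y' G M hy hd hle hGM hM0 hmono hlim => ?_⟩
  -- M is frozen at its final value, the largest on [1,t], which makes the barrier constant.
  -- Wherever y touches it, the damping exceeds the source and y' < 0.
  have key : ∀ t ≥ 1, y t ≤ y 1 + 1 + (C₀ * M t / c) ^ (1 / θ) := by
    intro t ht
    have hMt := hM0 t (by linarith)
    refine image_le_of_deriv_right_lt_deriv_boundary'
      (B := fun _ => y 1 + 1 + (C₀ * M t / c) ^ (1 / θ)) (B' := fun _ => 0) (a := 1) (b := t)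
      (f' := y') (fun s hs => (hd s (by linarith [hs.1])).continuousAt.continuousWithinAt)
      (fun s hs => (hd s (by linarith [hs.1])).hasDerivWithinAt) ?_ continuousOn_const
      (fun s _ => hasDerivWithinAt_const _ _ _) ?_ (right_mem_Icc.2 ht)
    · have : 0 ≤ (C₀ * M t / c) ^ (1 / θ) := by positivity
      linarith
    · intro s hs hys
      have hs0 : 0 < s := by linarith [hs.1]
      have h1 := hle s hs0
      have h2 : M s ≤ M t := hmono hs0.le (by simp; linarith) hs.2.le
      have h3 : (C₀ * M t / c) ^ (1 / θ) < y s := by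
        rw [hys]; linarith [hy 1 one_pos]
      have h4 : C₀ * M t / c < y s ^ θ := by
        have := Real.rpow_lt_rpow (by positivity) h3 hθ
        rwa [← Real.rpow_mul (by positivity), one_div_mul_cancel hθ.ne', Real.rpow_one] at this
      rw [div_lt_iff₀ hc] at h4
      have h5 := mul_le_mul_of_nonneg_left ((hGM s hs0).trans h2) hC₀.le
      linarith
  have hlim' : Tendsto (fun t => M t ^ (1 / θ)) atTop atTop :=
    (tendsto_rpow_atTop (by positivity)).comp hlim
  -- Unboundedness of M absorbs the initial value, so that A does not depend on y(1).
  filter_upwards [hlim'.eventually_ge_atTop (y 1 + 1), eventually_ge_atTop 1] with t h1 h2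
  have h3 := key t h2
  rw [mul_div_right_comm, Real.mul_rpow (by positivity) (hM0 t (by linarith))] at h3
  linarith

/-- Weighted AM–GM with weights γ and 1-γ, which are then bounded by 1. -/
theorem rpow_mul_le_eps {γ ε x z : ℝ} (hγ0 : 0 ≤ γ) (hγ1 : γ < 1) (hε : 0 < ε) (hx : 0 ≤ x)
    (hz : 0 ≤ z) :
    x ^ γ * z ≤ ε * x + ε ^ (-(γ / (1 - γ))) * z ^ (1 / (1 - γ)) := by
  have h1 : 0 < 1 - γ := by linarith
  have h := Real.geom_mean_le_arith_mean2_weighted hγ0 h1.le (p₁ := ε * x)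
    (p₂ := ε ^ (-(γ / (1 - γ))) * z ^ (1 / (1 - γ))) (by positivity) (by positivity) (by ring)
  have e : (ε * x) ^ γ * (ε ^ (-(γ / (1 - γ))) * z ^ (1 / (1 - γ))) ^ (1 - γ) = x ^ γ * z := by
    rw [Real.mul_rpow hε.le hx, Real.mul_rpow (by positivity) (by positivity),
      ← Real.rpow_mul hε.le, ← Real.rpow_mul hz, one_div_mul_cancel h1.ne', Real.rpow_one,
      neg_mul, div_mul_cancel₀ _ h1.ne', Real.rpow_neg hε.le]
    have := Real.rpow_pos_of_pos hε γ
    field_simp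
  rw [e] at h
  have h2 : 0 ≤ ε ^ (-(γ / (1 - γ))) * z ^ (1 / (1 - γ)) := by positivity
  have h3 : 0 ≤ ε * x := by positivity
  nlinarith

/-- `y' ≤ -c y^θ + C₀ G` with `G' ≥ -β`, where `1/2 < θ < 1`. -/
theorem exists_eventually_le_of_deriv_ge {θ c C₀ : ℝ} (hθ : 1 / 2 < θ) (hθ1 : θ < 1) (hc : 0 < c)
    (hC₀ : 0 < C₀) :
    ∃ A > 0, ∀ (y y' G G' : ℝ → ℝ) (β : ℝ), 1 ≤ β → (∀ t > 0, 0 ≤ y t) →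
      (∀ t > 0, HasDerivAt y (y' t) t) → (∀ t > 0, y' t ≤ -c * y t ^ θ + C₀ * G t) →
      (∀ t > 0, 1 ≤ G t) → (∀ t > 0, HasDerivAt G (G' t) t) → (∀ᶠ t in atTop, -β ≤ G' t) →
      ∀ᶠ t in atTop, y t ≤ A * (G t ^ (1 / θ) + β ^ (1 / (2 * θ - 1))) := by
  have hθ0 : 0 < θ := by linarith
  have hγ0 : 0 ≤ 1 / θ - 1 := by rw [sub_nonneg, one_le_div hθ0]; linarith
  have hγ1 : 1 / θ - 1 < 1 := by
    rw [sub_lt_iff_lt_add, div_lt_iff₀ hθ0]; linarith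
  -- A makes a quarter of the damping at the barrier equal to at least 2C₀G: once for the source,
  -- once for the C₀G produced by Young's inequality from the barrier's derivative. A₂ below handles
  -- the remaining power of β.
  obtain ⟨A, hA, hAc⟩ : ∃ A > 0, c / 4 * A ^ θ = 2 * C₀ := by
    refine ⟨(8 * C₀ / c) ^ (1 / θ), by positivity, ?_⟩
    rw [← Real.rpow_mul (by positivity), one_div_mul_cancel hθ0.ne', Real.rpow_one]
    field_simp; ring
  set ε := C₀ * θ / A with hε
  have hε0 : 0 < ε := by positivity
  set k := A / θ * ε ^ (-((1 / θ - 1) / (1 - (1 / θ - 1)))) with hk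
  have hk0 : 0 < k := by positivity
  obtain ⟨A₂, hA₂, hAc₂⟩ : ∃ A₂ > 0, c / 4 * A₂ ^ θ = k := by
    refine ⟨(4 * k / c) ^ (1 / θ), by positivity, ?_⟩
    rw [← Real.rpow_mul (by positivity), one_div_mul_cancel hθ0.ne', Real.rpow_one]
    field_simp
  refine ⟨A + A₂, by positivity, fun y y' G G' β hβ hy hd hle hG1 hGd hG' => ?_⟩
  set q := 1 / (2 * θ - 1) with hq
  have hq0 : 0 < 2 * θ - 1 := by linarith
  -- The barrier: a supersolution with only half of the damping coefficient. The other half later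
  -- provides strictness.
  set z : ℝ → ℝ := fun t => A * G t ^ (1 / θ) + A₂ * β ^ q with hz
  set z' : ℝ → ℝ := fun t => A * (G' t * (1 / θ) * G t ^ (1 / θ - 1)) with hz'
  have hzd : ∀ t > 0, HasDerivAt z (z' t) t := fun t ht => by
    have := ((((hGd t ht).rpow_const (p := 1 / θ) (Or.inl (by linarith [hG1 t ht]))).const_mul
      A)).add_const (A₂ * β ^ q)
    exact this
  have hsuper : ∀ t > 0, -β ≤ G' t → C₀ * G t - c / 2 * z t ^ θ ≤ z' t := by
    intro t ht hGt
    have hG0 : 0 ≤ G t := by linarith [hG1 t ht]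
    have h1 : A ^ θ * G t ≤ z t ^ θ := by
      have : (A * G t ^ (1 / θ)) ^ θ ≤ z t ^ θ := by
        apply Real.rpow_le_rpow (by positivity) _ hθ0.le
        have : 0 ≤ A₂ * β ^ q := by positivity
        simp only [hz]; linarith
      rwa [Real.mul_rpow hA.le (by positivity), ← Real.rpow_mul hG0, one_div_mul_cancel hθ0.ne',
        Real.rpow_one] at this
    have h2 : A₂ ^ θ * β ^ (q * θ) ≤ z t ^ θ := by
      have : (A₂ * β ^ q) ^ θ ≤ z t ^ θ := by
        apply Real.rpow_le_rpow (by positivity) _ hθ0.le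
        have : 0 ≤ A * G t ^ (1 / θ) := by positivity
        simp only [hz]; linarith
      rwa [Real.mul_rpow hA₂.le (by positivity), ← Real.rpow_mul (by linarith)] at this
    -- The barrier may fall at a rate of order G^{1/θ-1}β. Since θ > 1/2 the power of G is below 1,
    -- so Young's inequality applies and produces β^{θ/(2θ-1)}.
    have h3 := rpow_mul_le_eps hγ0 hγ1 hε0 hG0 (by linarith : (0 : ℝ) ≤ β)
    have hexp : 1 / (1 - (1 / θ - 1)) = q * θ := by
      have : 1 - (1 / θ - 1) = (2 * θ - 1) / θ := by field_simp; ring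
      rw [this, hq]; field_simp
    rw [hexp] at h3
    have h4 : A / θ * (G t ^ (1 / θ - 1) * β) ≤ C₀ * G t + k * β ^ (q * θ) := by
      calc _ ≤ A / θ * (ε * G t + ε ^ (-((1 / θ - 1) / (1 - (1 / θ - 1)))) * β ^ (q * θ)) := by
            gcongr
        _ = _ := by rw [hk, hε]; field_simp
    have h5 : -(A / θ * (G t ^ (1 / θ - 1) * β)) ≤ z' t := by
      have h6 : 0 ≤ A / θ * G t ^ (1 / θ - 1) := by positivity
      have := mul_le_mul_of_nonneg_left hGt h6
      simp only [hz']
      calc _ = A / θ * G t ^ (1 / θ - 1) * -β := by ring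
        _ ≤ _ := this
        _ = _ := by ring
    have h7 := mul_le_mul_of_nonneg_left h1 (by positivity : 0 ≤ c / 4)
    have h8 := mul_le_mul_of_nonneg_left h2 (by positivity : 0 ≤ c / 4)
    rw [← mul_assoc, hAc] at h7
    rw [← mul_assoc, hAc₂] at h8
    linarith
  have hzA : ∀ t > 0, A ≤ z t := fun t ht => by
    have h1 := Real.one_le_rpow (hG1 t ht) (by positivity : 0 ≤ 1 / θ)
    have h2 : 0 ≤ A₂ * β ^ q := by positivity
    simp only [hz]
    nlinarith
  obtain ⟨T, hT⟩ := (hG'.and (eventually_gt_atTop 0)).exists_forall_of_atTop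
  have hstrict : ∀ t ≥ T, z t ≤ y t → y' t ≤ z' t - c / 2 * A ^ θ := by
    intro t ht hzy
    obtain ⟨h1, h2⟩ := hT t ht
    have h3 := hsuper t h2 h1
    have h4 := hle t h2
    have h5 : z t ^ θ ≤ y t ^ θ := Real.rpow_le_rpow (hA.le.trans (hzA t h2)) hzy hθ0.le
    have h6 : A ^ θ ≤ z t ^ θ := Real.rpow_le_rpow hA.le (hzA t h2) hθ0.le
    have h7 := mul_le_mul_of_nonneg_left h5 hc.le
    have h8 := mul_le_mul_of_nonneg_left h6 (by positivity : 0 ≤ c / 2)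
    linarith
  have hAθ : 0 < c / 2 * A ^ θ := by positivity
  -- If y stayed above z forever, y - z would fall at least at the rate c/2·A^θ and reach 0 in
  -- finite time. Once y is below z, the strict inequality keeps it there.
  obtain ⟨T', hT', hT'le⟩ : ∃ T' ≥ T, y T' ≤ z T' := by
    by_contra! hcon
    have hT0 := (hT T le_rfl).2
    set κ := c / 2 * A ^ θ
    have hdd : ∀ t ≥ T, HasDerivAt (fun t => y t - z t + κ * t) (y' t - z' t + κ) t := fun t ht => by
      have := ((hd t (hT t ht).2).sub (hzd t (hT t ht).2)).add ((hasDerivAt_id t).const_mul κ)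
      simpa using! this
    have hanti : AntitoneOn (fun t => y t - z t + κ * t) (Ici T) := by
      refine antitoneOn_of_deriv_nonpos (convex_Ici _)
        (fun t ht => (hdd t ht).continuousAt.continuousWithinAt)
        (fun t ht => (hdd t (interior_subset ht)).differentiableAt.differentiableWithinAt)
        fun t ht => ?_
      have ht' := interior_subset ht
      rw [(hdd t ht').deriv]
      linarith [hstrict t ht' (hcon t ht').le]
    have hd0 : 0 ≤ y T - z T := by linarith [hcon T le_rfl]
    have hs : T ≤ T + (y T - z T) / κ := by
      have : 0 ≤ (y T - z T) / κ := by positivity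
      linarith
    have := hanti (mem_Ici.2 le_rfl) hs hs
    have h2 := hcon _ hs
    simp only at this
    rw [mul_add, mul_div_cancel₀ _ hAθ.ne'] at this
    linarith
  filter_upwards [eventually_ge_atTop T'] with t ht
  have hyz : y t ≤ z t := by
    refine image_le_of_deriv_right_lt_deriv_boundary' (a := T') (b := t) (f' := y') (B' := z')
      (fun s hs => (hd s (hT s (hT'.trans hs.1)).2).continuousAt.continuousWithinAt)
      (fun s hs => (hd s (hT s (hT'.trans hs.1)).2).hasDerivWithinAt) hT'le
      (fun s hs => (hzd s (hT s (hT'.trans hs.1)).2).continuousAt.continuousWithinAt)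
      (fun s hs => (hzd s (hT s (hT'.trans hs.1)).2).hasDerivWithinAt) ?_ (right_mem_Icc.2 ht)
    intro s hs h
    linarith [hstrict s (hT'.trans hs.1) h.ge]
  have hG0 : 0 ≤ G t := by linarith [hG1 t (hT t (hT'.trans ht)).2]
  have h1 : 0 ≤ G t ^ (1 / θ) := by positivity
  have h2 : 0 ≤ β ^ q := by positivity
  simp only [hz] at hyz
  nlinarith

/-- `w' ≤ -θ⁻¹ (c w - L)` with `∫ θ⁻¹ = ∞`. -/
theorem eventually_le_of_deriv_le_div {w w' θ : ℝ → ℝ} {c L ε T : ℝ} (hc : 0 < c) (hε : 0 < ε)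
    (hw : ∀ t ≥ T, HasDerivAt w (w' t) t) (hθ : ContinuousOn θ (Ici T)) (hθ1 : ∀ t ≥ T, 1 ≤ θ t)
    (hle : ∀ t ≥ T, w' t ≤ -(θ t)⁻¹ * (c * w t - L))
    (hint : ∫⁻ t in Ioi T, ENNReal.ofReal (θ t)⁻¹ = ⊤) :
    ∀ᶠ t in atTop, w t ≤ L / c + ε := by
  have hθi : ContinuousOn (fun t => (θ t)⁻¹) (Ici T) :=
    hθ.inv₀ fun t ht => by linarith [hθ1 t ht]
  have hpos : ∀ t ≥ T, 0 ≤ (θ t)⁻¹ := fun t ht => inv_nonneg.2 (by linarith [hθ1 t ht])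
  have hii : ∀ s ≥ T, ∀ t ≥ T, IntervalIntegrable (fun t => (θ t)⁻¹) volume s t := fun s hs t ht =>
    (hθi.mono fun r hr => (le_min hs ht).trans hr.1).intervalIntegrable
  set I : ℝ → ℝ := fun t => ∫ s in T..t, (θ s)⁻¹ with hI
  have hImono : MonotoneOn I (Ici T) := by
    intro s hs t ht hst
    simp only [hI]
    rw [← intervalIntegral.integral_add_adjacent_intervals (hii T le_rfl s hs) (hii s hs t ht)]
    have : 0 ≤ ∫ r in s..t, (θ r)⁻¹ := intervalIntegral.integral_nonneg hst
      fun r hr => hpos r (le_trans hs hr.1)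
    linarith
  -- If the primitive I stayed bounded, θ⁻¹ would be integrable, against the infinite integral.
  have hIlim : ∀ B : ℝ, ∀ᶠ t in atTop, B < I t := by
    intro B
    by_contra hcon
    have hbd : ∀ t ≥ T, I t ≤ B := by
      intro t ht
      by_contra! h
      exact hcon (by filter_upwards [eventually_ge_atTop t] with s hs
        using h.trans_le (hImono ht (le_trans ht hs) hs))
    have hint' : IntegrableOn (fun t => (θ t)⁻¹) (Ioi T) := by
      refine integrableOn_Ioi_of_intervalIntegral_norm_bounded B T (b := fun t => max T t)
        (l := atTop) (fun t => ?_) (tendsto_atTop_mono (fun t => le_max_right T t) tendsto_id) ?_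
      · exact (hii T le_rfl _ (le_max_left _ _)).1
      · filter_upwards [eventually_ge_atTop T] with t ht
        rw [max_eq_right ht]
        refine le_trans (le_of_eq ?_) (hbd t ht)
        refine intervalIntegral.integral_congr fun s hs => ?_
        rw [uIcc_of_le ht] at hs
        exact Real.norm_of_nonneg (hpos s hs.1)
    have hfin := hint'.lintegral_lt_top
    rw [hint] at hfin
    exact lt_irrefl _ hfin
  have hIat : Tendsto I atTop atTop := tendsto_atTop.2 fun B => (hIlim B).mono fun _ h => h.le
  -- Integrating factor: v is nonincreasing, so w - L/c ≤ |v(T)| e^{-cI}, which tends to 0.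
  set v : ℝ → ℝ := fun t => (w t - L / c) * Real.exp (c * I t) with hv
  have hIc : ContinuousOn I (Ici T) := by
    intro t ht
    have h := intervalIntegral.continuousOn_primitive_interval'
      (hii T le_rfl (t + 1) (by simp at ht ⊢; linarith)) left_mem_uIcc
    refine ((h t ?_).mono_of_mem_nhdsWithin ?_)
    · rw [uIcc_of_le (by simp at ht; linarith)]; exact ⟨ht, by linarith⟩
    · rw [uIcc_of_le (by simp at ht; linarith), ← Ici_inter_Iic]
      exact inter_mem_nhdsWithin _ (Iic_mem_nhds (by linarith))
  have hId : ∀ t > T, HasDerivAt I ((θ t)⁻¹) t := fun t ht =>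
    intervalIntegral.integral_hasDerivAt_right (hii T le_rfl t ht.le)
      ((hθi.mono Ioi_subset_Ici_self).stronglyMeasurableAtFilter isOpen_Ioi t ht)
      (hθi.continuousAt (Ici_mem_nhds ht))
  have hvd : ∀ t > T, HasDerivAt v (w' t * Real.exp (c * I t)
      + (w t - L / c) * (Real.exp (c * I t) * (c * (θ t)⁻¹))) t := fun t ht =>
    ((hw t ht.le).sub_const _).mul (((hId t ht).const_mul c).exp)
  have hanti : AntitoneOn v (Ici T) := by
    refine antitoneOn_of_deriv_nonpos (convex_Ici _) ?_ ?_ ?_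
    · refine ContinuousOn.mul ?_ (Real.continuous_exp.comp_continuousOn (hIc.const_smul c))
      exact (ContinuousOn.sub (fun t ht => (hw t ht).continuousAt.continuousWithinAt)
        continuousOn_const)
    · rw [interior_Ici]
      exact fun t ht => (hvd t ht).differentiableAt.differentiableWithinAt
    · rw [interior_Ici]
      intro t ht
      rw [(hvd t ht).deriv]
      have h1 := hle t (le_of_lt ht)
      have h2 : w' t + (w t - L / c) * (c * (θ t)⁻¹) ≤ 0 := by
        have : (w t - L / c) * (c * (θ t)⁻¹) = (θ t)⁻¹ * (c * w t - L) := by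
          field_simp
        linarith
      have := mul_nonpos_of_nonpos_of_nonneg h2 (Real.exp_pos (c * I t)).le
      linarith
  have hexp : Tendsto (fun t => |v T| * Real.exp (-(c * I t))) atTop (𝓝 (|v T| * 0)) :=
    (Real.tendsto_exp_neg_atTop_nhds_zero.comp (hIat.const_mul_atTop hc)).const_mul _
  rw [mul_zero] at hexp
  filter_upwards [hexp.eventually (gt_mem_nhds hε), eventually_ge_atTop T] with t h1 h2
  have h3 := hanti (mem_Ici.2 le_rfl) h2 h2
  have h4 : w t - L / c = v t * Real.exp (-(c * I t)) := by
    simp only [hv]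
    rw [mul_assoc, ← Real.exp_add, add_neg_cancel, Real.exp_zero, mul_one]
  have h5 : v t * Real.exp (-(c * I t)) ≤ |v T| * Real.exp (-(c * I t)) :=
    mul_le_mul_of_nonneg_right (h3.trans (le_abs_self _)) (Real.exp_pos _).le
  linarith

end Scalar

/-! ## Asymptotic estimates for flows -/

section Asymptotics

open scoped RealInnerProductSpace

theorem eventually_le_limsup_toReal_add {R : ℝ → ℝ} {δ : ℝ} (hδ : 0 < δ)
    (hR : limsup (fun t => ENNReal.ofReal (R t)) atTop ≠ ⊤) :
    ∀ᶠ t in atTop, R t ≤ (limsup (fun t => ENNReal.ofReal (R t)) atTop).toReal + δ := by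
  have hlt : limsup (fun t => ENNReal.ofReal (R t)) atTop
      < ENNReal.ofReal ((limsup (fun t => ENNReal.ofReal (R t)) atTop).toReal + δ) := by
    conv_lhs => rw [← ENNReal.ofReal_toReal hR]
    rw [ENNReal.ofReal_lt_ofReal_iff (by positivity)]
    linarith
  filter_upwards [eventually_lt_of_limsup_lt hlt] with t ht
  exact (lt_of_not_ge fun h => ht.not_ge (ENNReal.ofReal_le_ofReal h)).le

/-- If `Z` is eventually controlled by any eventual bounds on `P`, `Q`, linearly, then so are the
limits superior. -/
theorem limsup_ofReal_le_of_eventually {Z P Q : ℝ → ℝ} {C : ℝ} (hC : 0 < C)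
    (h : ∀ l m ε : ℝ, 0 ≤ l → 0 ≤ m → 0 < ε → (∀ᶠ t in atTop, P t ≤ l) → (∀ᶠ t in atTop, Q t ≤ m) →
      ∀ᶠ t in atTop, Z t ≤ C * l + C * m + ε) :
    limsup (fun t => ENNReal.ofReal (Z t)) atTop
      ≤ ENNReal.ofReal C * limsup (fun t => ENNReal.ofReal (P t)) atTop
        + ENNReal.ofReal C * limsup (fun t => ENNReal.ofReal (Q t)) atTop := by
  set LP := limsup (fun t => ENNReal.ofReal (P t)) atTop with hLP
  set LQ := limsup (fun t => ENNReal.ofReal (Q t)) atTop with hLQ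
  have hC' : ENNReal.ofReal C ≠ 0 := by simpa using hC
  by_cases hP : LP = ⊤
  · rw [hP, ENNReal.mul_top hC', top_add]; exact le_top
  by_cases hQ : LQ = ⊤
  · rw [hQ, ENNReal.mul_top hC', add_top]; exact le_top
  refine ENNReal.le_of_forall_pos_le_add fun ε hε _ => ?_
  have hδ : 0 < (ε : ℝ) / (4 * C) := by positivity
  have h1 := h (LP.toReal + ε / (4 * C)) (LQ.toReal + ε / (4 * C)) (ε / 2) (by positivity)
    (by positivity) (by positivity) (eventually_le_limsup_toReal_add hδ hP) (eventually_le_limsup_toReal_add hδ hQ)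
  refine limsup_le_of_le (h := ?_)
  filter_upwards [h1] with t ht
  calc ENNReal.ofReal (Z t) ≤ ENNReal.ofReal (C * LP.toReal + C * LQ.toReal + ε) := by
        refine ENNReal.ofReal_le_ofReal (ht.trans (le_of_eq ?_))
        field_simp
        ring
    _ = _ := by
        rw [ENNReal.ofReal_add (by positivity) (by positivity),
          ENNReal.ofReal_add (by positivity) (by positivity), ENNReal.ofReal_mul hC.le,
          ENNReal.ofReal_mul hC.le, ENNReal.ofReal_toReal hP, ENNReal.ofReal_toReal hQ,
          ENNReal.ofReal_coe_nnreal]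

/-- The scalar inequalities that imply the asymptotic estimate of `Z`; here `y = ‖P̄‖²`. -/
theorem limsup_le_of_differential_inequality {γ C : ℝ} (hγ : 0 < γ) (hC : 1 ≤ C)
    {V d Z y y' : ℝ → ℝ} (hV1 : ∀ t ≥ 1, 1 ≤ V t)
    (hVd : ∀ᶠ t in atTop, DifferentiableAt ℝ (fun s => V s ^ γ) t)
    (hVlim : Tendsto (deriv fun s => V s ^ γ) atTop (𝓝 0))
    (hVint : ∫⁻ t in Ioi (1 : ℝ), ENNReal.ofReal (V t ^ (-γ)) = ⊤)
    (hd : ∀ t > 0, 0 ≤ d t) (hy0 : ∀ t > 0, 0 ≤ y t) (hyZ : ∀ t > 0, y t ≤ C * Z t)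
    (hyd : ∀ t > 0, HasDerivAt y (y' t) t)
    (hZ : ∀ᶠ t in atTop, Z t ≤ C * V t ^ γ * (-y' t + C * (V t ^ (1 / 2 : ℝ) * d t)))
    (hy' : ∀ᶠ t in atTop, |y' t| ≤ C * (V t ^ (1 / 2 : ℝ) * y t ^ (1 / 2 : ℝ))) :
    limsup (fun t => ENNReal.ofReal (Z t)) atTop
      ≤ ENNReal.ofReal (2 * C ^ 4) * limsup (fun t => ENNReal.ofReal
          ((V t ^ (3 * (γ + 1 / 2)) * d t) ^ (1 / 2 : ℝ))) atTop
        + ENNReal.ofReal (2 * C ^ 4) * limsup (fun t => ENNReal.ofReal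
          (V t ^ (γ + 1 / 2) * d t)) atTop := by
  have hC0 : 0 < C := by linarith
  refine limsup_ofReal_le_of_eventually (by positivity) fun l m ε hl hm hε hP hQ => ?_
  set κ := γ + 1 / 2 with hκ
  have hκ0 : 0 < κ := by positivity
  set θ : ℝ → ℝ := fun s => V s ^ γ with hθ
  -- Chosen so that θ^σ = V^{2κ}: the hypothesis is on the derivative of θ = V^γ, so the weight is
  -- written as a power of θ.
  set σ := 2 * κ / γ with hσ
  have hσ0 : 0 < σ := by positivity
  set w : ℝ → ℝ := fun t => θ t ^ σ * y t with hw
  set w' : ℝ → ℝ := fun t => deriv θ t * σ * θ t ^ (σ - 1) * y t + θ t ^ σ * y' t with hw'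
  -- The damping of w is C⁻²θ⁻¹w. This threshold lets the derivative of the weight consume at most
  -- half of it.
  have hsmall : ∀ᶠ t in atTop, deriv θ t < 1 / (2 * C ^ 2 * σ) :=
    hVlim.eventually (gt_mem_nhds (by positivity))
  obtain ⟨T, hT⟩ := (hVd.and (hsmall.and (hZ.and (hy'.and (hP.and
    (eventually_ge_atTop 1)))))).exists_forall_of_atTop
  have hθ1 : ∀ t ≥ T, 1 ≤ θ t := fun t ht =>
    Real.one_le_rpow (hV1 t (hT t ht).2.2.2.2.2) hγ.le
  have hwd : ∀ t ≥ T, HasDerivAt w (w' t) t := fun t ht => by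
    have h1 := (hT t ht).1.hasDerivAt
    exact (h1.rpow_const (Or.inl (by linarith [hθ1 t ht]))).mul
      (hyd t (by linarith [(hT t ht).2.2.2.2.2]))
  have hθσ : ∀ t ≥ T, θ t ^ σ = V t ^ (2 * κ) := fun t ht => by
    rw [hθ, ← Real.rpow_mul (by linarith [hV1 t (hT t ht).2.2.2.2.2])]
    congr 1; rw [hσ]; field_simp
  have hle : ∀ t ≥ T, w' t ≤ -(θ t)⁻¹ * (1 / (2 * C ^ 2) * w t - C * l ^ 2) := by
    intro t ht
    obtain ⟨-, h2, h3, -, h5, h6⟩ := hT t ht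
    have hV := hV1 t h6
    have ht0 : 0 < t := by linarith
    have hθt := hθ1 t ht
    have hθ0 : 0 < θ t := by linarith
    have hy := hy0 t ht0
    have hdt := hd t ht0
    have hθσ0 : 0 < θ t ^ σ := by positivity
    have hpow : θ t ^ (σ - 1) = θ t ^ σ * (θ t)⁻¹ := by
      rw [Real.rpow_sub_one hθ0.ne', div_eq_mul_inv]
    have e1 : deriv θ t * σ * θ t ^ (σ - 1) * y t ≤ 1 / (2 * C ^ 2) * ((θ t)⁻¹ * w t) := by
      have : deriv θ t * σ ≤ 1 / (2 * C ^ 2) := by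
        calc deriv θ t * σ ≤ 1 / (2 * C ^ 2 * σ) * σ := by gcongr
          _ = _ := by field_simp
      calc _ = deriv θ t * σ * ((θ t)⁻¹ * w t) := by rw [hpow]; simp only [hw]; ring
        _ ≤ _ := by
          have : 0 ≤ (θ t)⁻¹ * w t := by simp only [hw]; positivity
          gcongr
    have e2 : y' t ≤ -(1 / C ^ 2) * ((θ t)⁻¹ * y t) + C * (V t ^ (1 / 2 : ℝ) * d t) := by
      have h7 := (hyZ t ht0).trans (mul_le_mul_of_nonneg_left h3 hC0.le)
      have h8 : (1 / C ^ 2) * ((θ t)⁻¹ * y t)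
          ≤ (1 / C ^ 2) * ((θ t)⁻¹ * (C * (C * θ t * (-y' t + C * (V t ^ (1 / 2 : ℝ) * d t))))) := by
        gcongr
      have h9 : (1 / C ^ 2) * ((θ t)⁻¹ * (C * (C * θ t * (-y' t + C * (V t ^ (1 / 2 : ℝ) * d t)))))
          = -y' t + C * (V t ^ (1 / 2 : ℝ) * d t) := by field_simp
      linarith
    have e3 : V t ^ (3 * κ) * d t ≤ l ^ 2 := by
      have hn : 0 ≤ V t ^ (3 * κ) * d t := by positivity
      have := pow_le_pow_left₀ (by positivity) h5 2
      rwa [← Real.rpow_natCast, ← Real.rpow_mul hn, Nat.cast_ofNat, one_div_mul_cancel two_ne_zero,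
        Real.rpow_one] at this
    -- The exponents balance because κ = γ + 1/2 gives 2κ + 1/2 = -γ + 3κ; this is the origin of
    -- V^{3κ₀}.
    have e4 : θ t ^ σ * (V t ^ (1 / 2 : ℝ) * d t) = (θ t)⁻¹ * (V t ^ (3 * κ) * d t) := by
      have hV0 : 0 < V t := by linarith
      rw [hθσ t ht]
      simp only [hθ]
      rw [← Real.rpow_neg hV0.le, ← mul_assoc, ← mul_assoc, ← Real.rpow_add hV0,
        ← Real.rpow_add hV0]
      congr 2
      rw [hκ]; ring
    have e5 := mul_le_mul_of_nonneg_left e2 hθσ0.le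
    have e6 : C * ((θ t)⁻¹ * (V t ^ (3 * κ) * d t)) ≤ C * ((θ t)⁻¹ * l ^ 2) := by gcongr
    have e7 : θ t ^ σ * (-(1 / C ^ 2) * ((θ t)⁻¹ * y t) + C * (V t ^ (1 / 2 : ℝ) * d t))
        = -(1 / C ^ 2) * ((θ t)⁻¹ * w t) + C * (θ t ^ σ * (V t ^ (1 / 2 : ℝ) * d t)) := by
      simp only [hw]; ring
    rw [e7, e4] at e5
    have e8 : 1 / C ^ 2 * ((θ t)⁻¹ * w t) = 2 * (1 / (2 * C ^ 2) * ((θ t)⁻¹ * w t)) := by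
      field_simp
    calc w' t = deriv θ t * σ * θ t ^ (σ - 1) * y t + θ t ^ σ * y' t := rfl
      _ ≤ -(1 / (2 * C ^ 2) * ((θ t)⁻¹ * w t)) + C * ((θ t)⁻¹ * l ^ 2) := by linarith
      _ = _ := by ring
  -- V ≥ 1 makes the integrand at most 1 on (1,T], so discarding that interval keeps the integral
  -- infinite.
  have hint : ∫⁻ t in Ioi T, ENNReal.ofReal (θ t)⁻¹ = ⊤ := by
    have hT1 : 1 ≤ T := (hT T le_rfl).2.2.2.2.2
    rw [← Ioc_union_Ioi_eq_Ioi hT1, lintegral_union measurableSet_Ioi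
      (Ioc_disjoint_Ioi le_rfl)] at hVint
    have hfin : ∫⁻ t in Ioc 1 T, ENNReal.ofReal (V t ^ (-γ)) < ⊤ := by
      calc ∫⁻ t in Ioc 1 T, ENNReal.ofReal (V t ^ (-γ)) ≤ ∫⁻ t in Ioc 1 T, 1 := by
            refine setLIntegral_mono measurable_const fun t ht => ?_
            rw [← ENNReal.ofReal_one]
            exact ENNReal.ofReal_le_ofReal
              (Real.rpow_le_one_of_one_le_of_nonpos (hV1 t ht.1.le) (by linarith))
        _ < ⊤ := by simp
    have h2 := (ENNReal.add_eq_top.1 hVint).resolve_left hfin.ne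
    rw [← h2]
    refine setLIntegral_congr_fun measurableSet_Ioi fun t ht => ?_
    rw [← Real.rpow_neg (by linarith [hV1 t (hT1.trans (le_of_lt ht))])]
  -- The error in w is taken as (ε/C²)²: after the square root and the factor C² in the bound of Z
  -- it becomes ε.
  have hεC : 0 < ε / C ^ 2 := by positivity
  have hfinal := eventually_le_of_deriv_le_div (L := C * l ^ 2) (c := 1 / (2 * C ^ 2))
    (ε := (ε / C ^ 2) ^ 2) (by positivity) (by positivity) hwd
    (fun t ht => (hT t ht).1.continuousAt.continuousWithinAt) hθ1 hle hint
  filter_upwards [hfinal, hQ, eventually_ge_atTop T] with t h1 h2 h3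
  obtain ⟨-, -, e3, e4, -, e6⟩ := hT t h3
  have hV := hV1 t e6
  have hV0 : 0 < V t := by linarith
  have ht0 : 0 < t := by linarith
  have hy := hy0 t ht0
  have hsq : w t = (V t ^ κ * y t ^ (1 / 2 : ℝ)) ^ 2 := by
    simp only [hw]
    rw [hθσ t h3, mul_pow, ← Real.rpow_natCast, ← Real.rpow_natCast, ← Real.rpow_mul hV0.le,
      ← Real.rpow_mul hy, Nat.cast_ofNat, one_div_mul_cancel two_ne_zero, Real.rpow_one, mul_comm κ]
  have hroot : V t ^ κ * y t ^ (1 / 2 : ℝ) ≤ 2 * C ^ 2 * l + ε / C ^ 2 := by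
    refine le_of_sq_le_sq ?_ (by positivity)
    rw [← hsq]
    refine h1.trans ?_
    have : C * l ^ 2 / (1 / (2 * C ^ 2)) = 2 * C ^ 3 * l ^ 2 := by field_simp
    rw [this]
    have h4 : 2 * C ^ 3 * l ^ 2 ≤ (2 * C ^ 2 * l) ^ 2 := by
      have : C ^ 3 ≤ C ^ 4 := pow_le_pow_right₀ hC (by norm_num)
      nlinarith [sq_nonneg l, pow_pos hC0 3]
    have h5 : 0 ≤ 2 * C ^ 2 * l * (ε / C ^ 2) := by positivity
    nlinarith
  have hκV : V t ^ γ * V t ^ (1 / 2 : ℝ) = V t ^ κ := by rw [← Real.rpow_add hV0]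
  calc Z t ≤ C * V t ^ γ * (-y' t + C * (V t ^ (1 / 2 : ℝ) * d t)) := e3
    _ ≤ C * V t ^ γ * (C * (V t ^ (1 / 2 : ℝ) * y t ^ (1 / 2 : ℝ))
          + C * (V t ^ (1 / 2 : ℝ) * d t)) := by
        gcongr
        exact (neg_le_abs _).trans e4
    _ = C ^ 2 * (V t ^ κ * y t ^ (1 / 2 : ℝ)) + C ^ 2 * (V t ^ κ * d t) := by rw [← hκV]; ring
    _ ≤ C ^ 2 * (2 * C ^ 2 * l + ε / C ^ 2) + C ^ 2 * m := by gcongr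
    _ = 2 * C ^ 4 * l + C ^ 2 * m + ε := by field_simp; ring
    _ ≤ _ := by
        have : C ^ 2 ≤ C ^ 4 := pow_le_pow_right₀ hC (by norm_num)
        have : C ^ 2 * m ≤ 2 * C ^ 4 * m := by
          apply mul_le_mul_of_nonneg_right _ hm
          nlinarith [pow_pos hC0 4]
        linarith

theorem le_rpow_two_div {b x : ℝ} (hb0 : 0 < b) (hb1 : b < 1) (hx : 1 ≤ x) :
    x ≤ x ^ (2 / (2 - b)) := by
  conv_lhs => rw [← Real.rpow_one x]
  refine Real.rpow_le_rpow_of_exponent_le hx ?_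
  rw [le_div_iff₀ (by linarith)]; linarith

theorem add_rpow_le_mul_rpow_add_rpow {x y q : ℝ} (hx : 0 ≤ x) (hy : 0 ≤ y) (hq : 1 ≤ q) :
    (x + y) ^ q ≤ 2 ^ (q - 1) * (x ^ q + y ^ q) := by
  lift x to NNReal using hx
  lift y to NNReal using hy
  exact_mod_cast NNReal.rpow_add_le_mul_rpow_add_rpow x y hq

/-- With θ = (2-b)/2 the scalar comparison bounds the energy at time t-1, and smoothing carries it
to t. Monotonicity of M replaces all values on [t-1,t] by M(t). -/
theorem exists_size_le_of_monotone {b C₀ : ℝ} (hb0 : 0 < b) (hb1 : b < 1) (hC₀ : 0 < C₀) :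
    ∃ C > 0, ∀ {H X : Type} [NormedAddCommGroup H] [InnerProductSpace ℝ H]
      [NormedAddCommGroup X] [InnerProductSpace ℝ X] (F : Flow H X) (G M : ℝ → ℝ),
      F.Controlled b C₀ G → (∀ t > 0, G t ≤ M t) → MonotoneOn M (Ici 0) →
      Tendsto M atTop atTop → ∀ᶠ t in atTop,
        F.size t ≤ C * (M t ^ (2 / (2 - b)) + ∫ τ in (t - 1)..t, F.source τ) := by
  have hE := Flow.energyConst_pos hb1 hC₀
  obtain ⟨A, hA, h⟩ := exists_eventually_le_of_monotone (θ := (2 - b) / 2) (c := 1 / C₀)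
    (C₀ := Flow.energyConst b C₀ + 1) (by linarith) (by positivity) (by positivity)
  refine ⟨9 * A + (9 * Flow.energyConst b C₀ + 3) + 4, by positivity,
    fun F G M hF hGM hM hMlim => ?_⟩
  have hM1 : ∀ t > 0, 1 ≤ M t := fun t ht => (hF.one_le t ht).trans (hGM t ht)
  have h1 := h _ _ G M (fun t _ => sq_nonneg _) (fun t ht => Flow.hasDerivAt_energy (F := F) ht)
    (fun t ht => hF.energy_le_rpow hb1 hC₀ ht) hGM (fun t ht => by linarith [hM1 t ht]) hM hMlim
  rw [one_div_div] at h1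
  filter_upwards [(tendsto_atTop_add_const_right atTop (-1 : ℝ) tendsto_id).eventually h1,
    eventually_gt_atTop 1] with t ht ht1
  simp only [id, ← sub_eq_add_neg] at ht
  have hle : M (t - 1) ≤ M t := hM (by simp; linarith) (by simp; linarith) (by linarith)
  have h2 := hF.size_le hb0 hb1 hC₀ ht1 (m := M t) fun τ hτ =>
    (hGM τ (by linarith [hτ.1])).trans
      (hM (by simp; linarith [hτ.1]) (by simp; linarith) hτ.2)
  have h3 : M (t - 1) ^ (2 / (2 - b)) ≤ M t ^ (2 / (2 - b)) :=
    Real.rpow_le_rpow (by linarith [hM1 (t - 1) (by linarith)]) hle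
      (div_nonneg (by norm_num) (by linarith))
  have h4 := le_rpow_two_div hb0 hb1 (hM1 t (by linarith))
  have h5 : 0 ≤ ∫ τ in (t - 1)..t, F.source τ :=
    intervalIntegral.integral_nonneg (by linarith) fun _ _ => Flow.source_nonneg _
  have h6 := mul_le_mul_of_nonneg_left h3 hA.le
  have h7 := mul_le_mul_of_nonneg_left h4 hE.le
  have h8 : 0 ≤ M t ^ (2 / (2 - b)) := by linarith [hM1 t (by linarith)]
  nlinarith [mul_nonneg hA.le h5, mul_nonneg hE.le h5]

/-- The same scheme with θ = (2-b)/2, for which 2θ-1 = 1-b. The lower bound on G' takes the place of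
monotonicity: G exceeds G(t) by at most β on the preceding unit interval. -/
theorem exists_size_le_of_deriv_ge {b C₀ : ℝ} (hb0 : 0 < b) (hb1 : b < 1) (hC₀ : 0 < C₀) :
    ∃ C > 0, ∀ {H X : Type} [NormedAddCommGroup H] [InnerProductSpace ℝ H]
      [NormedAddCommGroup X] [InnerProductSpace ℝ X] (F : Flow H X) (G G' : ℝ → ℝ) (β : ℝ),
      F.Controlled b C₀ G → 1 ≤ β → (∀ t > 0, HasDerivAt G (G' t) t) →
      (∀ᶠ t in atTop, -β ≤ G' t) → ∀ᶠ t in atTop,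
        F.size t ≤ C * (G t ^ (2 / (2 - b)) + β ^ (1 / (1 - b))
          + ∫ τ in (t - 1)..t, F.source τ) := by
  have hE := Flow.energyConst_pos hb1 hC₀
  obtain ⟨A, hA, h⟩ := exists_eventually_le_of_deriv_ge (θ := (2 - b) / 2) (c := 1 / C₀)
    (C₀ := Flow.energyConst b C₀ + 1) (by linarith) (by linarith) (by positivity) (by positivity)
  set q := 2 / (2 - b) with hq
  have hq1 : 1 ≤ q := by rw [hq, le_div_iff₀ (by linarith)]; linarith
  set c := 9 * Flow.energyConst b C₀ + 3 with hc
  have hc0 : 0 < c := by positivity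
  refine ⟨2 ^ (q - 1) * (9 * A + c) + 9 * A + 4, by positivity, fun F G G' β hF hβ hG hG' => ?_⟩
  have h1 := h _ _ G G' β hβ (fun t _ => sq_nonneg _)
    (fun t ht => Flow.hasDerivAt_energy (F := F) ht)
    (fun t ht => hF.energy_le_rpow hb1 hC₀ ht) hF.one_le hG hG'
  rw [one_div_div, show 2 * ((2 - b) / 2) - 1 = 1 - b by ring] at h1
  obtain ⟨T, hT⟩ := (hG'.and (eventually_gt_atTop 0)).exists_forall_of_atTop
  have hmono : MonotoneOn (fun t => G t + β * t) (Ici T) := by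
    have hd : ∀ t ≥ T, HasDerivAt (fun t => G t + β * t) (G' t + β) t := fun t ht => by
      simpa using (hG t (hT t ht).2).fun_add ((hasDerivAt_id t).const_mul β)
    refine monotoneOn_of_deriv_nonneg (convex_Ici _)
        (fun t ht => (hd t ht).continuousAt.continuousWithinAt)
        (fun t ht => (hd t (interior_subset ht)).differentiableAt.differentiableWithinAt)
        fun t ht => ?_
    rw [(hd t (interior_subset ht)).deriv]
    linarith [(hT t (interior_subset ht)).1]
  filter_upwards [(tendsto_atTop_add_const_right atTop (-1 : ℝ) tendsto_id).eventually h1,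
    eventually_gt_atTop 1, eventually_ge_atTop (T + 1)] with t ht ht1 htT
  simp only [id, ← sub_eq_add_neg] at ht
  have hGm : ∀ τ ∈ Icc (t - 1) t, G τ ≤ G t + β := fun τ hτ => by
    have := hmono (show τ ∈ Ici T by simp; linarith [hτ.1]) (show t ∈ Ici T by simp; linarith) hτ.2
    simp only at this
    nlinarith [hτ.1]
  have h2 := hF.size_le hb0 hb1 hC₀ ht1 hGm
  have hG1 := hF.one_le t (by linarith)
  have h3 : G (t - 1) ^ q ≤ (G t + β) ^ q :=
    Real.rpow_le_rpow (by linarith [hF.one_le (t - 1) (by linarith)])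
      (hGm _ ⟨le_rfl, by linarith⟩) (by linarith)
  have h4 : G t + β ≤ (G t + β) ^ q := le_rpow_two_div hb0 hb1 (by linarith)
  have h5 : (G t + β) ^ q ≤ 2 ^ (q - 1) * (G t ^ q + β ^ q) :=
    add_rpow_le_mul_rpow_add_rpow (by linarith) (by linarith) hq1
  -- Since β ≥ 1, the power 2/(2-b) arising from smoothing is absorbed by the larger power 1/(1-b).
  have h6 : β ^ q ≤ β ^ (1 / (1 - b)) := by
    refine Real.rpow_le_rpow_of_exponent_le hβ ?_
    rw [hq, div_le_div_iff₀ (by linarith) (by linarith)]; linarith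
  have h7 : 0 ≤ ∫ τ in (t - 1)..t, F.source τ :=
    intervalIntegral.integral_nonneg (by linarith) fun _ _ => Flow.source_nonneg _
  have h8 : 0 ≤ G t ^ q := Real.rpow_nonneg (by linarith) _
  have h9 : 0 ≤ β ^ (1 / (1 - b)) := Real.rpow_nonneg (by linarith) _
  have hK : (0 : ℝ) < 2 ^ (q - 1) := by positivity
  set S := G t ^ q + β ^ (1 / (1 - b)) with hS
  have hS0 : 0 ≤ S := by positivity
  have h10 : (G t + β) ^ q ≤ 2 ^ (q - 1) * S := h5.trans (by rw [hS]; gcongr)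
  calc F.size t ≤ 9 * (A * (G (t - 1) ^ q + β ^ (1 / (1 - b)))) + c * (G t + β)
        + 4 * ∫ τ in (t - 1)..t, F.source τ := by linarith
    _ ≤ 9 * (A * (2 ^ (q - 1) * S + S)) + c * (2 ^ (q - 1) * S)
        + 4 * ∫ τ in (t - 1)..t, F.source τ := by
        have e1 := h3.trans h10
        have e2 : β ^ (1 / (1 - b)) ≤ S := by linarith
        have e3 := h4.trans h10
        gcongr
    _ ≤ _ := by
        have e1 : 0 ≤ (2 ^ (q - 1) * (9 * A + c) + 9 * A) * ∫ τ in (t - 1)..t, F.source τ := by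
          positivity
        nlinarith

/-- The asymptotic estimate for the difference of two flows. -/
theorem Flow.limsup_difference_le {b C₀ C₁ : ℝ} (hb0 : 0 < b) (hb1 : b < 1) (hC₀ : 0 < C₀)
    (hC₁ : 0 < C₁) :
    ∃ C > 0, ∀ {H X : Type} [NormedAddCommGroup H] [InnerProductSpace ℝ H]
      [NormedAddCommGroup X] [InnerProductSpace ℝ X] (F₁ F₂ : Flow H X) (V B Z : ℝ → ℝ),
      (∀ s > 0, ∀ t > 0, ⟪F₁.u' s, F₂.u t - F₂.ψ t⟫ = -⟪F₁.f s, F₂.y t - F₂.η t⟫) →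
      (∀ s > 0, ∀ t > 0, ⟪F₂.u' s, F₁.u t - F₁.ψ t⟫ = -⟪F₂.f s, F₁.y t - F₁.η t⟫) →
      (∀ t > 0, Z t ≤ C₀ * (B t + F₁.diss t + F₂.diss t) ^ (b / (2 - b)) *
        (⟪F₁.f t - F₂.f t, F₁.y t - F₂.y t⟫ + ‖F₁.η t - F₂.η t‖ ^ 2)) →
      (∀ t > 0, ‖(F₁.u t - F₁.ψ t) - (F₂.u t - F₂.ψ t)‖ ^ 2 ≤ C₀ * Z t) →
      (∀ t > 0, 0 ≤ B t) → (∀ t ≥ 1, B t ≤ V t) → (∀ t ≥ 1, 1 ≤ V t) →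
      (∀ᶠ t in atTop, F₁.size t ≤ C₁ * V t) → (∀ᶠ t in atTop, F₂.size t ≤ C₁ * V t) →
      (∀ᶠ t in atTop, DifferentiableAt ℝ (fun s => V s ^ (b / (2 - b))) t) →
      Tendsto (deriv fun s => V s ^ (b / (2 - b))) atTop (𝓝 0) →
      ∫⁻ t in Ioi (1 : ℝ), ENNReal.ofReal (V t ^ (-(b / (2 - b)))) = ⊤ →
      ∀ d : ℝ → ℝ, (∀ t > 0, d t = ‖F₁.η t - F₂.η t‖ ^ 2 + ‖F₁.η t - F₂.η t‖
          + ‖F₁.ψ' t - F₂.ψ' t‖) →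
      limsup (fun t => ENNReal.ofReal (Z t)) atTop
        ≤ ENNReal.ofReal C * limsup (fun t => ENNReal.ofReal
            ((V t ^ (3 * (b / (2 - b) + 1 / 2)) * d t) ^ (1 / 2 : ℝ))) atTop
          + ENNReal.ofReal C * limsup (fun t => ENNReal.ofReal
            (V t ^ (b / (2 - b) + 1 / 2) * d t)) atTop := by
  set γ := b / (2 - b) with hγ
  have hγ0 : 0 < γ := div_pos hb0 (by linarith)
  set r := Real.sqrt C₁ with hr
  have hr0 : 0 < r := Real.sqrt_pos.2 hC₁
  set k := 1 + 2 * C₁ with hk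
  have hk0 : 0 < k := by positivity
  set C := 1 + C₀ + 4 * r + 2 * (2 * r + 1) + C₀ * k ^ γ with hCdef
  have hkγ : 0 < k ^ γ := by positivity
  have hC1 : 1 ≤ C := by
    have : 0 < C₀ * k ^ γ := by positivity
    rw [hCdef]; linarith
  refine ⟨2 * C ^ 4, by positivity, fun {H X} _ _ _ _ F₁ F₂ V B Z hw12 hw21 hZ hyZ hB0 hBV hV1 hs1 hs2 hVd hVlim
    hVint d hd => ?_⟩
  have hyZ0 : ∀ t > 0, 0 ≤ Z t := fun t ht => by
    have := (sq_nonneg _).trans (hyZ t ht)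
    exact nonneg_of_mul_nonneg_right this hC₀
  have hroot : ∀ (F : Flow H X) (t : ℝ), 1 ≤ t → F.size t ≤ C₁ * V t →
      ‖F.u t - F.ψ t‖ ≤ r * V t ^ (1 / 2 : ℝ) ∧ ‖F.f t‖ ≤ r * V t ^ (1 / 2 : ℝ) ∧
      ‖F.u' t - F.ψ' t‖ ≤ r * V t ^ (1 / 2 : ℝ) := by
    intro F t ht h
    have hsq : (r * V t ^ (1 / 2 : ℝ)) ^ 2 = C₁ * V t := by
      rw [← Real.sqrt_eq_rpow, mul_pow, Real.sq_sqrt hC₁.le,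
        Real.sq_sqrt (by linarith [hV1 t ht])]
    have hn : 0 ≤ r * V t ^ (1 / 2 : ℝ) := by
      have := hV1 t ht
      positivity
    have h1 := F.norm_f_sq_le t (by linarith)
    have h2 : 0 ≤ F.diss t := Flow.diss_nonneg (by linarith)
    rw [Flow.size] at h
    have h3 := sq_nonneg ‖F.u t - F.ψ t‖
    have h4 := sq_nonneg ‖F.u' t - F.ψ' t‖
    rw [Flow.diss] at h h2
    refine ⟨?_, ?_, ?_⟩ <;> refine le_of_sq_le_sq ?_ hn <;> rw [hsq] <;> linarith
  have hd0 : ∀ t > 0, 0 ≤ d t := fun t ht => by rw [hd t ht]; positivity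
  set P : ℝ → H := fun t => (F₁.u t - F₁.ψ t) - (F₂.u t - F₂.ψ t) with hP
  set P' : ℝ → H := fun t => (F₁.u' t - F₁.ψ' t) - (F₂.u' t - F₂.ψ' t) with hP'
  refine limsup_le_of_differential_inequality hγ0 hC1 (y := fun t => ‖P t‖ ^ 2)
    (y' := fun t => 2 * ⟪P t, P' t⟫) hV1 hVd hVlim hVint hd0 (fun t _ => sq_nonneg _)
    (fun t ht => (hyZ t ht).trans ?_) (fun t ht => ?_) ?_ ?_
  · have : C₀ ≤ C := by
      have : 0 < C₀ * k ^ γ := by positivity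
      rw [hCdef]; linarith
    exact mul_le_mul_of_nonneg_right this (hyZ0 t ht)
  · exact (((F₁.hasDerivAt_u t ht).sub (F₁.hasDerivAt_ψ t ht)).sub
      ((F₂.hasDerivAt_u t ht).sub (F₂.hasDerivAt_ψ t ht))).norm_sq
  · filter_upwards [hs1, hs2, eventually_ge_atTop 1] with t h1 h2 ht
    have ht0 : 0 < t := by linarith
    have hV := hV1 t ht
    have hV0 : 0 < V t := by linarith
    obtain ⟨a1, a2, -⟩ := hroot F₁ t ht h1
    obtain ⟨b1, b2, -⟩ := hroot F₂ t ht h2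
    set v := V t ^ (1 / 2 : ℝ) with hv
    have hv1 : 1 ≤ v := Real.one_le_rpow hV (by norm_num)
    -- Each equation is tested with both p̄₁ and p̄₂; the cross relations are what allow P̄ as a
    -- test function in the difference.
    have e1 : ⟪P t, P' t⟫ = -⟪F₁.f t - F₂.f t, F₁.y t - F₂.y t⟫
        + ⟪F₁.f t - F₂.f t, F₁.η t - F₂.η t⟫ - ⟪F₁.ψ' t - F₂.ψ' t, P t⟫ := by
      have c1 := F₁.weak t ht0 t ht0
      have c2 := F₂.weak t ht0 t ht0
      have c3 := hw12 t ht0 t ht0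
      have c4 := hw21 t ht0 t ht0
      rw [real_inner_comm]
      simp only [hP, hP', inner_sub_left, inner_sub_right] at c1 c2 c3 c4 ⊢
      linarith
    have e2 : ⟪F₁.f t - F₂.f t, F₁.η t - F₂.η t⟫ ≤ 2 * r * v * ‖F₁.η t - F₂.η t‖ := by
      refine (real_inner_le_norm _ _).trans ?_
      gcongr
      exact (norm_sub_le _ _).trans (by linarith)
    have e3 : -⟪F₁.ψ' t - F₂.ψ' t, P t⟫ ≤ 2 * r * v * ‖F₁.ψ' t - F₂.ψ' t‖ := by
      rw [← inner_neg_left]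
      refine (real_inner_le_norm _ _).trans ?_
      rw [norm_neg, mul_comm]
      gcongr
      exact (norm_sub_le _ _).trans (by linarith)
    have e4 : ⟪F₁.f t - F₂.f t, F₁.y t - F₂.y t⟫ + ‖F₁.η t - F₂.η t‖ ^ 2
        ≤ -⟪P t, P' t⟫ + (2 * r + 1) * (v * d t) := by
      have n1 := norm_nonneg (F₁.η t - F₂.η t)
      have n2 := norm_nonneg (F₁.ψ' t - F₂.ψ' t)
      have n3 := sq_nonneg ‖F₁.η t - F₂.η t‖
      have hη : ‖F₁.η t - F₂.η t‖ ^ 2 ≤ v * d t := by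
        calc _ ≤ 1 * d t := by rw [hd t ht0]; linarith
          _ ≤ v * d t := mul_le_mul_of_nonneg_right hv1 (hd0 t ht0)
      have hrest : 2 * r * v * ‖F₁.η t - F₂.η t‖ + 2 * r * v * ‖F₁.ψ' t - F₂.ψ' t‖
          ≤ 2 * r * (v * d t) := by
        rw [← mul_add, mul_assoc (2 * r)]
        have : ‖F₁.η t - F₂.η t‖ + ‖F₁.ψ' t - F₂.ψ' t‖ ≤ d t := by rw [hd t ht0]; linarith
        gcongr
      linarith
    have d1 : 0 ≤ F₁.diss t := Flow.diss_nonneg ht0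
    have d2 : 0 ≤ F₂.diss t := Flow.diss_nonneg ht0
    have hB := hB0 t ht0
    have hΛ : B t + F₁.diss t + F₂.diss t ≤ k * V t := by
      have := hBV t ht
      unfold Flow.size at h1 h2
      rw [hk]
      nlinarith [sq_nonneg ‖F₁.u t - F₁.ψ t‖, sq_nonneg ‖F₂.u t - F₂.ψ t‖,
        sq_nonneg ‖F₁.u' t - F₁.ψ' t‖, sq_nonneg ‖F₂.u' t - F₂.ψ' t‖]
    have hΛγ : (B t + F₁.diss t + F₂.diss t) ^ γ ≤ k ^ γ * V t ^ γ := by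
      rw [← Real.mul_rpow hk0.le hV0.le]
      exact Real.rpow_le_rpow (by positivity) hΛ hγ0.le
    -- This sign is needed to enlarge the factor in front. If it failed, the bound on Z would force
    -- Z = 0, hence P = 0 by the Poincaré inequality, and the expression would be nonnegative after
    -- all.
    have hpos : 0 ≤ -⟪P t, P' t⟫ + (2 * r + 1) * (v * d t) := by
      by_contra! hneg
      have hx : ⟪F₁.f t - F₂.f t, F₁.y t - F₂.y t⟫ + ‖F₁.η t - F₂.η t‖ ^ 2 < 0 := e4.trans_lt hneg
      have hz := hZ t ht0
      have hp : 0 ≤ C₀ * (B t + F₁.diss t + F₂.diss t) ^ γ := by positivity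
      have hz0 : Z t = 0 := le_antisymm
        (hz.trans (mul_nonpos_of_nonneg_of_nonpos hp hx.le)) (hyZ0 t ht0)
      have hPz : ‖P t‖ ^ 2 ≤ 0 := by have := hyZ t ht0; rwa [hz0, mul_zero] at this
      have hP0 : P t = 0 := by
        rw [← norm_eq_zero]; exact pow_eq_zero_iff two_ne_zero |>.1 (le_antisymm hPz (sq_nonneg _))
      rw [hP0, inner_zero_left] at hneg
      have := hd0 t ht0
      have : 0 ≤ (2 * r + 1) * (v * d t) := by positivity
      linarith
    calc Z t ≤ _ := hZ t ht0
      _ ≤ C₀ * (B t + F₁.diss t + F₂.diss t) ^ γ * (-⟪P t, P' t⟫ + (2 * r + 1) * (v * d t)) := by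
          gcongr
      _ ≤ C₀ * (k ^ γ * V t ^ γ) * (-⟪P t, P' t⟫ + (2 * r + 1) * (v * d t)) := by gcongr
      _ = (C₀ * k ^ γ / 2) * V t ^ γ * (-(2 * ⟪P t, P' t⟫) + (2 * (2 * r + 1)) * (v * d t)) := by
          ring
      _ ≤ (C₀ * k ^ γ / 2) * V t ^ γ * (-(2 * ⟪P t, P' t⟫) + C * (v * d t)) := by
          have := hd0 t ht0
          gcongr
          have : 0 < C₀ * k ^ γ := by positivity
          rw [hCdef]; linarith
      _ ≤ C * V t ^ γ * (-(2 * ⟪P t, P' t⟫) + C * (v * d t)) := by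
          have hd' : 0 ≤ v * d t := mul_nonneg (by linarith) (hd0 t ht0)
          have h2rC : 2 * (2 * r + 1) ≤ C := by
            have : 0 < C₀ * k ^ γ := by positivity
            rw [hCdef]; linarith
          have hge : 0 ≤ -(2 * ⟪P t, P' t⟫) + C * (v * d t) := by
            nlinarith [mul_le_mul_of_nonneg_right h2rC hd']
          gcongr
          have : 0 < C₀ * k ^ γ := by positivity
          rw [hCdef]; linarith
  · filter_upwards [hs1, hs2, eventually_ge_atTop 1] with t h1 h2 ht
    obtain ⟨-, -, a3⟩ := hroot F₁ t ht h1
    obtain ⟨-, -, b3⟩ := hroot F₂ t ht h2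
    have hy : (‖P t‖ ^ 2) ^ (1 / 2 : ℝ) = ‖P t‖ := by
      rw [← Real.sqrt_eq_rpow, Real.sqrt_sq (norm_nonneg _)]
    have hP'le : ‖P' t‖ ≤ 2 * r * V t ^ (1 / 2 : ℝ) := (norm_sub_le _ _).trans (by linarith)
    have hV := hV1 t ht
    rw [hy, abs_mul, abs_two]
    calc 2 * |⟪P t, P' t⟫| ≤ 2 * (‖P t‖ * ‖P' t‖) := by
          gcongr; exact abs_real_inner_le_norm _ _
      _ ≤ 2 * (‖P t‖ * (2 * r * V t ^ (1 / 2 : ℝ))) := by gcongr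
      _ = 4 * r * (V t ^ (1 / 2 : ℝ) * ‖P t‖) := by ring
      _ ≤ _ := by
          gcongr
          have : 0 < C₀ * k ^ γ := by positivity
          rw [hCdef]; linarith

end Asymptotics

/-! ## Weighted Lebesgue spaces -/

section Weighted

variable {n : ℕ} {U : Set (E n)} {w : E n → ℝ} {F : Type*} [NormedAddCommGroup F]

theorem wMeasure_absolutelyContinuous : wMeasure U w ≪ volume.restrict U :=
  withDensity_absolutelyContinuous _ _

theorem ae_wMeasure_of_forall_mem (hU : MeasurableSet U) {p : E n → Prop} (h : ∀ x ∈ U, p x) :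
    ∀ᵐ x ∂wMeasure U w, p x :=
  wMeasure_absolutelyContinuous.ae_le ((ae_restrict_mem hU).mono h)

theorem lintegral_wMeasure (hw : AEMeasurable w (volume.restrict U)) (f : E n → ℝ≥0∞) :
    ∫⁻ x, f x ∂wMeasure U w = ∫⁻ x in U, ENNReal.ofReal (w x) * f x := by
  rw [wMeasure, lintegral_withDensity_eq_lintegral_mul_non_measurable₀ _ hw.ennreal_ofReal
    (ae_of_all _ fun _ => ENNReal.ofReal_lt_top)]
  rfl

theorem integral_wMeasure (hU : MeasurableSet U) (hw : AEMeasurable w (volume.restrict U))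
    (hw0 : ∀ x ∈ U, 0 ≤ w x) (f : E n → ℝ) :
    ∫ x, f x ∂wMeasure U w = ∫ x in U, w x * f x := by
  rw [wMeasure, integral_withDensity_eq_integral_toReal_smul₀ hw.ennreal_ofReal
    (ae_of_all _ fun _ => ENNReal.ofReal_lt_top)]
  refine integral_congr_ae ?_
  filter_upwards [ae_restrict_mem hU] with x hx
  rw [ENNReal.toReal_ofReal (hw0 x hx), smul_eq_mul]

theorem wNorm_eq_eLpNorm (hU : MeasurableSet U) (hw : AEMeasurable w (volume.restrict U))
    (hw0 : ∀ x ∈ U, 0 ≤ w x) {q : ℝ} (hq : 0 < q) (u : E n → F) :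
    wNorm U w q u = eLpNorm u (ENNReal.ofReal q) (wMeasure U w) := by
  rw [eLpNorm_eq_lintegral_rpow_enorm_toReal (by simpa using hq) ENNReal.ofReal_ne_top,
    lintegral_wMeasure hw, ENNReal.toReal_ofReal hq.le, wNorm]
  congr 1
  refine lintegral_congr_ae ?_
  filter_upwards [ae_restrict_mem hU] with x hx
  rw [ENNReal.ofReal_mul (hw0 x hx), ← ENNReal.ofReal_rpow_of_nonneg (norm_nonneg _) hq.le,
    ofReal_norm]

theorem wNorm_two_eq_eLpNorm (hU : MeasurableSet U) (hw : AEMeasurable w (volume.restrict U))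
    (hw0 : ∀ x ∈ U, 0 ≤ w x) (u : E n → F) :
    wNorm U w 2 u = eLpNorm u 2 (wMeasure U w) := by
  rw [wNorm_eq_eLpNorm hU hw hw0 two_pos]; simp

theorem wNorm_two_eq_norm (hU : MeasurableSet U) (hw : AEMeasurable w (volume.restrict U))
    (hw0 : ∀ x ∈ U, 0 ≤ w x) {u : E n → F} {c : Lp F 2 (wMeasure U w)}
    (hc : c =ᵐ[wMeasure U w] u) : wNorm U w 2 u = ENNReal.ofReal ‖c‖ := by
  rw [wNorm_two_eq_eLpNorm hU hw hw0, ← eLpNorm_congr_ae hc, ofReal_norm, Lp.enorm_def]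

theorem norm_sq_eq_integral [InnerProductSpace ℝ F] {u : E n → F} {c : Lp F 2 (wMeasure U w)}
    (hc : c =ᵐ[wMeasure U w] u) : ‖c‖ ^ 2 = ∫ x, ‖u x‖ ^ 2 ∂wMeasure U w := by
  rw [← real_inner_self_eq_norm_sq, L2.inner_def]
  refine integral_congr_ae ?_
  filter_upwards [hc] with x hx
  rw [real_inner_self_eq_norm_sq, hx]

theorem wInt_two_eq_norm_sq [InnerProductSpace ℝ F] (hU : MeasurableSet U)
    (hw : AEMeasurable w (volume.restrict U)) (hw0 : ∀ x ∈ U, 0 ≤ w x) {u : E n → F}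
    {c : Lp F 2 (wMeasure U w)} (hc : c =ᵐ[wMeasure U w] u) : wInt U w 2 u = ‖c‖ ^ 2 := by
  rw [norm_sq_eq_integral hc, integral_wMeasure hU hw hw0, wInt]
  simp_rw [Real.rpow_two]

theorem wInt_nonneg (hU : MeasurableSet U) (hw0 : ∀ x ∈ U, 0 ≤ w x) {q : ℝ} (u : E n → F) :
    0 ≤ wInt U w q u :=
  setIntegral_nonneg hU fun x hx => mul_nonneg (hw0 x hx) (Real.rpow_nonneg (norm_nonneg _) _)

theorem inner_eq_integral_of_ae [InnerProductSpace ℝ F] {u v : E n → F}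
    {c d : Lp F 2 (wMeasure U w)} (hc : c =ᵐ[wMeasure U w] u) (hd : d =ᵐ[wMeasure U w] v) :
    inner ℝ c d = ∫ x, inner ℝ (u x) (v x) ∂wMeasure U w := by
  rw [L2.inner_def]
  refine integral_congr_ae ?_
  filter_upwards [hc, hd] with x h1 h2
  rw [h1, h2]

theorem integrable_inner_of_ae [InnerProductSpace ℝ F] {u v : E n → F}
    {c d : Lp F 2 (wMeasure U w)} (hc : c =ᵐ[wMeasure U w] u) (hd : d =ᵐ[wMeasure U w] v) :
    Integrable (fun x => inner ℝ (u x) (v x)) (wMeasure U w) := by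
  refine (L2.integrable_inner (𝕜 := ℝ) c d).congr ?_
  filter_upwards [hc, hd] with x h1 h2
  rw [h1, h2]

theorem coeFn_sub_ae {u v : E n → F} {c d : Lp F 2 (wMeasure U w)}
    (hc : c =ᵐ[wMeasure U w] u) (hd : d =ᵐ[wMeasure U w] v) :
    (c - d : Lp F 2 (wMeasure U w)) =ᵐ[wMeasure U w] fun x => u x - v x := by
  filter_upwards [Lp.coeFn_sub c d, hc, hd] with x h1 h2 h3
  rw [h1, Pi.sub_apply, h2, h3]

end Weighted

/-! ## Regular functions as curves in `L²` -/

namespace RegFun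

variable {n : ℕ} {U : Set (E n)} {φ a₀ : E n → ℝ} (R : RegFun U φ a₀)

/-- `u(t)` as an element of `L²_φ`. -/
def valL : ℝ → Lp ℝ 2 (wMeasure U φ) := R.val_curve.choose

/-- `u_t(t)` as an element of `L²_φ`. -/
def dtL : ℝ → Lp ℝ 2 (wMeasure U φ) := R.dt_curve.choose

/-- `u_tt(t)` as an element of `L²_φ`. -/
def dttL : ℝ → Lp ℝ 2 (wMeasure U φ) := R.dt_curve.choose_spec.choose

/-- `∇u(t)` as an element of `L²_{1/a₀}`. -/
def gradL : ℝ → Lp (E n) 2 (wMeasure U fun x => (a₀ x)⁻¹) := R.grad_curve.choose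

/-- `∇u_t(t)` as an element of `L²_{1/a₀}`. -/
def gradDtL : ℝ → Lp (E n) 2 (wMeasure U fun x => (a₀ x)⁻¹) := R.grad_curve.choose_spec.choose

theorem valL_ae {t : ℝ} (ht : 0 < t) : R.valL t =ᵐ[wMeasure U φ] R.val t :=
  R.val_curve.choose_spec.choose_spec.1 t ht

theorem dtL_ae {t : ℝ} (ht : 0 < t) : R.dtL t =ᵐ[wMeasure U φ] R.dt t :=
  R.dt_curve.choose_spec.choose_spec.1 t ht

theorem dttL_ae {t : ℝ} (ht : 0 < t) : R.dttL t =ᵐ[wMeasure U φ] R.dtt t :=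
  R.dt_curve.choose_spec.choose_spec.2.1 t ht

theorem gradL_ae {t : ℝ} (ht : 0 < t) :
    R.gradL t =ᵐ[wMeasure U fun x => (a₀ x)⁻¹] R.grad t :=
  R.grad_curve.choose_spec.choose_spec.1 t ht

theorem gradDtL_ae {t : ℝ} (ht : 0 < t) :
    R.gradDtL t =ᵐ[wMeasure U fun x => (a₀ x)⁻¹] R.gradDt t :=
  R.grad_curve.choose_spec.choose_spec.2.1 t ht

/-- The curve u_t is chosen twice, as the derivative in `val_curve` and as the curve in `dt_curve`.
Both represent `R.dt t`, so they agree in L². -/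
theorem hasDerivAt_valL {t : ℝ} (ht : 0 < t) : HasDerivAt R.valL (R.dtL t) t := by
  have h := R.val_curve.choose_spec.choose_spec.2.2.1 t ht
  have he : R.val_curve.choose_spec.choose t = R.dtL t :=
    Lp.ext ((R.val_curve.choose_spec.choose_spec.2.1 t ht).trans (R.dtL_ae ht).symm)
  rwa [he] at h

theorem hasDerivAt_dtL {t : ℝ} (ht : 0 < t) : HasDerivAt R.dtL (R.dttL t) t :=
  R.dt_curve.choose_spec.choose_spec.2.2.1 t ht

theorem hasDerivAt_gradL {t : ℝ} (ht : 0 < t) : HasDerivAt R.gradL (R.gradDtL t) t :=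
  R.grad_curve.choose_spec.choose_spec.2.2.1 t ht

theorem continuousOn_dttL : ContinuousOn R.dttL (Ioi 0) :=
  R.dt_curve.choose_spec.choose_spec.2.2.2

theorem continuousOn_gradDtL : ContinuousOn R.gradDtL (Ioi 0) :=
  R.grad_curve.choose_spec.choose_spec.2.2.2

end RegFun

/-! ## The flow of a solution -/

section SolutionFlow

variable {n N : ℕ} {U : Set (E n)} {φ : E n → ℝ} {α : Fin (N + 1) → ℝ}
  {a : Fin (N + 1) → E n → ℝ}

namespace IsMedium

theorem inv_meas (hm : IsMedium U φ a) :
    AEMeasurable (fun x => (a 0 x)⁻¹) (volume.restrict U) := (hm.coeff_meas 0).inv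

theorem inv_pos (hm : IsMedium U φ a) : ∀ x ∈ U, 0 < (a 0 x)⁻¹ := fun x hx =>
  _root_.inv_pos.2 (hm.coeff_zero_pos x hx)

theorem inv_nonneg (hm : IsMedium U φ a) : ∀ x ∈ U, 0 ≤ (a 0 x)⁻¹ := fun x hx =>
  (hm.inv_pos x hx).le

theorem porosity_nonneg (hm : IsMedium U φ a) : ∀ x ∈ U, 0 ≤ φ x := fun x hx =>
  (hm.porosity_pos x hx).le

end IsMedium

variable {p Ψ q Θ : RegFun U φ (a 0)} {p₀ q₀ : E n → ℝ}

/-- The flux at time `t`. -/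
def fluxAt (α : Fin (N + 1) → ℝ) (p : RegFun U φ (a 0)) (t : ℝ) (x : E n) : E n :=
  flux α a x (p.grad t x)

/-- K is defined through an infimum; measurability of the flux is taken from its local integrability
instead. -/
theorem IsSolution.aestronglyMeasurable_flux (hp : IsSolution α p Ψ p₀) {t : ℝ} (ht : 0 < t) :
    AEStronglyMeasurable (fluxAt α p t) (volume.restrict U) :=
  (hp.flux_locInt t ht).aestronglyMeasurable

/-- |y| = g·|flux| and g ≥ a₀. Hence a₀·flux inherits membership in L²_{1/a₀} from ∇p. -/
theorem norm_smul_flux_le (hα : AdmissibleExp α) {x : E n} (ha : AdmissibleAt a x) (y : E n) :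
    ‖a 0 x • flux α a x y‖ ≤ ‖y‖ := by
  conv_rhs => rw [← g_smul_flux hα ha y]
  rw [norm_smul, norm_smul, Real.norm_of_nonneg ha.zero_pos.le,
    Real.norm_of_nonneg (g_nonneg ha (norm_nonneg _))]
  exact mul_le_mul_of_nonneg_right (zero_le_g hα ha (norm_nonneg _)) (norm_nonneg _)

theorem IsSolution.memLp_flux (hU : MeasurableSet U) (hm : IsMedium U φ a)
    (hα : AdmissibleExp α) (hp : IsSolution α p Ψ p₀) {t : ℝ} (ht : 0 < t) :
    MemLp (fun x => a 0 x • fluxAt α p t x) 2 (wMeasure U fun x => (a 0 x)⁻¹) := by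
  have hg : MemLp (p.grad t) 2 (wMeasure U fun x => (a 0 x)⁻¹) :=
    (memLp_congr_ae (p.gradL_ae ht)).1 (Lp.memLp _)
  refine hg.of_le (AEStronglyMeasurable.mono_ac wMeasure_absolutelyContinuous
    ((hm.coeff_meas 0).aestronglyMeasurable.smul (hp.aestronglyMeasurable_flux ht)))
    (ae_wMeasure_of_forall_mem hU fun x hx => norm_smul_flux_le hα (hm.admissibleAt hx) _)

open Classical in
/-- `a₀ K(x,|∇p|)∇p` as a curve in `L²_{1/a₀}`. -/
def fluxL (α : Fin (N + 1) → ℝ) (p : RegFun U φ (a 0)) (t : ℝ) :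
    Lp (E n) 2 (wMeasure U fun x => (a 0 x)⁻¹) :=
  if h : MemLp (fun x => a 0 x • fluxAt α p t x) 2 (wMeasure U fun x => (a 0 x)⁻¹) then h.toLp _
  else 0

theorem IsSolution.fluxL_ae (hU : MeasurableSet U) (hm : IsMedium U φ a)
    (hα : AdmissibleExp α) (hp : IsSolution α p Ψ p₀) {t : ℝ} (ht : 0 < t) :
    fluxL α p t =ᵐ[wMeasure U fun x => (a 0 x)⁻¹] fun x => a 0 x • fluxAt α p t x := by
  rw [fluxL, dif_pos (hp.memLp_flux hU hm hα ht)]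
  exact MemLp.coeFn_toLp _

/-- The weak formulation tested with `q - Θ`, for any `q` with boundary values `Θ`. -/
theorem IsSolution.inner_dtL_eq (hU : MeasurableSet U) (hm : IsMedium U φ a)
    (hα : AdmissibleExp α) (hp : IsSolution α p Ψ p₀) (hq : IsSolution α q Θ q₀) {s t : ℝ}
    (hs : 0 < s) (ht : 0 < t) :
    inner ℝ (p.dtL s) (q.valL t - Θ.valL t)
      = -inner ℝ (fluxL α p s) (q.gradL t - Θ.gradL t) := by
  set u := q.valL t - Θ.valL t
  set v := q.gradL t - Θ.gradL t
  have hu : u =ᵐ[wMeasure U φ] fun x => q.val t x - Θ.val t x :=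
    coeFn_sub_ae (q.valL_ae ht) (Θ.valL_ae ht)
  have hv : v =ᵐ[wMeasure U fun x => (a 0 x)⁻¹] fun x => q.grad t x - Θ.grad t x :=
    coeFn_sub_ae (q.gradL_ae ht) (Θ.gradL_ae ht)
  -- q - Θ is approximated by a test function ζ. The equation annihilates the part coming from ζ, so
  -- only the remainders e₁, e₂ of norm at most ε contribute.
  have key : ∀ ε > 0, |inner ℝ (p.dtL s) u + inner ℝ (fluxL α p s) v|
      ≤ (‖p.dtL s‖ + ‖fluxL α p s‖) * ε := by
    intro ε hε
    obtain ⟨ζ, hζ, hlt⟩ := hq.bdry t ht (ENNReal.ofReal ε) (by simpa using hε)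
    rw [wNorm_two_eq_eLpNorm hU hm.porosity_meas hm.porosity_nonneg,
      wNorm_two_eq_eLpNorm hU hm.inv_meas hm.inv_nonneg] at hlt
    have hζc : Continuous ζ := hζ.smooth.continuous
    have hgc : Continuous (gradient ζ) :=
      (InnerProductSpace.toDual ℝ (E n)).symm.continuous.comp
        (hζ.smooth.continuous_fderiv (by simp))
    set d₁ : E n → ℝ := fun x => q.val t x - Θ.val t x - ζ x
    set d₂ : E n → E n := fun x => q.grad t x - Θ.grad t x - gradient ζ x
    have hd₁ : MemLp d₁ 2 (wMeasure U φ) :=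
      ⟨((Lp.aestronglyMeasurable u).congr hu).sub hζc.aestronglyMeasurable,
        (le_self_add.trans_lt hlt).trans_le le_top⟩
    have hd₂ : MemLp d₂ 2 (wMeasure U fun x => (a 0 x)⁻¹) :=
      ⟨((Lp.aestronglyMeasurable v).congr hv).sub hgc.aestronglyMeasurable,
        (le_add_self.trans_lt hlt).trans_le le_top⟩
    set e₁ := hd₁.toLp d₁
    set e₂ := hd₂.toLp d₂
    have hn₁ : ‖e₁‖ ≤ ε := by
      rw [Lp.norm_toLp]
      exact ENNReal.toReal_le_of_le_ofReal hε.le (le_self_add.trans hlt.le)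
    have hn₂ : ‖e₂‖ ≤ ε := by
      rw [Lp.norm_toLp]
      exact ENNReal.toReal_le_of_le_ofReal hε.le (le_add_self.trans hlt.le)
    have h1 : (u - e₁ : Lp ℝ 2 (wMeasure U φ)) =ᵐ[wMeasure U φ] ζ := by
      filter_upwards [coeFn_sub_ae hu hd₁.coeFn_toLp] with x hx
      rw [hx]; simp [d₁]
    have h2 : (v - e₂ : Lp (E n) 2 (wMeasure U fun x => (a 0 x)⁻¹))
        =ᵐ[wMeasure U fun x => (a 0 x)⁻¹] gradient ζ := by
      filter_upwards [coeFn_sub_ae hv hd₂.coeFn_toLp] with x hx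
      rw [hx]; simp [d₂]
    have h3 : inner ℝ (p.dtL s) (u - e₁) = ∫ x in U, φ x * p.dt s x * ζ x := by
      rw [inner_eq_integral_of_ae (p.dtL_ae hs) h1,
        integral_wMeasure hU hm.porosity_meas hm.porosity_nonneg]
      refine integral_congr_ae (ae_of_all _ fun x => ?_)
      simp only [RCLike.inner_apply, conj_trivial]
      ring
    have h4 : inner ℝ (fluxL α p s) (v - e₂)
        = ∫ x in U, K α a x ‖p.grad s x‖ * inner ℝ (p.grad s x) (gradient ζ x) := by
      rw [inner_eq_integral_of_ae (hp.fluxL_ae hU hm hα hs) h2,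
        integral_wMeasure hU hm.inv_meas hm.inv_nonneg]
      refine integral_congr_ae ?_
      filter_upwards [ae_restrict_mem hU] with x hx
      have := (hm.coeff_zero_pos x hx).ne'
      rw [fluxAt, flux, inner_smul_left, inner_smul_left]
      simp only [conj_trivial]
      field_simp
    have h5 := hp.pde s hs ζ hζ
    rw [← h3, ← h4] at h5
    rw [inner_sub_right _ u, inner_sub_right _ v] at h5
    have h6 : inner ℝ (p.dtL s) u + inner ℝ (fluxL α p s) v
        = inner ℝ (p.dtL s) e₁ + inner ℝ (fluxL α p s) e₂ := by linarith
    rw [h6, add_mul]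
    refine (abs_add_le _ _).trans (add_le_add ?_ ?_)
    · exact (abs_real_inner_le_norm _ _).trans (by gcongr)
    · exact (abs_real_inner_le_norm _ _).trans (by gcongr)
  have hzero : |inner ℝ (p.dtL s) u + inner ℝ (fluxL α p s) v| ≤ 0 := by
    refine le_of_forall_pos_le_add fun ε hε => ?_
    set A := ‖p.dtL s‖ + ‖fluxL α p s‖
    have hA : 0 ≤ A := by positivity
    refine (key (ε / (A + 1)) (by positivity)).trans ?_
    rw [zero_add, mul_div_assoc', div_le_iff₀ (by positivity)]
    nlinarith
  have := abs_nonpos_iff.1 hzero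
  linarith

theorem aemeasurable_potential (hm : IsMedium U φ a) {s : E n → ℝ}
    (hs : AEMeasurable s (volume.restrict U)) :
    AEMeasurable (fun x => potential α a x (s x)) (volume.restrict U) := by
  unfold potential
  exact Finset.aemeasurable_fun_sum _ fun j _ =>
    (hm.coeff_meas j).mul ((hs.pow_const _).const_mul _)

theorem aemeasurable_g (hm : IsMedium U φ a) {s : E n → ℝ}
    (hs : AEMeasurable s (volume.restrict U)) :
    AEMeasurable (fun x => g α a x (s x)) (volume.restrict U) := by
  unfold g
  exact Finset.aemeasurable_fun_sum _ fun j _ => (hm.coeff_meas j).mul (hs.pow_const _)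

theorem potential_nonneg (hα : AdmissibleExp α) {x : E n} (ha : AdmissibleAt a x) {s : ℝ}
    (hs : 0 ≤ s) : 0 ≤ potential α a x s := by
  have h1 := le_two_potential (α := α) hα ha hs
  have h2 := g_nonneg (α := α) ha hs
  nlinarith [mul_nonneg (sq_nonneg s) h2]

/-- The potential energy density with respect to the measure `dx / a₀`. -/
def potentialAt (α : Fin (N + 1) → ℝ) (p : RegFun U φ (a 0)) (t : ℝ) (x : E n) : ℝ :=
  a 0 x * potential α a x ‖fluxAt α p t x‖

theorem IsSolution.integrable_inner_flux (hU : MeasurableSet U) (hm : IsMedium U φ a)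
    (hα : AdmissibleExp α) (hp : IsSolution α p Ψ p₀) {s t : ℝ} (hs : 0 < s) (ht : 0 < t) :
    Integrable (fun x => inner ℝ (a 0 x • fluxAt α p s x) (q.grad t x))
      (wMeasure U fun x => (a 0 x)⁻¹) :=
  integrable_inner_of_ae (hp.fluxL_ae hU hm hα hs) (q.gradL_ae ht)

/-- The potential is dominated by the dissipation density, a pairing of two L² fields. -/
theorem IsSolution.integrable_potentialAt (hU : MeasurableSet U) (hm : IsMedium U φ a)
    (hα : AdmissibleExp α) (hp : IsSolution α p Ψ p₀) {t : ℝ} (ht : 0 < t) :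
    Integrable (potentialAt α p t) (wMeasure U fun x => (a 0 x)⁻¹) := by
  refine (hp.integrable_inner_flux hU hm hα ht ht (q := p)).mono ?_ ?_
  · exact (((hm.coeff_meas 0).mul (aemeasurable_potential hm
      (hp.aestronglyMeasurable_flux ht).norm.aemeasurable)).mono_ac
        wMeasure_absolutelyContinuous).aestronglyMeasurable
  · refine ae_wMeasure_of_forall_mem hU fun x hx => ?_
    have ha := hm.admissibleAt hx
    rw [fluxAt, inner_smul_left, inner_flux_self hα ha, potentialAt, fluxAt]
    simp only [conj_trivial]
    have h0 := ha.zero_pos.le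
    have h1 := potential_le hα ha (norm_nonneg (flux α a x (p.grad t x)))
    have h2 := potential_nonneg hα ha (norm_nonneg (flux α a x (p.grad t x)))
    rw [Real.norm_of_nonneg (mul_nonneg h0 h2),
      Real.norm_of_nonneg (mul_nonneg h0 (h2.trans h1))]
    exact mul_le_mul_of_nonneg_left h1 h0

/-- The flow associated with a solution. -/
def IsSolution.toFlow (hU : MeasurableSet U) (hm : IsMedium U φ a)
    (hα : AdmissibleExp α) (hp : IsSolution α p Ψ p₀) :
    Flow (Lp ℝ 2 (wMeasure U φ)) (Lp (E n) 2 (wMeasure U fun x => (a 0 x)⁻¹)) where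
  u := p.valL
  u' := p.dtL
  u'' := p.dttL
  ψ := Ψ.valL
  ψ' := Ψ.dtL
  ψ'' := Ψ.dttL
  y := p.gradL
  y' := p.gradDtL
  η := Ψ.gradL
  η' := Ψ.gradDtL
  f := fluxL α p
  j := fun t => ∫ x, potentialAt α p t x ∂wMeasure U fun x => (a 0 x)⁻¹
  hasDerivAt_u _ ht := p.hasDerivAt_valL ht
  hasDerivAt_u' _ ht := p.hasDerivAt_dtL ht
  hasDerivAt_ψ _ ht := Ψ.hasDerivAt_valL ht
  hasDerivAt_ψ' _ ht := Ψ.hasDerivAt_dtL ht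
  hasDerivAt_y _ ht := p.hasDerivAt_gradL ht
  hasDerivAt_η _ ht := Ψ.hasDerivAt_gradL ht
  continuousOn_ψ'' := Ψ.continuousOn_dttL
  continuousOn_η' := Ψ.continuousOn_gradDtL
  -- Against dx/a₀ the field f = a₀·flux carries a spare a₀: multiplying the pointwise cocoercivity
  -- by a₀ gives cocoercivity with constant 1.
  cocoercive s hs t ht := by
    have hf := coeFn_sub_ae (hp.fluxL_ae hU hm hα hs) (hp.fluxL_ae hU hm hα ht)
    have hy := coeFn_sub_ae (p.gradL_ae hs) (p.gradL_ae ht)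
    rw [← real_inner_self_eq_norm_sq, inner_eq_integral_of_ae hf hf, inner_eq_integral_of_ae hf hy]
    refine integral_mono_ae (integrable_inner_of_ae hf hf) (integrable_inner_of_ae hf hy)
      (ae_wMeasure_of_forall_mem hU fun x hx => ?_)
    have ha := hm.admissibleAt hx
    have h := flux_cocoercive hα ha (p.grad t x) (p.grad s x)
    simp only [fluxAt]
    rw [← smul_sub, inner_smul_left, inner_smul_left, inner_smul_right,
      real_inner_self_eq_norm_sq]
    exact mul_le_mul_of_nonneg_left h ha.zero_pos.le
  norm_f_sq_le t ht := by
    have hf := hp.fluxL_ae hU hm hα ht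
    have hy := p.gradL_ae ht
    rw [← real_inner_self_eq_norm_sq, inner_eq_integral_of_ae hf hf, inner_eq_integral_of_ae hf hy]
    refine integral_mono_ae (integrable_inner_of_ae hf hf) (integrable_inner_of_ae hf hy)
      (ae_wMeasure_of_forall_mem hU fun x hx => ?_)
    have ha := hm.admissibleAt hx
    have h1 := zero_le_g hα ha (norm_nonneg (flux α a x (p.grad t x)))
    simp only [fluxAt]
    rw [inner_smul_left, inner_smul_left, inner_smul_right, real_inner_self_eq_norm_sq,
      inner_flux_self hα ha]
    simp only [conj_trivial]
    rw [mul_comm (‖flux α a x (p.grad t x)‖ ^ 2)]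
    have := ha.zero_pos.le
    gcongr
  le_j_sub s hs t ht := by
    have hf := hp.fluxL_ae hU hm hα ht
    have hy := coeFn_sub_ae (p.gradL_ae hs) (p.gradL_ae ht)
    rw [inner_eq_integral_of_ae hf hy, ← integral_sub (hp.integrable_potentialAt hU hm hα hs)
      (hp.integrable_potentialAt hU hm hα ht)]
    refine integral_mono_ae (integrable_inner_of_ae hf hy)
      ((hp.integrable_potentialAt hU hm hα hs).sub (hp.integrable_potentialAt hU hm hα ht))
      (ae_wMeasure_of_forall_mem hU fun x hx => ?_)
    have ha := hm.admissibleAt hx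
    have h := inner_flux_sub_le_potential hα ha (p.grad t x) (p.grad s x)
    simp only [potentialAt, fluxAt]
    rw [inner_smul_left, ← mul_sub]
    exact mul_le_mul_of_nonneg_left h ha.zero_pos.le
  j_le t ht := by
    have hf := hp.fluxL_ae hU hm hα ht
    have hy := p.gradL_ae ht
    rw [inner_eq_integral_of_ae hf hy]
    refine integral_mono_ae (hp.integrable_potentialAt hU hm hα ht) (integrable_inner_of_ae hf hy)
      (ae_wMeasure_of_forall_mem hU fun x hx => ?_)
    have ha := hm.admissibleAt hx
    simp only [potentialAt, fluxAt]
    rw [inner_smul_left, inner_flux_self hα ha]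
    exact mul_le_mul_of_nonneg_left (potential_le hα ha (norm_nonneg _)) ha.zero_pos.le
  le_two_j t ht := by
    have hf := hp.fluxL_ae hU hm hα ht
    have hy := p.gradL_ae ht
    rw [inner_eq_integral_of_ae hf hy, ← integral_const_mul]
    refine integral_mono_ae (integrable_inner_of_ae hf hy)
      ((hp.integrable_potentialAt hU hm hα ht).const_mul 2)
      (ae_wMeasure_of_forall_mem hU fun x hx => ?_)
    have ha := hm.admissibleAt hx
    simp only [potentialAt, fluxAt]
    rw [inner_smul_left, inner_flux_self hα ha, mul_left_comm 2]
    exact mul_le_mul_of_nonneg_left (le_two_potential hα ha (norm_nonneg _)) ha.zero_pos.le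
  weak _ hs _ ht := hp.inner_dtL_eq hU hm hα hp hs ht

end SolutionFlow

/-! ## Weighted inequalities for the gradients -/

section Gradients

variable {n N : ℕ} {U : Set (E n)} {φ : E n → ℝ} {α : Fin (N + 1) → ℝ}
  {a : Fin (N + 1) → E n → ℝ}

theorem W1_nonneg_on (hm : IsMedium U φ a) : ∀ x ∈ U, 0 ≤ W1 α a x := fun _ hx =>
  W1_nonneg (hm.admissibleAt hx)

theorem aemeasurable_W1 (hm : IsMedium U φ a) : AEMeasurable (W1 α a) (volume.restrict U) := by
  have hmax : AEMeasurable (maxCoeff a) (volume.restrict U) := by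
    refine ⟨fun x => Finset.univ.sup' Finset.univ_nonempty fun j => (hm.coeff_meas j).mk _ x,
      ?_, ?_⟩
    · have := Finset.measurable_sup' Finset.univ_nonempty
        fun j (_ : j ∈ Finset.univ) => (hm.coeff_meas j).measurable_mk
      convert this using 1
      ext x
      rw [Finset.sup'_apply]
    · have : ∀ᵐ x ∂volume.restrict U, ∀ j, a j x = (hm.coeff_meas j).mk _ x :=
        ae_all_iff.2 fun j => (hm.coeff_meas j).ae_eq_mk
      filter_upwards [this] with x hx
      unfold maxCoeff
      simp_rw [hx]
  exact ((hm.coeff_meas _).pow_const _).div (hmax.const_mul _)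

/-- The bound on W₁ raised to the power a/2, arranged as the integrand for Hölder's inequality with
exponents 2/(2-a) and 2/a. -/
theorem W1_mul_rpow_le (hα : AdmissibleExp α) {x : E n} (ha : AdmissibleAt a x) {s r : ℝ}
    (hs : 0 ≤ s) (hr : 0 ≤ r) :
    W1 α a x * r ^ (2 - aExp α) ≤ (r ^ 2 / g α a x s) ^ ((2 - aExp α) / 2)
      * (s ^ 2 * g α a x s + a (Fin.last N) x) ^ (aExp α / 2) := by
  have hb := hα.aExp_pos
  have hb1 := hα.aExp_lt_one
  have hg := g_pos hα ha hs
  have hW := W1_nonneg (α := α) ha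
  have h := Real.rpow_le_rpow (by positivity) (W1_rpow_mul_g_rpow_le hα ha hs)
    (by positivity : 0 ≤ aExp α / 2)
  rw [Real.mul_rpow (by positivity) (by positivity), ← Real.rpow_mul hW, ← Real.rpow_mul hg.le,
    show 2 / aExp α * (aExp α / 2) = 1 by field_simp,
    show (2 - aExp α) / aExp α * (aExp α / 2) = (2 - aExp α) / 2 by field_simp,
    Real.rpow_one] at h
  rw [Real.div_rpow (by positivity) hg.le, ← Real.rpow_natCast r 2, ← Real.rpow_mul hr,
    show ((2 : ℕ) : ℝ) * ((2 - aExp α) / 2) = 2 - aExp α by push_cast; ring]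
  have hgp : 0 < g α a x s ^ ((2 - aExp α) / 2) := by positivity
  calc W1 α a x * r ^ (2 - aExp α)
      = r ^ (2 - aExp α) / g α a x s ^ ((2 - aExp α) / 2)
        * (W1 α a x * g α a x s ^ ((2 - aExp α) / 2)) := by field_simp
    _ ≤ _ := by gcongr

/-- Hölder's inequality relating `L^{2-a}_{W₁}` to a weighted `L²` norm. -/
theorem wNorm_W1_sq_le (hU : MeasurableSet U) (hm : IsMedium U φ a) (hα : AdmissibleExp α)
    {z : E n → E n} {s : E n → ℝ} (hz : AEStronglyMeasurable z (volume.restrict U))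
    (hs : AEMeasurable s (volume.restrict U)) (hs0 : ∀ x, 0 ≤ s x) :
    wNorm U (W1 α a) (2 - aExp α) z ^ 2
      ≤ (∫⁻ x in U, ENNReal.ofReal (‖z x‖ ^ 2 / g α a x (s x)))
        * (∫⁻ x in U, ENNReal.ofReal (s x ^ 2 * g α a x (s x) + a (Fin.last N) x))
          ^ (aExp α / (2 - aExp α)) := by
  have hb := hα.aExp_pos
  have hb1 := hα.aExp_lt_one
  have h2b : 0 < 2 - aExp α := by linarith
  set I := ∫⁻ x in U, ENNReal.ofReal (‖z x‖ ^ 2 / g α a x (s x))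
  set L := ∫⁻ x in U, ENNReal.ofReal (s x ^ 2 * g α a x (s x) + a (Fin.last N) x)
  have hgm := aemeasurable_g (α := α) hm hs
  set f₁ : E n → ℝ≥0∞ := fun x =>
    ENNReal.ofReal (‖z x‖ ^ 2 / g α a x (s x)) ^ ((2 - aExp α) / 2)
  set f₂ : E n → ℝ≥0∞ := fun x =>
    ENNReal.ofReal (s x ^ 2 * g α a x (s x) + a (Fin.last N) x) ^ (aExp α / 2)
  have hf₁ : AEMeasurable f₁ (volume.restrict U) :=
    (((hz.norm.aemeasurable.pow_const 2).div hgm).ennreal_ofReal).pow_const _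
  have hf₂ : AEMeasurable f₂ (volume.restrict U) :=
    ((((hs.pow_const 2).mul hgm).add (hm.coeff_meas _)).ennreal_ofReal).pow_const _
  have hconj : (2 / (2 - aExp α)).HolderConjugate (2 / aExp α) := by
    rw [Real.holderConjugate_iff]
    refine ⟨by rw [lt_div_iff₀ h2b]; linarith, ?_⟩
    field_simp
    ring
  have h1 : ∫⁻ x in U, ENNReal.ofReal (W1 α a x * ‖z x‖ ^ (2 - aExp α))
      ≤ I ^ ((2 - aExp α) / 2) * L ^ (aExp α / 2) := by
    calc _ ≤ ∫⁻ x in U, (f₁ * f₂) x := by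
          refine setLIntegral_mono_ae' hU (ae_of_all _ fun x hx => ?_)
          have ha := hm.admissibleAt hx
          have hg := g_pos hα ha (hs0 x)
          have hl := ha.last_pos
          simp only [f₁, f₂, Pi.mul_apply]
          rw [ENNReal.ofReal_rpow_of_nonneg (by positivity) (by positivity),
            ENNReal.ofReal_rpow_of_nonneg (by positivity) (by positivity),
            ← ENNReal.ofReal_mul (by positivity)]
          exact ENNReal.ofReal_le_ofReal (W1_mul_rpow_le hα ha (hs0 x) (norm_nonneg _))
      _ ≤ _ := ENNReal.lintegral_mul_le_Lp_mul_Lq _ hconj hf₁ hf₂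
      _ = _ := by
          rw [one_div_div, one_div_div]
          congr 2
          · refine lintegral_congr fun x => ?_
            simp only [f₁]
            rw [← ENNReal.rpow_mul, show (2 - aExp α) / 2 * (2 / (2 - aExp α)) = 1 by field_simp,
              ENNReal.rpow_one]
          · refine lintegral_congr fun x => ?_
            simp only [f₂]
            rw [← ENNReal.rpow_mul, show aExp α / 2 * (2 / aExp α) = 1 by field_simp,
              ENNReal.rpow_one]
  have h3 := ENNReal.rpow_le_rpow h1 (by positivity : 0 ≤ 1 / (2 - aExp α) * 2)
  rw [ENNReal.mul_rpow_of_nonneg _ _ (by positivity), ← ENNReal.rpow_mul, ← ENNReal.rpow_mul,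
    show (2 - aExp α) / 2 * (1 / (2 - aExp α) * 2) = 1 by field_simp,
    show aExp α / 2 * (1 / (2 - aExp α) * 2) = aExp α / (2 - aExp α) by field_simp,
    ENNReal.rpow_one, ENNReal.rpow_mul] at h3
  rw [wNorm]
  exact_mod_cast h3

theorem wNorm_W1_sub_le (hU : MeasurableSet U) (hm : IsMedium U φ a) (hα : AdmissibleExp α)
    {z₁ z₂ : E n → E n} (hz₁ : AEStronglyMeasurable z₁ (volume.restrict U))
    (hz₂ : AEStronglyMeasurable z₂ (volume.restrict U)) :
    wNorm U (W1 α a) (2 - aExp α) (fun x => z₁ x - z₂ x)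
      ≤ wNorm U (W1 α a) (2 - aExp α) z₁ + wNorm U (W1 α a) (2 - aExp α) z₂ := by
  have hb1 := hα.aExp_lt_one
  simp_rw [wNorm_eq_eLpNorm hU (aemeasurable_W1 hm) (W1_nonneg_on hm)
    (by linarith : 0 < 2 - aExp α)]
  refine eLpNorm_sub_le (hz₁.mono_ac wMeasure_absolutelyContinuous)
    (hz₂.mono_ac wMeasure_absolutelyContinuous) ?_
  rw [← ENNReal.ofReal_one]
  exact ENNReal.ofReal_le_ofReal (by linarith)

variable {p Ψ p₁ p₂ Ψ₁ Ψ₂ : RegFun U φ (a 0)} {p₀ p₀₁ p₀₂ : E n → ℝ}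

theorem RegFun.aestronglyMeasurable_grad (R : RegFun U φ (a 0)) {t : ℝ} (ht : 0 < t) :
    AEStronglyMeasurable (R.grad t) (volume.restrict U) :=
  (R.grad_spec t ht).locInt_grad.aestronglyMeasurable

theorem integral_last_nonneg (hU : MeasurableSet U) (hm : IsMedium U φ a) :
    0 ≤ ∫ x in U, a (Fin.last N) x :=
  setIntegral_nonneg hU fun x hx => (hm.coeff_last_pos x hx).le

theorem lintegral_last (hU : MeasurableSet U) (hm : IsMedium U φ a) :
    ∫⁻ x in U, ENNReal.ofReal (a (Fin.last N) x) = ENNReal.ofReal (∫ x in U, a (Fin.last N) x) :=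
  (ofReal_integral_eq_lintegral_ofReal hm.coeff_last_int
    ((ae_restrict_mem hU).mono fun x hx => (hm.coeff_last_pos x hx).le)).symm

/-- The inequality for gradients in `L²_{1/a₀}`. -/
theorem wNorm_W1_sq_le_of_ae (hU : MeasurableSet U) (hm : IsMedium U φ a) (hα : AdmissibleExp α)
    {z : E n → E n} {c : Lp (E n) 2 (wMeasure U fun x => (a 0 x)⁻¹)}
    (hz : AEStronglyMeasurable z (volume.restrict U))
    (hc : c =ᵐ[wMeasure U fun x => (a 0 x)⁻¹] z) :
    wNorm U (W1 α a) (2 - aExp α) z ^ 2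
      ≤ ENNReal.ofReal (‖c‖ ^ 2 * (∫ x in U, a (Fin.last N) x) ^ (aExp α / (2 - aExp α))) := by
  have hb := hα.aExp_pos
  have hb1 := hα.aExp_lt_one
  -- With s = 0, g reduces to a₀: the first factor is the L²_{1/a₀} norm and the second is the
  -- integral of a_N.
  have h := wNorm_W1_sq_le hU hm hα hz (s := fun _ => 0) aemeasurable_const fun _ => le_rfl
  have hB := integral_last_nonneg hU hm
  refine h.trans (le_of_eq ?_)
  have e1 : ∫⁻ x in U, ENNReal.ofReal (‖z x‖ ^ 2 / g α a x 0) = ENNReal.ofReal (‖c‖ ^ 2) := by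
    have : ENNReal.ofReal (‖c‖ ^ 2) = wNorm U (fun x => (a 0 x)⁻¹) 2 z ^ 2 := by
      rw [wNorm_two_eq_norm hU hm.inv_meas hm.inv_nonneg hc, ENNReal.ofReal_pow (norm_nonneg _)]
    rw [this, wNorm, ← ENNReal.rpow_natCast, ← ENNReal.rpow_mul]
    norm_num
    refine lintegral_congr fun x => ?_
    rw [g_zero hα, div_eq_inv_mul]
  have e2 : ∫⁻ x in U, ENNReal.ofReal ((0 : ℝ) ^ 2 * g α a x 0 + a (Fin.last N) x)
      = ENNReal.ofReal (∫ x in U, a (Fin.last N) x) := by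
    rw [← lintegral_last hU hm]
    simp
  rw [e1, e2, ENNReal.ofReal_rpow_of_nonneg hB (div_nonneg hb.le (by linarith)),
    ← ENNReal.ofReal_mul (sq_nonneg _)]

theorem IsSolution.lintegral_diss (hU : MeasurableSet U) (hm : IsMedium U φ a)
    (hα : AdmissibleExp α) (hp : IsSolution α p Ψ p₀) {t : ℝ} (ht : 0 < t) :
    ∫⁻ x in U, ENNReal.ofReal (‖fluxAt α p t x‖ ^ 2 * g α a x ‖fluxAt α p t x‖)
      = ENNReal.ofReal ((hp.toFlow hU hm hα).diss t) := by
  have hi := hp.integrable_inner_flux hU hm hα ht ht (q := p)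
  have e : (hp.toFlow hU hm hα).diss t = ∫ x, inner ℝ (a 0 x • fluxAt α p t x) (p.grad t x)
      ∂wMeasure U fun x => (a 0 x)⁻¹ :=
    inner_eq_integral_of_ae (hp.fluxL_ae hU hm hα ht) (p.gradL_ae ht)
  have e2 : ∀ x ∈ U, inner ℝ (a 0 x • fluxAt α p t x) (p.grad t x)
      = a 0 x * (‖fluxAt α p t x‖ ^ 2 * g α a x ‖fluxAt α p t x‖) := fun x hx => by
    rw [inner_smul_left, fluxAt, inner_flux_self hα (hm.admissibleAt hx)]; rfl
  rw [e, ofReal_integral_eq_lintegral_ofReal hi (ae_wMeasure_of_forall_mem hU fun x hx => by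
    change 0 ≤ (inner ℝ (a 0 x • fluxAt α p t x) (p.grad t x) : ℝ)
    rw [e2 x hx]
    exact mul_nonneg (hm.coeff_zero_pos x hx).le (mul_nonneg (sq_nonneg _)
      (g_nonneg (hm.admissibleAt hx) (norm_nonneg _)))), lintegral_wMeasure hm.inv_meas]
  refine setLIntegral_congr_fun hU fun x hx => ?_
  have := hm.coeff_zero_pos x hx
  rw [e2 x hx, ← ENNReal.ofReal_mul (by positivity)]
  congr 1
  field_simp

/-- The inequality for the gradient of a solution. -/
theorem IsSolution.wNorm_W1_grad_sq_le (hU : MeasurableSet U) (hm : IsMedium U φ a)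
    (hα : AdmissibleExp α) (hp : IsSolution α p Ψ p₀) {t : ℝ} (ht : 0 < t) :
    wNorm U (W1 α a) (2 - aExp α) (p.grad t) ^ 2
      ≤ ENNReal.ofReal ((hp.toFlow hU hm hα).diss t * ((hp.toFlow hU hm hα).diss t
        + ∫ x in U, a (Fin.last N) x) ^ (aExp α / (2 - aExp α))) := by
  have hb := hα.aExp_pos
  have hb1 := hα.aExp_lt_one
  have hfm := (hp.aestronglyMeasurable_flux ht).norm.aemeasurable
  -- With s = |flux|, |∇p|²/g = s²g, so both Hölder factors are governed by the dissipation.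
  have h := wNorm_W1_sq_le hU hm hα (p.aestronglyMeasurable_grad ht)
    (s := fun x => ‖fluxAt α p t x‖) hfm fun _ => norm_nonneg _
  have hB := integral_last_nonneg hU hm
  have hd : 0 ≤ (hp.toFlow hU hm hα).diss t := Flow.diss_nonneg ht
  refine h.trans (le_of_eq ?_)
  have e1 : ∫⁻ x in U, ENNReal.ofReal (‖p.grad t x‖ ^ 2 / g α a x ‖fluxAt α p t x‖)
      = ENNReal.ofReal ((hp.toFlow hU hm hα).diss t) := by
    rw [← hp.lintegral_diss hU hm hα ht]
    refine setLIntegral_congr_fun hU fun x hx => ?_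
    have ha := hm.admissibleAt hx
    have hg := g_pos hα ha (norm_nonneg (fluxAt α p t x))
    have hn : ‖p.grad t x‖ = g α a x ‖fluxAt α p t x‖ * ‖fluxAt α p t x‖ := by
      conv_lhs => rw [← g_smul_flux hα ha (p.grad t x)]
      rw [norm_smul, Real.norm_of_nonneg (g_nonneg ha (norm_nonneg _))]
      rfl
    rw [hn]
    congr 1
    field_simp
  have e2 : ∫⁻ x in U, ENNReal.ofReal (‖fluxAt α p t x‖ ^ 2 * g α a x ‖fluxAt α p t x‖
      + a (Fin.last N) x) = ENNReal.ofReal ((hp.toFlow hU hm hα).diss t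
        + ∫ x in U, a (Fin.last N) x) := by
    rw [ENNReal.ofReal_add hd hB, ← hp.lintegral_diss hU hm hα ht, ← lintegral_last hU hm,
      ← lintegral_add_right' _ (hm.coeff_meas _).ennreal_ofReal]
    refine setLIntegral_congr_fun hU fun x hx => ?_
    exact ENNReal.ofReal_add (mul_nonneg (sq_nonneg _) (g_nonneg (hm.admissibleAt hx)
      (norm_nonneg _))) (hm.coeff_last_pos x hx).le
  rw [e1, e2, ENNReal.ofReal_rpow_of_nonneg (by positivity) (div_nonneg hb.le (by linarith)),
    ← ENNReal.ofReal_mul hd]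

/-- The inequality for the difference of the gradients of two solutions. -/
theorem IsSolution.wNorm_W1_grad_sub_sq_le (hU : MeasurableSet U) (hm : IsMedium U φ a)
    (hα : AdmissibleExp α) (h₁ : IsSolution α p₁ Ψ₁ p₀₁) (h₂ : IsSolution α p₂ Ψ₂ p₀₂) {t : ℝ}
    (ht : 0 < t) :
    0 ≤ (inner ℝ (fluxL α p₁ t - fluxL α p₂ t) (p₁.gradL t - p₂.gradL t) : ℝ) ∧
    wNorm U (W1 α a) (2 - aExp α) (fun x => p₁.grad t x - p₂.grad t x) ^ 2
      ≤ ENNReal.ofReal (2 * (2 + α (Fin.last N)) ^ 2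
          * inner ℝ (fluxL α p₁ t - fluxL α p₂ t) (p₁.gradL t - p₂.gradL t)
        * ((∫ x in U, a (Fin.last N) x) + (h₁.toFlow hU hm hα).diss t
          + (h₂.toFlow hU hm hα).diss t) ^ (aExp α / (2 - aExp α))) := by
  have hb := hα.aExp_pos
  have hb1 := hα.aExp_lt_one
  have hl := hα.last_pos
  have hm₁ := h₁.aestronglyMeasurable_flux ht
  have hm₂ := h₂.aestronglyMeasurable_flux ht
  have hsm : AEMeasurable (fun x => max ‖fluxAt α p₂ t x‖ ‖fluxAt α p₁ t x‖)
      (volume.restrict U) := hm₂.norm.aemeasurable.max hm₁.norm.aemeasurable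
  -- With s the larger of the two fluxes, the first factor matches `norm_sq_div_g_le_inner_flux`,
  -- and s²g is at most the sum of the two dissipation densities.
  have h := wNorm_W1_sq_le hU hm hα
    ((p₁.aestronglyMeasurable_grad ht).sub (p₂.aestronglyMeasurable_grad ht)) hsm
    fun _ => le_max_of_le_left (norm_nonneg _)
  have hB := integral_last_nonneg hU hm
  have hd₁ : 0 ≤ (h₁.toFlow hU hm hα).diss t := Flow.diss_nonneg ht
  have hd₂ : 0 ≤ (h₂.toFlow hU hm hα).diss t := Flow.diss_nonneg ht
  have hf := coeFn_sub_ae (h₁.fluxL_ae hU hm hα ht) (h₂.fluxL_ae hU hm hα ht)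
  have hy := coeFn_sub_ae (p₁.gradL_ae ht) (p₂.gradL_ae ht)
  set S : ℝ := inner ℝ (fluxL α p₁ t - fluxL α p₂ t) (p₁.gradL t - p₂.gradL t) with hSdef
  have hSint : S = ∫ x, inner ℝ (a 0 x • fluxAt α p₁ t x - a 0 x • fluxAt α p₂ t x)
      (p₁.grad t x - p₂.grad t x) ∂wMeasure U fun x => (a 0 x)⁻¹ := inner_eq_integral_of_ae hf hy
  have hpt : ∀ x ∈ U, inner ℝ (a 0 x • fluxAt α p₁ t x - a 0 x • fluxAt α p₂ t x)
      (p₁.grad t x - p₂.grad t x) = a 0 x * inner ℝ (fluxAt α p₁ t x - fluxAt α p₂ t x)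
        (p₁.grad t x - p₂.grad t x) := fun x _ => by rw [← smul_sub, inner_smul_left]; rfl
  have hpos : ∀ x ∈ U, 0 ≤ (inner ℝ (fluxAt α p₁ t x - fluxAt α p₂ t x)
      (p₁.grad t x - p₂.grad t x) : ℝ) := fun x hx =>
    (mul_nonneg (hm.coeff_zero_pos x hx).le (sq_nonneg _)).trans
      (flux_cocoercive hα (hm.admissibleAt hx) _ _)
  have hpos' : ∀ x ∈ U, 0 ≤ (inner ℝ (a 0 x • fluxAt α p₁ t x - a 0 x • fluxAt α p₂ t x)
      (p₁.grad t x - p₂.grad t x) : ℝ) := fun x hx => by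
    rw [hpt x hx]; exact mul_nonneg (hm.coeff_zero_pos x hx).le (hpos x hx)
  have hS0 : 0 ≤ S := by
    rw [hSint]; exact integral_nonneg_of_ae (ae_wMeasure_of_forall_mem hU hpos')
  refine ⟨hS0, h.trans ?_⟩
  set c := 2 * (2 + α (Fin.last N)) ^ 2 with hc
  have hc0 : 0 < c := by positivity
  have e1 : ∫⁻ x in U, ENNReal.ofReal (‖p₁.grad t x - p₂.grad t x‖ ^ 2
      / g α a x (max ‖fluxAt α p₂ t x‖ ‖fluxAt α p₁ t x‖)) ≤ ENNReal.ofReal (c * S) := by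
    rw [ENNReal.ofReal_mul hc0.le, hSint, ofReal_integral_eq_lintegral_ofReal
      (integrable_inner_of_ae hf hy) (ae_wMeasure_of_forall_mem hU hpos'),
      lintegral_wMeasure hm.inv_meas, ← lintegral_const_mul' _ _ ENNReal.ofReal_ne_top]
    refine setLIntegral_mono_ae' hU (ae_of_all _ fun x hx => ?_)
    have ha0 := hm.coeff_zero_pos x hx
    rw [← ENNReal.ofReal_mul (by positivity), ← ENNReal.ofReal_mul hc0.le, hpt x hx]
    refine ENNReal.ofReal_le_ofReal ?_
    have := norm_sq_div_g_le_inner_flux hα (hm.admissibleAt hx) (p₂.grad t x) (p₁.grad t x)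
    rw [inv_mul_cancel_left₀ ha0.ne']
    exact this
  have e2 : ∫⁻ x in U, ENNReal.ofReal (max ‖fluxAt α p₂ t x‖ ‖fluxAt α p₁ t x‖ ^ 2
      * g α a x (max ‖fluxAt α p₂ t x‖ ‖fluxAt α p₁ t x‖) + a (Fin.last N) x)
      ≤ ENNReal.ofReal ((∫ x in U, a (Fin.last N) x) + (h₁.toFlow hU hm hα).diss t
          + (h₂.toFlow hU hm hα).diss t) := by
    have hmeas : AEMeasurable (fun x => ENNReal.ofReal
        (‖fluxAt α p₂ t x‖ ^ 2 * g α a x ‖fluxAt α p₂ t x‖)) (volume.restrict U) :=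
      ((hm₂.norm.aemeasurable.pow_const 2).mul
        (aemeasurable_g hm hm₂.norm.aemeasurable)).ennreal_ofReal
    rw [ENNReal.ofReal_add (by positivity) hd₂, ENNReal.ofReal_add hB hd₁, ← lintegral_last hU hm,
      ← h₁.lintegral_diss hU hm hα ht, ← h₂.lintegral_diss hU hm hα ht,
      ← lintegral_add_left' (hm.coeff_meas _).ennreal_ofReal,
      ← lintegral_add_right' _ hmeas]
    refine setLIntegral_mono_ae' hU (ae_of_all _ fun x hx => ?_)
    have ha := hm.admissibleAt hx
    have g1 := mul_nonneg (sq_nonneg ‖fluxAt α p₁ t x‖)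
      (g_nonneg (α := α) ha (norm_nonneg (fluxAt α p₁ t x)))
    have g2 := mul_nonneg (sq_nonneg ‖fluxAt α p₂ t x‖)
      (g_nonneg (α := α) ha (norm_nonneg (fluxAt α p₂ t x)))
    have hA := ha.last_pos.le
    rw [← ENNReal.ofReal_add hA g1, ← ENNReal.ofReal_add (by positivity) g2]
    refine ENNReal.ofReal_le_ofReal ?_
    rcases max_cases ‖fluxAt α p₂ t x‖ ‖fluxAt α p₁ t x‖ with ⟨h, -⟩ | ⟨h, -⟩ <;> rw [h] <;>
      linarith
  rw [ENNReal.ofReal_mul (by positivity), ← ENNReal.ofReal_rpow_of_nonneg (by positivity)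
    (div_nonneg hb.le (by linarith))]
  exact mul_le_mul' e1 (ENNReal.rpow_le_rpow e2 (div_nonneg hb.le (by linarith)))

end Gradients

/-! ## Solutions as controlled flows -/

section Control

variable {n N : ℕ} {U : Set (E n)} {φ : E n → ℝ} {α : Fin (N + 1) → ℝ}
  {a : Fin (N + 1) → E n → ℝ} {p Ψ p₁ p₂ Ψ₁ Ψ₂ : RegFun U φ (a 0)} {p₀ p₀₁ p₀₂ : E n → ℝ}

theorem max_integral_le_G (hU : MeasurableSet U) (hm : IsMedium U φ a) (t : ℝ) :
    max (∫ x in U, a (Fin.last N) x) 1 ≤ G α Ψ t := by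
  have h1 : 0 ≤ wInt U (fun x => (a 0 x)⁻¹) 2 (Ψ.grad t) := wInt_nonneg hU hm.inv_nonneg _
  have h2 : 0 ≤ wInt U (W1 α a) (2 - aExp α) (Ψ.grad t) := wInt_nonneg hU (W1_nonneg_on hm) _
  have h3 : 0 ≤ wInt U φ 2 (Ψ.dt t) ^ ((2 - aExp α) / (2 * (1 - aExp α))) :=
    Real.rpow_nonneg (wInt_nonneg hU hm.porosity_nonneg _) _
  unfold G
  linarith

theorem one_le_G (hU : MeasurableSet U) (hm : IsMedium U φ a) (t : ℝ) : 1 ≤ G α Ψ t :=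
  (le_max_right _ _).trans (max_integral_le_G hU hm t)

theorem norm_gradL_sq_le_G (hU : MeasurableSet U) (hm : IsMedium U φ a) {t : ℝ} (ht : 0 < t) :
    ‖Ψ.gradL t‖ ^ 2 ≤ G α Ψ t := by
  rw [← wInt_two_eq_norm_sq hU hm.inv_meas hm.inv_nonneg (Ψ.gradL_ae ht)]
  have h1 : (1 : ℝ) ≤ max (∫ x in U, a (Fin.last N) x) 1 := le_max_right _ _
  have h2 : 0 ≤ wInt U (W1 α a) (2 - aExp α) (Ψ.grad t) := wInt_nonneg hU (W1_nonneg_on hm) _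
  have h3 : 0 ≤ wInt U φ 2 (Ψ.dt t) ^ ((2 - aExp α) / (2 * (1 - aExp α))) :=
    Real.rpow_nonneg (wInt_nonneg hU hm.porosity_nonneg _) _
  unfold G
  linarith

theorem norm_dtL_rpow_le_G (hU : MeasurableSet U) (hm : IsMedium U φ a) {t : ℝ} (ht : 0 < t) :
    ‖Ψ.dtL t‖ ^ ((2 - aExp α) / (1 - aExp α)) ≤ G α Ψ t := by
  have e : ‖Ψ.dtL t‖ ^ ((2 - aExp α) / (1 - aExp α))
      = wInt U φ 2 (Ψ.dt t) ^ ((2 - aExp α) / (2 * (1 - aExp α))) := by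
    rw [wInt_two_eq_norm_sq hU hm.porosity_meas hm.porosity_nonneg (Ψ.dtL_ae ht),
      ← Real.rpow_natCast, ← Real.rpow_mul (norm_nonneg _)]
    congr 1
    rw [Nat.cast_ofNat, mul_div_assoc', mul_div_mul_left _ _ two_ne_zero]
  have h1 : (1 : ℝ) ≤ max (∫ x in U, a (Fin.last N) x) 1 := le_max_right _ _
  have h2 : 0 ≤ wInt U (W1 α a) (2 - aExp α) (Ψ.grad t) := wInt_nonneg hU (W1_nonneg_on hm) _
  have h3 : 0 ≤ wInt U (fun x => (a 0 x)⁻¹) 2 (Ψ.grad t) := wInt_nonneg hU hm.inv_nonneg _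
  rw [e]
  unfold G
  linarith

theorem le_ofReal_sqrt_of_sq_le {x : ℝ≥0∞} {r : ℝ} (hr : 0 ≤ r) (h : x ^ 2 ≤ ENNReal.ofReal r) :
    x ≤ ENNReal.ofReal (Real.sqrt r) := by
  have e : ENNReal.ofReal r = ENNReal.ofReal (Real.sqrt r) ^ 2 := by
    rw [← ENNReal.ofReal_pow (Real.sqrt_nonneg _), Real.sq_sqrt hr]
  rw [e] at h
  exact (ENNReal.pow_le_pow_left_iff two_ne_zero).1 h

/-- Because 1 + b/(2-b) = 2/(2-b). -/
theorem sqrt_mul_rpow_le {b r q T : ℝ} (hb0 : 0 < b) (hb1 : b < 1) (hr : 0 ≤ r) (hq : 0 ≤ q)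
    (hrT : r ≤ T) (hqT : q ≤ T) : Real.sqrt (r * q ^ (b / (2 - b))) ≤ T ^ (1 / (2 - b)) := by
  have h2 : 0 < 2 - b := by linarith
  have hT : 0 ≤ T := hr.trans hrT
  refine Real.sqrt_le_iff.2 ⟨by positivity, ?_⟩
  have e : (T ^ (1 / (2 - b))) ^ 2 = T * T ^ (b / (2 - b)) := by
    nth_rewrite 2 [← Real.rpow_one T]
    rw [← Real.rpow_natCast, ← Real.rpow_mul hT, ← Real.rpow_add_of_nonneg hT zero_le_one
      (by positivity)]
    congr 1
    field_simp
    push_cast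
    ring
  rw [e]
  gcongr

/-- In the Poincaré inequality ∇p̄ is split into ∇p and ∇Ψ, each of W₁-norm at most (diss +
Γ)^{1/(2-a)}; hence the constant (2c_P)^{2-a}. A majorant Γ is allowed so that one function can
serve both solutions. -/
theorem IsSolution.controlled (hU : MeasurableSet U) (hm : IsMedium U φ a)
    (hα : AdmissibleExp α) (hp : IsSolution α p Ψ p₀) {cP : ℝ} (hcP : 0 < cP)
    (hPS : ∀ t > 0, PoincareSobolev U φ α a cP (bar p Ψ t) (gradBar p Ψ t)) {Γ : ℝ → ℝ}
    (hΓ : ∀ t > 0, G α Ψ t ≤ Γ t) :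
    (hp.toFlow hU hm hα).Controlled (aExp α) ((2 * cP) ^ (2 - aExp α)) Γ where
  one_le t ht := (one_le_G hU hm t).trans (hΓ t ht)
  norm_η_sq_le t ht := (norm_gradL_sq_le_G hU hm ht).trans (hΓ t ht)
  norm_ψ'_rpow_le t ht := (norm_dtL_rpow_le_G hU hm ht).trans (hΓ t ht)
  poincare t ht := by
    have hb0 := hα.aExp_pos
    have hb1 := hα.aExp_lt_one
    set d := (hp.toFlow hU hm hα).diss t with hd
    have hd0 : 0 ≤ d := Flow.diss_nonneg ht
    set B := ∫ x in U, a (Fin.last N) x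
    have hB0 : 0 ≤ B := integral_last_nonneg hU hm
    have hBΓ : B ≤ Γ t := (le_max_left _ _).trans ((max_integral_le_G hU hm t).trans (hΓ t ht))
    have hΓ0 : 0 ≤ Γ t := hB0.trans hBΓ
    have hη := (norm_gradL_sq_le_G (α := α) (Ψ := Ψ) hU hm ht).trans (hΓ t ht)
    set T := d + Γ t with hT
    have hT0 : 0 ≤ T := by positivity
    have hN₁ := (le_ofReal_sqrt_of_sq_le (by positivity)
      (hp.wNorm_W1_grad_sq_le hU hm hα ht)).trans (ENNReal.ofReal_le_ofReal
        (sqrt_mul_rpow_le hb0 hb1 hd0 (by positivity) (by linarith : d ≤ T)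
          (by linarith : d + B ≤ T)))
    have hN₂ := (le_ofReal_sqrt_of_sq_le (by positivity)
      (wNorm_W1_sq_le_of_ae hU hm hα (Ψ.aestronglyMeasurable_grad ht)
        (Ψ.gradL_ae ht))).trans (ENNReal.ofReal_le_ofReal
        (sqrt_mul_rpow_le hb0 hb1 (sq_nonneg _) hB0 (by linarith : _ ≤ T)
          (by linarith : B ≤ T)))
    have hn := wNorm_two_eq_norm hU hm.porosity_meas hm.porosity_nonneg
      (coeFn_sub_ae (p.valL_ae ht) (Ψ.valL_ae ht))
    have h1 : ENNReal.ofReal ‖p.valL t - Ψ.valL t‖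
        ≤ ENNReal.ofReal (cP * (2 * T ^ (1 / (2 - aExp α)))) := by
      rw [← hn, ENNReal.ofReal_mul hcP.le, two_mul,
        ENNReal.ofReal_add (by positivity) (by positivity)]
      refine (hPS t ht).trans ?_
      gcongr
      exact (wNorm_W1_sub_le hU hm hα (p.aestronglyMeasurable_grad ht)
        (Ψ.aestronglyMeasurable_grad ht)).trans (add_le_add hN₁ hN₂)
    have h2 := (ENNReal.ofReal_le_ofReal_iff (by positivity)).1 h1
    have h3 := Real.rpow_le_rpow (norm_nonneg _) h2 (by linarith : 0 ≤ 2 - aExp α)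
    rw [← mul_assoc, mul_comm cP, Real.mul_rpow (by positivity) (by positivity),
      ← Real.rpow_mul hT0, one_div_mul_cancel (by linarith), Real.rpow_one] at h3
    exact h3

/-- `‖∇P̄‖²` in terms of the monotonicity of the flux. -/
theorem wNorm_W1_gradBar_sub_sq_le (hU : MeasurableSet U) (hm : IsMedium U φ a)
    (hα : AdmissibleExp α) (h₁ : IsSolution α p₁ Ψ₁ p₀₁) (h₂ : IsSolution α p₂ Ψ₂ p₀₂) {t : ℝ}
    (ht : 0 < t) :
    wNorm U (W1 α a) (2 - aExp α) (fun x => gradBar p₁ Ψ₁ t x - gradBar p₂ Ψ₂ t x) ^ 2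
      ≤ ENNReal.ofReal (4 * (2 + α (Fin.last N)) ^ 2
        * ((∫ x in U, a (Fin.last N) x) + (h₁.toFlow hU hm hα).diss t
          + (h₂.toFlow hU hm hα).diss t) ^ (aExp α / (2 - aExp α))
        * (inner ℝ (fluxL α p₁ t - fluxL α p₂ t) (p₁.gradL t - p₂.gradL t)
          + ‖Ψ₁.gradL t - Ψ₂.gradL t‖ ^ 2)) := by
  have hb0 := hα.aExp_pos
  have hb1 := hα.aExp_lt_one
  have hl := hα.last_pos
  have h2b : 0 < 2 - aExp α := by linarith
  obtain ⟨hS0, hP⟩ := h₁.wNorm_W1_grad_sub_sq_le hU hm hα h₂ ht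
  set S : ℝ := inner ℝ (fluxL α p₁ t - fluxL α p₂ t) (p₁.gradL t - p₂.gradL t)
  have hΦ := wNorm_W1_sq_le_of_ae hU hm hα
    ((Ψ₁.aestronglyMeasurable_grad ht).sub (Ψ₂.aestronglyMeasurable_grad ht))
    (coeFn_sub_ae (Ψ₁.gradL_ae ht) (Ψ₂.gradL_ae ht))
  have hB0 := integral_last_nonneg hU hm
  set B := ∫ x in U, a (Fin.last N) x
  have hd₁ : 0 ≤ (h₁.toFlow hU hm hα).diss t := Flow.diss_nonneg ht
  have hd₂ : 0 ≤ (h₂.toFlow hU hm hα).diss t := Flow.diss_nonneg ht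
  set Λ := B + (h₁.toFlow hU hm hα).diss t + (h₂.toFlow hU hm hα).diss t with hΛ
  set c := 2 * (2 + α (Fin.last N)) ^ 2 with hc
  have hc1 : 1 ≤ c := by rw [hc]; nlinarith
  have hΛ0 : 0 ≤ Λ := by positivity
  set Y := ‖Ψ₁.gradL t - Ψ₂.gradL t‖ ^ 2
  have hY : 0 ≤ Y := sq_nonneg _
  have hP' := le_ofReal_sqrt_of_sq_le (by positivity) hP
  have hΦ' := le_ofReal_sqrt_of_sq_le (by positivity) hΦ
  have htri : wNorm U (W1 α a) (2 - aExp α) (fun x => gradBar p₁ Ψ₁ t x - gradBar p₂ Ψ₂ t x)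
      ≤ ENNReal.ofReal (Real.sqrt (c * S * Λ ^ (aExp α / (2 - aExp α)))
        + Real.sqrt (Y * B ^ (aExp α / (2 - aExp α)))) := by
    rw [ENNReal.ofReal_add (Real.sqrt_nonneg _) (Real.sqrt_nonneg _)]
    refine le_trans (le_of_eq ?_) ((wNorm_W1_sub_le hU hm hα
      ((p₁.aestronglyMeasurable_grad ht).sub (p₂.aestronglyMeasurable_grad ht))
      ((Ψ₁.aestronglyMeasurable_grad ht).sub (Ψ₂.aestronglyMeasurable_grad ht))).trans
      (add_le_add hP' hΦ'))
    congr 1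
    ext1 x
    simp only [gradBar, Pi.sub_apply]
    abel
  refine (pow_le_pow_left' htri 2).trans ?_
  rw [← ENNReal.ofReal_pow (by positivity)]
  refine ENNReal.ofReal_le_ofReal ?_
  have e1 := Real.sq_sqrt (by positivity : 0 ≤ c * S * Λ ^ (aExp α / (2 - aExp α)))
  have e2 := Real.sq_sqrt (by positivity : 0 ≤ Y * B ^ (aExp α / (2 - aExp α)))
  have e3 : B ^ (aExp α / (2 - aExp α)) ≤ Λ ^ (aExp α / (2 - aExp α)) :=
    Real.rpow_le_rpow hB0 (by linarith) (by positivity)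
  have e4 : Y * B ^ (aExp α / (2 - aExp α)) ≤ c * Y * Λ ^ (aExp α / (2 - aExp α)) := by
    have : Y ≤ c * Y := le_mul_of_one_le_left hY hc1
    gcongr
  calc _ ≤ 2 * (Real.sqrt (c * S * Λ ^ (aExp α / (2 - aExp α))) ^ 2
        + Real.sqrt (Y * B ^ (aExp α / (2 - aExp α))) ^ 2) := add_sq_le
    _ ≤ 2 * (c * S * Λ ^ (aExp α / (2 - aExp α)) + c * Y * Λ ^ (aExp α / (2 - aExp α))) := by
        rw [e1, e2]; gcongr
    _ = _ := by rw [hc]; ring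

theorem D_eq (hU : MeasurableSet U) (hm : IsMedium U φ a) {t : ℝ} (ht : 0 < t) :
    D Ψ₁ Ψ₂ t = ‖Ψ₁.gradL t - Ψ₂.gradL t‖ ^ 2 + ‖Ψ₁.gradL t - Ψ₂.gradL t‖
      + ‖Ψ₁.dtL t - Ψ₂.dtL t‖ := by
  rw [D, wInt_two_eq_norm_sq hU hm.inv_meas hm.inv_nonneg
    (coeFn_sub_ae (Ψ₁.gradL_ae ht) (Ψ₂.gradL_ae ht)),
    wInt_two_eq_norm_sq hU hm.porosity_meas hm.porosity_nonneg
    (coeFn_sub_ae (Ψ₁.dtL_ae ht) (Ψ₂.dtL_ae ht)), ← Real.sqrt_eq_rpow, ← Real.sqrt_eq_rpow,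
    Real.sqrt_sq (norm_nonneg _), Real.sqrt_sq (norm_nonneg _)]

theorem intG12_nonneg (hU : MeasurableSet U) (hm : IsMedium U φ a) (t : ℝ) :
    0 ≤ intG12 Ψ₁ Ψ₂ t :=
  intervalIntegral.integral_nonneg (by linarith) fun τ _ =>
    add_nonneg (add_nonneg (wInt_nonneg hU hm.inv_nonneg _) (wInt_nonneg hU hm.inv_nonneg _))
      (add_nonneg (wInt_nonneg hU hm.porosity_nonneg _) (wInt_nonneg hU hm.porosity_nonneg _))

theorem intG12_eq (hU : MeasurableSet U) (hm : IsMedium U φ a)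
    (hα : AdmissibleExp α) (h₁ : IsSolution α p₁ Ψ₁ p₀₁) (h₂ : IsSolution α p₂ Ψ₂ p₀₂) {t : ℝ}
    (ht : 1 < t) :
    intG12 Ψ₁ Ψ₂ t = (∫ τ in (t - 1)..t, (h₁.toFlow hU hm hα).source τ)
      + ∫ τ in (t - 1)..t, (h₂.toFlow hU hm hα).source τ := by
  have h0 : 0 < t - 1 := by linarith
  rw [← intervalIntegral.integral_add (Flow.intervalIntegrable_source h0 (by linarith))
    (Flow.intervalIntegrable_source h0 (by linarith))]
  refine intervalIntegral.integral_congr fun τ hτ => ?_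
  rw [uIcc_of_le (by linarith)] at hτ
  have hτ0 : 0 < τ := h0.trans_le hτ.1
  simp only [G1, G2]
  rw [wInt_two_eq_norm_sq hU hm.inv_meas hm.inv_nonneg (Ψ₁.gradDtL_ae hτ0),
    wInt_two_eq_norm_sq hU hm.inv_meas hm.inv_nonneg (Ψ₂.gradDtL_ae hτ0),
    wInt_two_eq_norm_sq hU hm.porosity_meas hm.porosity_nonneg (Ψ₁.dttL_ae hτ0),
    wInt_two_eq_norm_sq hU hm.porosity_meas hm.porosity_nonneg (Ψ₂.dttL_ae hτ0)]
  change _ = (‖Ψ₁.gradDtL τ‖ ^ 2 + ‖Ψ₁.dttL τ‖ ^ 2) + (‖Ψ₂.gradDtL τ‖ ^ 2 + ‖Ψ₂.dttL τ‖ ^ 2)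
  ring

/-- An infinite limit superior makes G exceed any level at some time, and a monotone majorant stays
above that level afterwards. -/
theorem IsMajorant.tendsto {M : ℝ → ℝ} (hM : IsMajorant α Ψ M) (h : limA α Ψ = ⊤) :
    Tendsto M atTop atTop := by
  refine tendsto_atTop.2 fun B => ?_
  have hlt : ENNReal.ofReal B < limsup (fun t => ENNReal.ofReal (G α Ψ t)) atTop := by
    rw [limA] at h; rw [h]; exact ENNReal.ofReal_lt_top
  obtain ⟨T, hT, hT0⟩ := ((frequently_lt_of_lt_limsup (h := hlt)).and_eventually
    (eventually_ge_atTop 0)).exists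
  have hBG : B < G α Ψ T := lt_of_not_ge fun h => hT.not_ge (ENNReal.ofReal_le_ofReal h)
  filter_upwards [eventually_ge_atTop T] with t ht
  exact hBG.le.trans ((hM.ge T hT0).trans (hM.mono hT0 (le_trans hT0 ht) ht))

/-- In both cases `V` dominates `G̃`, and the size of both flows for large times. -/
theorem exists_size_le_V (hα : AdmissibleExp α) {cP : ℝ} (hcP : 0 < cP) :
    ∃ C > 0, ∀ (U : Set (E n)) (hU : MeasurableSet U) (φ : E n → ℝ) (a : Fin (N + 1) → E n → ℝ)
      (hm : IsMedium U φ a) (p₁ p₂ Ψ₁ Ψ₂ : RegFun U φ (a 0)) (p₀₁ p₀₂ : E n → ℝ)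
      (h₁ : IsSolution α p₁ Ψ₁ p₀₁) (h₂ : IsSolution α p₂ Ψ₂ p₀₂),
      (∀ t > 0, PoincareSobolev U φ α a cP (bar p₁ Ψ₁ t) (gradBar p₁ Ψ₁ t)) →
      (∀ t > 0, PoincareSobolev U φ α a cP (bar p₂ Ψ₂ t) (gradBar p₂ Ψ₂ t)) →
      limA α Ψ₁ + limA α Ψ₂ = ⊤ →
      ∀ V : ℝ → ℝ, (IsGeneralV α Ψ₁ Ψ₂ V ∨ IsFiniteBV α Ψ₁ Ψ₂ V) →
      (∀ t ≥ 1, G α Ψ₁ t + G α Ψ₂ t ≤ V t) ∧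
      (∀ᶠ t in atTop, (h₁.toFlow hU hm hα).size t ≤ C * V t) ∧
      (∀ᶠ t in atTop, (h₂.toFlow hU hm hα).size t ≤ C * V t) := by
  have hb0 := hα.aExp_pos
  have hb1 := hα.aExp_lt_one
  set b := aExp α
  have hC₀ : 0 < (2 * cP) ^ (2 - b) := by positivity
  obtain ⟨A₁, hA₁, hgen⟩ := exists_size_le_of_monotone hb0 hb1 hC₀
  obtain ⟨A₂, hA₂, hfin⟩ := exists_size_le_of_deriv_ge hb0 hb1 hC₀
  set q := 1 / (1 - b) with hq
  have hq1 : 1 ≤ q := by rw [hq, le_div_iff₀ (by linarith)]; linarith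
  set k : ℝ := 2 ^ (q - 1) with hk
  have hk0 : 0 < k := by positivity
  refine ⟨A₁ + A₂ * (1 + k), by positivity, fun U hU φ a hm p₁ p₂ Ψ₁ Ψ₂ p₀₁ p₀₂ h₁ h₂ hP₁ hP₂ hA V
    hV => ?_⟩
  -- The sum over both boundary data controls each flow. It tends to be estimated only through V,
  -- which is built from the same sum.
  set Γ : ℝ → ℝ := fun t => G α Ψ₁ t + G α Ψ₂ t with hΓ
  have hG₁ : ∀ t, 1 ≤ G α Ψ₁ t := fun t => one_le_G hU hm t
  have hG₂ : ∀ t, 1 ≤ G α Ψ₂ t := fun t => one_le_G hU hm t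
  have hΓ1 : ∀ t, 1 ≤ Γ t := fun t => by simp only [hΓ]; linarith [hG₁ t, hG₂ t]
  have hc₁ := h₁.controlled hU hm hα hcP hP₁ (Γ := Γ) fun t _ => by
    simp only [hΓ]; linarith [hG₂ t]
  have hc₂ := h₂.controlled hU hm hα hcP hP₂ (Γ := Γ) fun t _ => by
    simp only [hΓ]; linarith [hG₁ t]
  have hint0 := intG12_nonneg (Ψ₁ := Ψ₁) (Ψ₂ := Ψ₂) hU hm
  have hs : ∀ t > 1, (∫ τ in (t - 1)..t, (h₁.toFlow hU hm hα).source τ) ≤ intG12 Ψ₁ Ψ₂ t ∧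
      (∫ τ in (t - 1)..t, (h₂.toFlow hU hm hα).source τ) ≤ intG12 Ψ₁ Ψ₂ t := fun t ht => by
    have n₁ : 0 ≤ ∫ τ in (t - 1)..t, (h₁.toFlow hU hm hα).source τ :=
      intervalIntegral.integral_nonneg (by linarith) fun _ _ => Flow.source_nonneg _
    have n₂ : 0 ≤ ∫ τ in (t - 1)..t, (h₂.toFlow hU hm hα).source τ :=
      intervalIntegral.integral_nonneg (by linarith) fun _ _ => Flow.source_nonneg _
    rw [intG12_eq hU hm hα h₁ h₂ ht]
    constructor <;> linarith
  rcases hV with ⟨M₁, M₂, hM₁, hM₂, hV⟩ | ⟨hd₁, hd₂, hB, hV⟩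
  · set M : ℝ → ℝ := fun t => M₁ t + M₂ t with hMdef
    have hΓM : ∀ t ≥ 0, Γ t ≤ M t := fun t ht => add_le_add (hM₁.ge t ht) (hM₂.ge t ht)
    have hmono : MonotoneOn M (Ici 0) := hM₁.mono.add hM₂.mono
    have hM1 : ∀ t ≥ 0, 1 ≤ M t := fun t ht => (hΓ1 t).trans (hΓM t ht)
    have hlim : Tendsto M atTop atTop := by
      rcases ENNReal.add_eq_top.1 hA with h | h
      · refine tendsto_atTop_mono' _ ?_ (hM₁.tendsto h)
        filter_upwards [eventually_ge_atTop 0] with t ht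
        simp only [hMdef]; linarith [hM₂.ge t ht, hG₂ t]
      · refine tendsto_atTop_mono' _ ?_ (hM₂.tendsto h)
        filter_upwards [eventually_ge_atTop 0] with t ht
        simp only [hMdef]; linarith [hM₁.ge t ht, hG₁ t]
    have hVM : ∀ t ≥ 1, V t = M t ^ (2 / (2 - b)) + intG12 Ψ₁ Ψ₂ t := hV
    have hV0 : ∀ t ≥ 1, 0 ≤ V t := fun t ht => by
      rw [hVM t ht]
      exact add_nonneg (Real.rpow_nonneg (by linarith [hM1 t (by linarith)]) _) (hint0 t)
    have hCle : ∀ t ≥ 1, A₁ * V t ≤ (A₁ + A₂ * (1 + k)) * V t := fun t ht =>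
      mul_le_mul_of_nonneg_right (by linarith [mul_pos hA₂ (by linarith : 0 < 1 + k)]) (hV0 t ht)
    refine ⟨fun t ht => ?_, ?_, ?_⟩
    · rw [hVM t ht]
      have := le_rpow_two_div hb0 hb1 (hM1 t (by linarith))
      have h2 := hΓM t (by linarith)
      simp only [hΓ] at h2
      linarith [hint0 t]
    · filter_upwards [hgen _ Γ M hc₁ (fun t ht => hΓM t (le_of_lt ht)) hmono hlim,
        eventually_gt_atTop 1] with t h ht
      refine h.trans (le_trans ?_ (hCle t ht.le))
      rw [hVM t ht.le]
      gcongr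
      exact (hs t ht).1
    · filter_upwards [hgen _ Γ M hc₂ (fun t ht => hΓM t (le_of_lt ht)) hmono hlim,
        eventually_gt_atTop 1] with t h ht
      refine h.trans (le_trans ?_ (hCle t ht.le))
      rw [hVM t ht.le]
      gcongr
      exact (hs t ht).2
  · have hB₁ : limB α Ψ₁ ≠ ⊤ := (le_self_add.trans_lt hB).ne
    have hB₂ : limB α Ψ₂ ≠ ⊤ := (le_add_self.trans_lt hB).ne
    set β := (limB α Ψ₁ + limB α Ψ₂).toReal with hβ
    have hβ0 : 0 ≤ β := ENNReal.toReal_nonneg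
    have hβs : β = (limB α Ψ₁).toReal + (limB α Ψ₂).toReal := ENNReal.toReal_add hB₁ hB₂
    have hder : ∀ t > 0, HasDerivAt Γ (deriv (G α Ψ₁) t + deriv (G α Ψ₂) t) t := fun t ht => by
      have e₁ := ((hd₁.differentiableOn one_ne_zero) t ht).differentiableAt (Ioi_mem_nhds ht)
      have e₂ := ((hd₂.differentiableOn one_ne_zero) t ht).differentiableAt (Ioi_mem_nhds ht)
      exact e₁.hasDerivAt.add e₂.hasDerivAt
    -- Each limit superior is an eventual bound up to 1/2; the resulting β + 1 is also at least 1,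
    -- as the comparison lemma requires.
    have hge : ∀ᶠ t in atTop, -(β + 1) ≤ deriv (G α Ψ₁) t + deriv (G α Ψ₂) t := by
      filter_upwards [eventually_le_limsup_toReal_add (R := fun t => -deriv (G α Ψ₁) t)
          (δ := 1 / 2) (by norm_num) hB₁,
        eventually_le_limsup_toReal_add (R := fun t => -deriv (G α Ψ₂) t)
          (δ := 1 / 2) (by norm_num) hB₂] with t e₁ e₂
      have e₁' : -deriv (G α Ψ₁) t ≤ (limB α Ψ₁).toReal + 1 / 2 := e₁
      have e₂' : -deriv (G α Ψ₂) t ≤ (limB α Ψ₂).toReal + 1 / 2 := e₂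
      linarith
    have hVΓ : ∀ t ≥ 1, V t = β ^ q + Γ t ^ (2 / (2 - b)) + intG12 Ψ₁ Ψ₂ t := hV
    have hβq : 0 ≤ β ^ q := by positivity
    have hΓle : ∀ t, Γ t ≤ Γ t ^ (2 / (2 - b)) := fun t => le_rpow_two_div hb0 hb1 (hΓ1 t)
    -- The price of replacing β by β + 1; the extra 1 is absorbed by the power of Γ, which is at
    -- least 1.
    have hβ1 : (β + 1) ^ q ≤ k * (β ^ q + 1) := by
      have := add_rpow_le_mul_rpow_add_rpow hβ0 zero_le_one hq1
      rwa [Real.one_rpow] at this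
    have hfinal : ∀ t ≥ 1, ∀ I ≤ intG12 Ψ₁ Ψ₂ t,
        A₂ * (Γ t ^ (2 / (2 - b)) + (β + 1) ^ q + I) ≤ (A₁ + A₂ * (1 + k)) * V t := by
      intro t ht I hI
      have h1 : 1 ≤ Γ t ^ (2 / (2 - b)) := (hΓ1 t).trans (hΓle t)
      have h2 : Γ t ^ (2 / (2 - b)) + (β + 1) ^ q + I ≤ (1 + k) * V t := by
        rw [hVΓ t ht]
        nlinarith [mul_nonneg hk0.le (hint0 t), mul_nonneg hk0.le (sub_nonneg.2 h1)]
      have hV0 : 0 ≤ V t := by rw [hVΓ t ht]; linarith [hint0 t]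
      calc _ ≤ A₂ * ((1 + k) * V t) := by gcongr
        _ ≤ _ := by nlinarith [mul_nonneg hA₁.le hV0]
    refine ⟨fun t ht => ?_, ?_, ?_⟩
    · have := hΓle t
      simp only [hΓ] at this hVΓ
      rw [hVΓ t ht]
      linarith [hint0 t]
    · filter_upwards [hfin _ Γ _ (β + 1) hc₁ (by linarith) hder hge, eventually_gt_atTop 1]
        with t h ht
      exact h.trans (hfinal t ht.le _ (hs t ht).1)
    · filter_upwards [hfin _ Γ _ (β + 1) hc₂ (by linarith) hder hge, eventually_gt_atTop 1]
        with t h ht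
      exact h.trans (hfinal t ht.le _ (hs t ht).2)

end Control

end Forchheimer

end

/-! ### Assembly of the theorem -/

open Forchheimer
theorem mainTheorem9 {n N : ℕ} (hn : 2 ≤ n) (hN : 1 ≤ N)
    (U : Set (E n)) (hUo : IsOpen U) (hUc : IsConnected U) (hUb : Bornology.IsBounded U)
    (α : Fin (N + 1) → ℝ) (hα0 : α 0 = 0) (hα : StrictMono α)
    (cP : ℝ) (hcP : 0 < cP) :
    ∃ C : ℝ, 0 < C ∧
      ∀ (φ : E n → ℝ) (a : Fin (N + 1) → E n → ℝ), IsMedium U φ a →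
      ∀ (p₁ p₂ Ψ₁ Ψ₂ : RegFun U φ (a 0)) (p₀₁ p₀₂ : E n → ℝ),
        IsSolution α p₁ Ψ₁ p₀₁ → IsSolution α p₂ Ψ₂ p₀₂ →
        (∀ t > 0, PoincareSobolev U φ α a cP (bar p₁ Ψ₁ t) (gradBar p₁ Ψ₁ t)) →
        (∀ t > 0, PoincareSobolev U φ α a cP (bar p₂ Ψ₂ t) (gradBar p₂ Ψ₂ t)) →
        (∀ t > 0, PoincareSobolev U φ α a cP
          (fun x => bar p₁ Ψ₁ t x - bar p₂ Ψ₂ t x)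
          (fun x => gradBar p₁ Ψ₁ t x - gradBar p₂ Ψ₂ t x)) →
        limA α Ψ₁ + limA α Ψ₂ = ⊤ →
        ∀ V : ℝ → ℝ, (IsGeneralV α Ψ₁ Ψ₂ V ∨ IsFiniteBV α Ψ₁ Ψ₂ V) →
        ∫⁻ t in Ioi (1 : ℝ), ENNReal.ofReal (V t ^ (-(aExp α / (2 - aExp α)))) = ⊤ →
        (∀ᶠ t in atTop, DifferentiableAt ℝ (fun s => V s ^ (aExp α / (2 - aExp α))) t) →
        Tendsto (deriv fun s => V s ^ (aExp α / (2 - aExp α))) atTop (𝓝 0) →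
        limsup (fun t => wNorm U (W1 α a) (2 - aExp α)
            (fun x => gradBar p₁ Ψ₁ t x - gradBar p₂ Ψ₂ t x) ^ 2) atTop
          ≤ ENNReal.ofReal C *
              limsup (fun t => ENNReal.ofReal
                ((V t ^ (3 * kappa0 α) * D Ψ₁ Ψ₂ t) ^ (1 / 2 : ℝ))) atTop
            + ENNReal.ofReal C *
              limsup (fun t => ENNReal.ofReal (V t ^ kappa0 α * D Ψ₁ Ψ₂ t)) atTop := by
  have hexp : AdmissibleExp α := ⟨hN, hα0, hα⟩
  have hU : MeasurableSet U := hUo.measurableSet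
  have hl := hexp.last_pos
  obtain ⟨C₁, hC₁, hsize⟩ := exists_size_le_V (n := n) hexp hcP
  -- One constant serves two bounds: c_P² for the Poincaré inequality of P̄ and 4(2+α_N)² for the
  -- Hölder bound of ∇P̄.
  obtain ⟨C, hC, hmain⟩ := Flow.limsup_difference_le (C₀ := cP ^ 2 + 4 * (2 + α (Fin.last N)) ^ 2)
    hexp.aExp_pos hexp.aExp_lt_one (by positivity) hC₁
  refine ⟨C, hC, fun φ a hm p₁ p₂ Ψ₁ Ψ₂ p₀₁ p₀₂ h₁ h₂ hP₁ hP₂ hP hA V hV hint hdiff hder => ?_⟩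
  obtain ⟨hGV, hs₁, hs₂⟩ := hsize U hU φ a hm p₁ p₂ Ψ₁ Ψ₂ p₀₁ p₀₂ h₁ h₂ hP₁ hP₂ hA V hV
  -- The squared norm is finite for t > 0 by the Hölder bound, so passing to a real number changes
  -- nothing in the limit superior.
  set Z : ℝ → ℝ := fun t => (wNorm U (W1 α a) (2 - aExp α)
    (fun x => gradBar p₁ Ψ₁ t x - gradBar p₂ Ψ₂ t x) ^ 2).toReal with hZdef
  have hbound := fun t (ht : 0 < t) => wNorm_W1_gradBar_sub_sq_le hU hm hexp h₁ h₂ ht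
  have hfin : ∀ t > 0, wNorm U (W1 α a) (2 - aExp α)
      (fun x => gradBar p₁ Ψ₁ t x - gradBar p₂ Ψ₂ t x) ^ 2 ≠ ⊤ := fun t ht =>
    ((hbound t ht).trans_lt ENNReal.ofReal_lt_top).ne
  have hB0 := integral_last_nonneg hU hm
  have hG₁ : ∀ t, 1 ≤ G α Ψ₁ t := fun t => one_le_G hU hm t
  have hG₂ : ∀ t, 1 ≤ G α Ψ₂ t := fun t => one_le_G hU hm t
  have hcongr : (fun t => wNorm U (W1 α a) (2 - aExp α)
      (fun x => gradBar p₁ Ψ₁ t x - gradBar p₂ Ψ₂ t x) ^ 2)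
      =ᶠ[atTop] fun t => ENNReal.ofReal (Z t) := by
    filter_upwards [eventually_gt_atTop 0] with t ht
    rw [hZdef, ENNReal.ofReal_toReal (hfin t ht)]
  rw [limsup_congr hcongr]
  refine hmain (h₁.toFlow hU hm hexp) (h₂.toFlow hU hm hexp) V
    (fun _ => ∫ x in U, a (Fin.last N) x) Z
    (fun s hs t ht => h₁.inner_dtL_eq hU hm hexp h₂ hs ht)
    (fun s hs t ht => h₂.inner_dtL_eq hU hm hexp h₁ hs ht) (fun t ht => ?_) (fun t ht => ?_)
    (fun t _ => hB0) (fun t ht => ?_) (fun t ht => ?_) hs₁ hs₂ hdiff hder hint _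
    fun t ht => D_eq hU hm ht
  · have hd₁ : 0 ≤ (h₁.toFlow hU hm hexp).diss t := Flow.diss_nonneg ht
    have hd₂ : 0 ≤ (h₂.toFlow hU hm hexp).diss t := Flow.diss_nonneg ht
    have hS := (h₁.wNorm_W1_grad_sub_sq_le hU hm hexp h₂ ht).1
    have h2b : 0 < 2 - aExp α := by linarith [hexp.aExp_lt_one]
    refine (ENNReal.toReal_le_of_le_ofReal ?_ (hbound t ht)).trans ?_
    · positivity
    · change _ ≤ (cP ^ 2 + 4 * (2 + α (Fin.last N)) ^ 2) * _
        * (inner ℝ (fluxL α p₁ t - fluxL α p₂ t) (p₁.gradL t - p₂.gradL t)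
          + ‖Ψ₁.gradL t - Ψ₂.gradL t‖ ^ 2)
      gcongr
      linarith [sq_nonneg cP]
  · have hn := wNorm_two_eq_norm hU hm.porosity_meas hm.porosity_nonneg
      (coeFn_sub_ae (coeFn_sub_ae (p₁.valL_ae ht) (Ψ₁.valL_ae ht))
        (coeFn_sub_ae (p₂.valL_ae ht) (Ψ₂.valL_ae ht)))
    have h := pow_le_pow_left' (hn.symm.le.trans (hP t ht)) 2
    rw [mul_pow, ← ENNReal.ofReal_pow (norm_nonneg _), ← ENNReal.ofReal_pow hcP.le,
      ← ENNReal.ofReal_toReal (hfin t ht), ← ENNReal.ofReal_mul (sq_nonneg _)] at h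
    have hZ0 : 0 ≤ Z t := ENNReal.toReal_nonneg
    have h' := (ENNReal.ofReal_le_ofReal_iff (mul_nonneg (sq_nonneg cP) hZ0)).1 h
    refine h'.trans ?_
    have : 0 ≤ 4 * (2 + α (Fin.last N)) ^ 2 * Z t := by positivity
    linarith
  · exact ((le_max_left _ _).trans (max_integral_le_G (α := α) (Ψ := Ψ₁) hU hm t)).trans
      (le_trans (by linarith [hG₂ t]) (hGV t ht))
  · linarith [hGV t ht, hG₁ t, hG₂ t]
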